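/- Let $S=\mathbb{C}[x,y,z]$ with its standard grading. A line arrangement $\mathcal{A}: f=0$ of $d$ lines in $\mathbb{P}^2=\mathbb{P}^2(\mathbb{C})$ is given by $f=\ell_1\cdots\ell_d$ with $\ell_1,\dots,\ell_d\in S_1$ nonzero and pairwise non-proportional. Let $AR(f)=\{(a,b,c)\in S^3 : af_x+bf_y+cf_z=0\}$, a graded $S$-module, let $mdr(f)$ be the smallest $r\ge 0$ such that $AR(f)$ contains a nonzero triple with $a,b,c\in S_r$, and let $M(f)=S/(f_x,f_y,f_z)$. The arrangement is *free* if $AR(f)\cong S(-d_1)\oplus S(-d_2)$ as graded $S$-modules for some integers $d_1,d_2\ge 0$. It is *nearly free* if $M(f)$ has a minimal graded free resolution $$0\to S(-d-d_2)\to S(-d-d_1+1)\oplus S(-d-d_2+1)^2\to S(-d+1)^3\xrightarrow{(f_x,f_y,f_z)} S$$ for some integers $1\le d_1\le d_2$. The intersection lattice $L(\mathcal{A})$ is the set of all intersections of lines of $\mathcal{A}$ (including the empty intersection $\mathbb{P}^2$), ordered by reverse inclusion, and lattices are considered up to isomorphism. The multiplicity of a point is the number of lines of $\mathcal{A}$ through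 it. For $2\le m\le d$, let $L(d,m)$ be the intersection lattice of an arrangement of $d$ lines with one point of multiplicity $m$ and only double points apart from that. For $3\le m_1\le m_2$, let $\hat L(m_1,m_2)$ be the intersection lattice of an arrangement of $m_1+m_2-1$ lines, one of which contains a point of multiplicity $m_1$ and another point of multiplicity $m_2$, with only double points apart from these two. Let $\mathcal{A}(2,2,3)$ be the arrangement $(x^2-y^2)(x^2-z^2)(y^2-z^2)=0$. **Corollary 4.10.** Let $\mathcal{A}: f=0$ be an arrangement of $d\ge 4$ lines in $\mathbb{P}^2$. If $mdr(f)\le 2$, then $\mathcal{A}$ is either free or nearly free (and not both). Moreover, if $mdr(f)\le 2$, then $L(\mathcal{A})$ determines $mdr(f)$ and whether $\mathcal{A}$ is free or nearly free: every line arrangement $\mathcal{B}: g=0$ with $L(\mathcal{B})\cong L(\mathcal{A})$ satisfies $mdr(g)=mdr(f)$, is free if and only if $\mathcal{A}$ is free, and is nearly free if and only if $\mathcal{A}$ is nearly free. In fact: 1. $mdr(f)=0$ if and only if $L(\mathcal{A})\cong L(d,d)$; 2. $mdr(f)=1$ if and only if $L(\mathcal{A})\cong L(d,d-1)$; 3.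 $mdr(f)=2$ if and only if $L(\mathcal{A})$ is isomorphic to $L(d,d-2)$, to $\hat L(3,d-2)$ (which is possible only for $d\ge 5$), or to $L(\mathcal{A}(2,2,3))$ (which is possible only for $d=6$). -/

import Mathlib

open scoped LinearAlgebra.Projectivization

/-- The graded polynomial ring `S = ℂ[x, y, z]` (standard grading by total degree). -/
abbrev PolyXYZ : Type := MvPolynomial (Fin 3) ℂ

/-- The `S`-linear map `S³ → S`, `(a, b, c) ↦ a f_x + b f_y + c f_z`. Its range is the Jacobian
ideal `J_f` and its cokernel is the Milnor algebra `M(f) = S / J_f`. -/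
noncomputable def jacobianMap (f : PolyXYZ) : (Fin 3 → PolyXYZ) →ₗ[PolyXYZ] PolyXYZ :=
  Fintype.linearCombination PolyXYZ fun j => MvPolynomial.pderiv j f

/-- The module `AR(f)` of all Jacobian syzygies of `f`. -/
noncomputable def jacobianSyzygies (f : PolyXYZ) : Submodule PolyXYZ (Fin 3 → PolyXYZ) :=
  LinearMap.ker (jacobianMap f)

theorem mem_jacobianSyzygies {f : PolyXYZ} {s : Fin 3 → PolyXYZ} :
    s ∈ jacobianSyzygies f ↔ s 0 * MvPolynomial.pderiv 0 f + s 1 * MvPolynomial.pderiv 1 f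
      + s 2 * MvPolynomial.pderiv 2 f = 0 := by
  simp [jacobianSyzygies, jacobianMap, Fintype.linearCombination_apply, Fin.sum_univ_three]

/-- A triple of polynomials all of whose entries are homogeneous of degree `r`
(an element of `(S_r)³`). -/
def IsHomogeneousTriple (s : Fin 3 → PolyXYZ) (r : ℕ) : Prop :=
  ∀ j, (s j).IsHomogeneous r

/-- `mdr(f)`: the smallest `r ≥ 0` such that there is a nontrivial relation
`a f_x + b f_y + c f_z = 0` with `a, b, c ∈ S_r`. For homogeneous `f` such an `r` exists, see
`exists_homogeneous_jacobianSyzygy`. -/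
noncomputable def mdr (f : PolyXYZ) : ℕ :=
  sInf {r : ℕ | ∃ s ∈ jacobianSyzygies f, s ≠ 0 ∧ IsHomogeneousTriple s r}

theorem exists_homogeneous_jacobianSyzygy {f : PolyXYZ} {d : ℕ} (hf : f.IsHomogeneous d) :
    {r : ℕ | ∃ s ∈ jacobianSyzygies f, s ≠ 0 ∧ IsHomogeneousTriple s r}.Nonempty := by
  have hp : ∀ j, (MvPolynomial.pderiv j f).IsHomogeneous (d - 1) := fun j => hf.pderiv
  by_cases h0 : MvPolynomial.pderiv 0 f = 0
  · refine ⟨0, ![1, 0, 0], ?_, ?_, ?_⟩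
    · simp [mem_jacobianSyzygies, h0]
    · intro h
      simpa using congrFun h 0
    · intro j
      fin_cases j
      · exact MvPolynomial.isHomogeneous_one _ _
      · exact MvPolynomial.isHomogeneous_zero _ _ _
      · exact MvPolynomial.isHomogeneous_zero _ _ _
  · refine ⟨d - 1, ![MvPolynomial.pderiv 1 f, - MvPolynomial.pderiv 0 f, 0], ?_, ?_, ?_⟩
    · simp [mem_jacobianSyzygies]
      ring
    · intro h
      exact h0 (by simpa using congrFun h 1)
    · intro j
      fin_cases j
      · exact hp 1
      · exact (hp 0).neg
      · exact MvPolynomial.isHomogeneous_zero _ _ _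

/-- The curve `f = 0` is free: `AR(f) ≅ S(-d₁) ⊕ S(-d₂)` as graded `S`-modules, that is, `AR(f)`
has a basis consisting of a homogeneous syzygy of degree `d₁` and one of degree `d₂`. -/
def IsFreeCurve (f : PolyXYZ) : Prop :=
  ∃ (d₁ d₂ : ℕ) (b : Module.Basis (Fin 2) PolyXYZ (jacobianSyzygies f)),
    IsHomogeneousTriple (b 0 : Fin 3 → PolyXYZ) d₁ ∧
    IsHomogeneousTriple (b 1 : Fin 3 → PolyXYZ) d₂

/-- The curve `f = 0`, with `f` homogeneous of degree `d`, is nearly free: for some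
`1 ≤ d₁ ≤ d₂` the Milnor algebra `M(f) = S / J_f` has a minimal graded free resolution
`0 → S(-d-d₂) → S(-d-d₁+1) ⊕ S(-d-d₂+1)² → S(-d+1)³ → S`,
the last map being `(f_x, f_y, f_z)`.
The middle map sends the three basis vectors to the triples `ρ 0, ρ 1, ρ 2`, of degrees
`d₁, d₂, d₂`, and the first map sends `1` to `η`, whose entries have degrees `d₂ - d₁ + 1, 1, 1`.
All these degrees are positive, so the entries of both matrices lie in the maximal ideal
`(x, y, z)` and the resolution is minimal. -/
def IsNearlyFreeCurve (f : PolyXYZ) : Prop :=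
  ∃ (d₁ d₂ : ℕ) (ρ : Fin 3 → Fin 3 → PolyXYZ) (η : Fin 3 → PolyXYZ),
    1 ≤ d₁ ∧ d₁ ≤ d₂ ∧
    IsHomogeneousTriple (ρ 0) d₁ ∧ IsHomogeneousTriple (ρ 1) d₂ ∧ IsHomogeneousTriple (ρ 2) d₂ ∧
    (η 0).IsHomogeneous (d₂ - d₁ + 1) ∧ (η 1).IsHomogeneous 1 ∧ (η 2).IsHomogeneous 1 ∧
    Function.Injective (LinearMap.toSpanSingleton PolyXYZ (Fin 3 → PolyXYZ) η) ∧
    Function.Exact (LinearMap.toSpanSingleton PolyXYZ (Fin 3 → PolyXYZ) η)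
      (Fintype.linearCombination PolyXYZ ρ) ∧
    Function.Exact (Fintype.linearCombination PolyXYZ ρ) (jacobianMap f)

/-- An arrangement of `d` distinct lines in the complex projective plane, given by `d` nonzero
linear forms `a x + b y + c z` (through their coefficient vectors `(a, b, c)`), no two of which are
proportional. -/
structure LineArrangement (d : ℕ) where
  coeff : Fin d → Fin 3 → ℂ
  coeff_ne_zero : ∀ i, coeff i ≠ 0
  coeff_distinct : ∀ i j, i ≠ j → LinearIndependent ℂ ![coeff i, coeff j]

namespace LineArrangement

variable {d : ℕ} (A : LineArrangement d)

/-- The `i`-th linear form of the arrangement. -/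
noncomputable def linearForm (i : Fin d) : PolyXYZ :=
  ∑ j, MvPolynomial.C (A.coeff i j) * MvPolynomial.X j

/-- The defining polynomial `f` of the arrangement `𝒜 : f = 0`. -/
noncomputable def definingPoly : PolyXYZ := ∏ i, A.linearForm i

/-- The `i`-th line, as the plane through the origin of `ℂ³` on which the `i`-th form vanishes. -/
noncomputable def line (i : Fin d) : Submodule ℂ (Fin 3 → ℂ) :=
  LinearMap.ker (Fintype.linearCombination ℂ (A.coeff i))

theorem mem_line {i : Fin d} {v : Fin 3 → ℂ} :
    v ∈ A.line i ↔ MvPolynomial.eval v (A.linearForm i) = 0 := by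
  simp [line, linearForm, Fintype.linearCombination_apply, mul_comm]

/-- The set of all intersections of lines of the arrangement. The empty intersection is the whole
plane (the subspace `⊤` of `ℂ³`), and the empty subset of the plane is the subspace `⊥`. -/
def intersections : Set (Submodule ℂ (Fin 3 → ℂ)) :=
  Set.range fun s : Finset (Fin d) => ⨅ i ∈ s, A.line i

/-- The intersection lattice `L(𝒜)`: all intersections of lines, ordered by reverse inclusion. -/
abbrev intersectionLattice : Type := (↥A.intersections)ᵒᵈ

/-- The intersection lattices of the two arrangements are isomorphic. -/
def SameLattice {d' : ℕ} (B : LineArrangement d') : Prop :=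
  Nonempty (A.intersectionLattice ≃o B.intersectionLattice)

/-- The multiplicity `m_p` of the arrangement at a point `p` of the projective plane: the number of
lines through `p`. -/
noncomputable def mult (p : ℙ ℂ (Fin 3 → ℂ)) : ℕ :=
  {i : Fin d | p.submodule ≤ A.line i}.ncard

/-- The arrangement has one point of multiplicity `m` and only double points apart from that. -/
def HasOneMultiplePoint (m : ℕ) : Prop :=
  2 ≤ m ∧ ∃ p, A.mult p = m ∧ ∀ q, q ≠ p → A.mult q ≤ 2

/-- `L(𝒜)` is the lattice `L(d, m)`, i.e. the lattice of an arrangement of `d` lines with one point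
of multiplicity `m` and only double points apart from that. -/
def HasLatticeL (m : ℕ) : Prop :=
  ∃ B : LineArrangement d, B.HasOneMultiplePoint m ∧ A.SameLattice B

/-- The arrangement has `d = m₁ + m₂ - 1` lines, `m₂ ≥ m₁ ≥ 3`, a line of the arrangement contains
a point of multiplicity `m₁` and another point of multiplicity `m₂`, and there are only double
points apart from that. -/
def HasTwoMultiplePointsOnLine (m₁ m₂ : ℕ) : Prop :=
  3 ≤ m₁ ∧ m₁ ≤ m₂ ∧ d + 1 = m₁ + m₂ ∧
    ∃ p₁ p₂, p₁ ≠ p₂ ∧ A.mult p₁ = m₁ ∧ A.mult p₂ = m₂ ∧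
      (∃ i, p₁.submodule ≤ A.line i ∧ p₂.submodule ≤ A.line i) ∧
      ∀ q, q ≠ p₁ → q ≠ p₂ → A.mult q ≤ 2

/-- `L(𝒜)` is the lattice `L̂(m₁, m₂)`. -/
def HasLatticeLHat (m₁ m₂ : ℕ) : Prop :=
  ∃ B : LineArrangement d, B.HasTwoMultiplePointsOnLine m₁ m₂ ∧ A.SameLattice B

/-- The monomial arrangement `𝒜(2,2,3) : (x² - y²)(x² - z²)(y² - z²) = 0`. -/
def monomial223 : LineArrangement 6 where
  coeff := ![![1, -1, 0], ![1, 1, 0], ![1, 0, -1], ![1, 0, 1], ![0, 1, -1], ![0, 1, 1]]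
  coeff_ne_zero := by
    intro i h
    have h0 := congrFun h 0
    have h1 := congrFun h 1
    fin_cases i <;> simp at h0 h1
  coeff_distinct := by
    intro i j hij
    rw [LinearIndependent.pair_iff]
    intro s t h
    have h0 := congrFun h 0
    have h1 := congrFun h 1
    have h2 := congrFun h 2
    fin_cases i <;> fin_cases j <;> simp at hij h0 h1 h2 ⊢ <;> grind

theorem definingPoly_monomial223 :
    monomial223.definingPoly =
      (MvPolynomial.X 0 ^ 2 - MvPolynomial.X 1 ^ 2) *
      (MvPolynomial.X 0 ^ 2 - MvPolynomial.X 2 ^ 2) *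
      (MvPolynomial.X 1 ^ 2 - MvPolynomial.X 2 ^ 2) := by
  simp [definingPoly, linearForm, monomial223, Fin.prod_univ_six, Fin.sum_univ_three]
  ring

end LineArrangement

/-! Read a triple of forms as a polynomial vector field on ℂ³, and call it logarithmic if it is
tangent to every line. Since the Euler field E satisfies E f = d f, every logarithmic field is a
Jacobian syzygy plus a multiple of E, and no nonzero multiple of E is a syzygy
(`IsLogarithmic.exists_syzygy`, `smul_euler_mem`). So `mdr` is the least degree of a logarithmic
field that is not a multiple of E.

If m lines pass through a point p, the constant field p times the product of the other lines is
logarithmic, so `mdr` is at most d - m (`mdr_le_card_sub`). Conversely, let θ be logarithmic of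
degree r ≤ 2 and not a multiple of E. If more than r + 1 lines pass through p, then det(θ, E, p) has
degree r + 1 and is divisible by all of them, hence vanishes; so θ = aE + bp, and b, of degree r, is
divisible by every line missing p (`card_sdiff_pencil_le`). If some line l meets the others in more
than r + 1 points, θ is parallel to E along l, so θ = lω + gE with ω of degree r - 1 tangent to the
other lines (`exists_tangent_erase`), and one descends. When neither applies for r = 2 and d ≥ 6,
every point lies on at most three lines and every line carries at most three intersection points.
This forces six lines with four triple points; a seventh line would give a Fano plane, impossible
over ℂ. Hence either d - `mdr` lines are concurrent or the arrangement is a copy of 𝒜(2,2,3)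
(`exists_pencil_or_isBraid_of_mdr_le`).

In each case explicit fields settle the algebra. A pencil with at most one further line, or with two
further lines meeting on a line of the pencil, is free by Saito's criterion
`isFreeCurve_of_tripleProd`. Two further lines meeting off the pencil give an explicit resolution
(`isNearlyFreeCurve_of_two_transversals`). For 𝒜(2,2,3) Saito's determinant is a Vandermonde
determinant. A free curve is not nearly free, because two generators of the syzygy module cannot
replace three minimal ones.

Finally, a lattice isomorphism amounts to a bijection of lines preserving concurrency of triples
(`SameLattice.exists_equiv`, `sameLattice_of_concurrent`), so it preserves multiplicities and
incidences, which are all that the case distinction uses. -/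

/-! ### Linear forms, tangency to lines, and the Koszul complex -/

section

open MvPolynomial
open scoped Matrix

/-- A vector of `ℂ³`, as a triple of constant polynomials. -/
noncomputable def constTriple (u : Fin 3 → ℂ) : Fin 3 → PolyXYZ := fun j => C (u j)

/-- The Euler field `(x, y, z)`. -/
noncomputable def eulerTriple : Fin 3 → PolyXYZ := fun j => X j

/-- The linear form with a given coefficient vector. -/
noncomputable def linForm (l : Fin 3 → ℂ) : PolyXYZ := constTriple l ⬝ᵥ eulerTriple

/-- The gradient of a polynomial. -/
noncomputable def grad (f : PolyXYZ) : Fin 3 → PolyXYZ := fun j => pderiv j f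

/-- The scalar triple product `a · (b × c)`. -/
def tripleProd {R : Type*} [CommRing R] (a b c : Fin 3 → R) : R := a ⬝ᵥ (b ⨯₃ c)

theorem tripleProd_expand {R : Type*} [CommRing R] (a b c : Fin 3 → R) :
    tripleProd a b c = a 0 * (b 1 * c 2 - b 2 * c 1) + a 1 * (b 2 * c 0 - b 0 * c 2)
      + a 2 * (b 0 * c 1 - b 1 * c 0) := by
  simp [tripleProd, cross_apply]; simp [Matrix.vecHead, Matrix.vecTail, add_assoc]

theorem dot_expand {R : Type*} [CommRing R] (a b : Fin 3 → R) :
    a ⬝ᵥ b = a 0 * b 0 + a 1 * b 1 + a 2 * b 2 := Matrix.vec3_dotProduct a b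

theorem cross_zero_apply {R : Type*} [CommRing R] (a b : Fin 3 → R) :
    (a ⨯₃ b) 0 = a 1 * b 2 - a 2 * b 1 := by simp [cross_apply]

theorem cross_one_apply {R : Type*} [CommRing R] (a b : Fin 3 → R) :
    (a ⨯₃ b) 1 = a 2 * b 0 - a 0 * b 2 := by simp [cross_apply]

theorem cross_two_apply {R : Type*} [CommRing R] (a b : Fin 3 → R) :
    (a ⨯₃ b) 2 = a 0 * b 1 - a 1 * b 0 := by simp [cross_apply]

/-- Cramer's rule for the scalar triple product. -/
theorem tripleProd_smul {R : Type*} [CommRing R] (a b c t : Fin 3 → R) :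
    tripleProd a b c • t =
      tripleProd t b c • a + tripleProd a t c • b + tripleProd a b t • c := by
  ext j
  fin_cases j <;> simp [tripleProd_expand] <;> ring

/-- The dual form of Cramer's rule: the determinant is controlled by the values of one functional
`l` on the three columns. It turns tangency into divisibility of determinants. -/
theorem linForm_mul_tripleProd {R : Type*} [CommRing R] (l a b c : Fin 3 → R) (j : Fin 3) :
    l j * tripleProd a b c =
      (l ⬝ᵥ a) * (b ⨯₃ c) j + (l ⬝ᵥ b) * (c ⨯₃ a) j + (l ⬝ᵥ c) * (a ⨯₃ b) j := by
  fin_cases j <;>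
    simp [tripleProd_expand, dot_expand, cross_apply] <;> ring

theorem MvPolynomial.coe_decompose_eq_homogeneousComponent {σ R : Type*} [CommRing R]
    (b : MvPolynomial σ R) (j : ℕ) :
    letI := gradedAlgebra (σ := σ) (R := R)
    (DirectSum.decompose (homogeneousSubmodule σ R) b j : MvPolynomial σ R) =
      homogeneousComponent j b :=
  decomposition.decompose'_apply b j

theorem MvPolynomial.homogeneousComponent_mul_of_left {σ R : Type*} [CommRing R]
    {a : MvPolynomial σ R} {i : ℕ} (ha : a.IsHomogeneous i) (b : MvPolynomial σ R) (j : ℕ) :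
    homogeneousComponent (i + j) (a * b) = a * homogeneousComponent j b := by
  classical
  let := gradedAlgebra (σ := σ) (R := R)
  simp only [← coe_decompose_eq_homogeneousComponent]
  exact DirectSum.coe_decompose_mul_add_of_left_mem
    (𝒜 := homogeneousSubmodule σ R) (b := b) (j := j) (a_mem := ha)

/-- A cofactor of a homogeneous polynomial in a homogeneous polynomial is homogeneous. -/
theorem MvPolynomial.IsHomogeneous.of_mul_left {σ R : Type*} [CommRing R] [IsDomain R]
    {a b : MvPolynomial σ R} {i n : ℕ} (ha : a.IsHomogeneous i) (ha0 : a ≠ 0)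
    (hab : (a * b).IsHomogeneous n) : b.IsHomogeneous (n - i) ∧ (n < i → b = 0) := by
  have key : ∀ j, i + j ≠ n → homogeneousComponent j b = 0 := by
    intro j hj
    have h := homogeneousComponent_mul_of_left ha b j
    rw [homogeneousComponent_of_mem (m := i + j) hab, if_neg (by simpa using hj)] at h
    exact (mul_eq_zero.1 h.symm).resolve_left ha0
  by_cases hn : n < i
  · have hb : b = 0 := by
      rw [← sum_homogeneousComponent b]
      exact Finset.sum_eq_zero fun j _ => key j (by omega)
    exact ⟨by rw [hb]; exact isHomogeneous_zero _ _ _, fun _ => hb⟩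
  · refine ⟨?_, fun h => absurd h hn⟩
    rw [← sum_homogeneousComponent b]
    refine IsHomogeneous.sum _ _ _ fun j _ => ?_
    by_cases hj : i + j = n
    · obtain rfl : j = n - i := by omega
      exact homogeneousComponent_isHomogeneous _ _
    · rw [key j hj]; exact isHomogeneous_zero _ _ _

theorem linForm_isHomogeneous (l : Fin 3 → ℂ) : (linForm l).IsHomogeneous 1 := by
  refine IsHomogeneous.sum _ _ _ fun j _ => ?_
  exact isHomogeneous_C_mul_X _ _

theorem linForm_expand (l : Fin 3 → ℂ) :
    linForm l = C (l 0) * X 0 + C (l 1) * X 1 + C (l 2) * X 2 := by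
  simp [linForm, dot_expand, constTriple, eulerTriple]

theorem coeff_linForm (l : Fin 3 → ℂ) (j : Fin 3) :
    coeff (Finsupp.single j 1) (linForm l) = l j := by
  have : linForm l = ∑ i, C (l i) * X i := rfl
  rw [this, coeff_sum]
  simp [coeff_C_mul, coeff_X, Finsupp.single_left_inj]

theorem eval_linForm (l v : Fin 3 → ℂ) : eval v (linForm l) = l ⬝ᵥ v := by
  simp [linForm_expand, dot_expand]

theorem linForm_injective : Function.Injective linForm := by
  intro l l' h
  ext j
  rw [← coeff_linForm l, h, coeff_linForm]

theorem linForm_zero : linForm 0 = 0 := by simp [linForm_expand]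

theorem linForm_ne_zero {l : Fin 3 → ℂ} (hl : l ≠ 0) : linForm l ≠ 0 := by
  rw [← linForm_zero]
  exact fun h => hl (linForm_injective h)

theorem linForm_prime {l : Fin 3 → ℂ} (hl : l ≠ 0) : Prime (linForm l) := by
  refine (irreducible_of_totalDegree_eq_one
    ((linForm_isHomogeneous l).totalDegree (linForm_ne_zero hl)) fun x hx => ?_).prime
  rw [isUnit_iff_ne_zero]
  rintro rfl
  refine hl (funext fun j => ?_)
  have := hx (Finsupp.single j 1)
  rw [coeff_linForm] at this
  simpa using this

theorem linForm_smul (c : ℂ) (l : Fin 3 → ℂ) : linForm (c • l) = C c * linForm l := by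
  simp [linForm_expand]; ring

theorem linForm_add (l l' : Fin 3 → ℂ) : linForm (l + l') = linForm l + linForm l' := by
  simp [linForm_expand]; ring

theorem linForm_dvd {l l' : Fin 3 → ℂ} (h : linForm l ∣ linForm l') :
    ∃ c : ℂ, l' = c • l := by
  by_cases hl : l = 0
  · subst hl
    rw [linForm_zero, zero_dvd_iff, ← linForm_zero] at h
    exact ⟨0, by rw [linForm_injective h]; simp⟩
  obtain ⟨k, hk⟩ := h
  have h1 := ((linForm_isHomogeneous l).of_mul_left (linForm_ne_zero hl) (n := 1)
    (by rw [← hk]; exact linForm_isHomogeneous l')).1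
  rw [Nat.sub_self, ← totalDegree_zero_iff_isHomogeneous, totalDegree_eq_zero_iff_eq_C] at h1
  rw [h1, mul_comm, ← linForm_smul] at hk
  exact ⟨_, linForm_injective hk⟩

theorem not_linForm_dvd {l l' : Fin 3 → ℂ} (h : LinearIndependent ℂ ![l, l']) :
    ¬ linForm l ∣ linForm l' := by
  intro hd
  obtain ⟨c, rfl⟩ := linForm_dvd hd
  rw [LinearIndependent.pair_iff] at h
  have := (h (-c) 1 (by simp)).2
  simp at this

/-- The field `θ` is tangent to the line `l = 0`. -/
def IsTangent (l : Fin 3 → ℂ) (θ : Fin 3 → PolyXYZ) : Prop :=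
  linForm l ∣ constTriple l ⬝ᵥ θ

theorem isTangent_euler (l : Fin 3 → ℂ) : IsTangent l eulerTriple := dvd_refl _

theorem IsTangent.add {l : Fin 3 → ℂ} {θ θ' : Fin 3 → PolyXYZ} (h : IsTangent l θ)
    (h' : IsTangent l θ') : IsTangent l (θ + θ') := by
  unfold IsTangent; rw [dotProduct_add]; exact dvd_add h h'

theorem IsTangent.smul {l : Fin 3 → ℂ} {θ : Fin 3 → PolyXYZ} (h : IsTangent l θ)
    (a : PolyXYZ) : IsTangent l (a • θ) := by
  unfold IsTangent; rw [dotProduct_smul]; exact h.mul_left a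

theorem IsTangent.neg {l : Fin 3 → ℂ} {θ : Fin 3 → PolyXYZ} (h : IsTangent l θ) :
    IsTangent l (-θ) := by
  simpa using h.smul (-1)

theorem IsTangent.sub {l : Fin 3 → ℂ} {θ θ' : Fin 3 → PolyXYZ} (h : IsTangent l θ)
    (h' : IsTangent l θ') : IsTangent l (θ - θ') := by
  rw [sub_eq_add_neg]; exact h.add h'.neg

theorem constTriple_dot (l u : Fin 3 → ℂ) : constTriple l ⬝ᵥ constTriple u = C (l ⬝ᵥ u) := by
  simp [dot_expand, constTriple]

theorem constTriple_cross (l u : Fin 3 → ℂ) :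
    constTriple l ⨯₃ constTriple u = constTriple (l ⨯₃ u) := by
  ext1 j
  fin_cases j <;> simp [constTriple, cross_apply]

theorem isTangent_constTriple {l u : Fin 3 → ℂ} (h : l ⬝ᵥ u = 0) :
    IsTangent l (constTriple u) := by
  simp [IsTangent, constTriple_dot, h]

/-- Along the line the three fields lie in one plane, so they are dependent there. Algebraically,
some coordinate of `l` is a unit, and the cofactor identity `linForm_mul_tripleProd` applies. -/
theorem dvd_tripleProd {l : Fin 3 → ℂ} (hl : l ≠ 0) {a b c : Fin 3 → PolyXYZ}
    (ha : IsTangent l a) (hb : IsTangent l b) (hc : IsTangent l c) :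
    linForm l ∣ tripleProd a b c := by
  obtain ⟨j, hj⟩ := Function.ne_iff.1 hl
  have hu : IsUnit (constTriple l j) := (isUnit_iff_ne_zero.2 hj).map C
  rw [← hu.dvd_mul_left, linForm_mul_tripleProd]
  exact dvd_add (dvd_add (ha.mul_right _) (hb.mul_right _)) (hc.mul_right _)

theorem prod_linForm_dvd {ι : Type*} (s : Finset ι) (l : ι → Fin 3 → ℂ)
    (hl : ∀ i ∈ s, l i ≠ 0)
    (hind : ∀ i ∈ s, ∀ j ∈ s, i ≠ j → LinearIndependent ℂ ![l i, l j])
    (F : PolyXYZ) (h : ∀ i ∈ s, linForm (l i) ∣ F) : ∏ i ∈ s, linForm (l i) ∣ F := by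
  classical
  induction s using Finset.induction_on generalizing F with
  | empty => simp
  | insert a s ha ih =>
    obtain ⟨G, rfl⟩ := h a (Finset.mem_insert_self _ _)
    rw [Finset.prod_insert ha]
    refine mul_dvd_mul_left _ (ih (fun i hi => hl i (Finset.mem_insert_of_mem hi))
      (fun i hi j hj => hind i (Finset.mem_insert_of_mem hi) j (Finset.mem_insert_of_mem hj))
      _ fun i hi => ?_)
    have hne : i ≠ a := fun e => ha (e ▸ hi)
    refine ((linForm_prime (hl i (Finset.mem_insert_of_mem hi))).dvd_or_dvd
      (h i (Finset.mem_insert_of_mem hi))).resolve_left ?_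
    exact not_linForm_dvd (hind i (Finset.mem_insert_of_mem hi) a (Finset.mem_insert_self _ _) hne)

/-- Exactness of the Koszul complex of `x, y, z` in degree two. -/
theorem exists_eq_cross_euler {τ : Fin 3 → PolyXYZ} (h : eulerTriple ⬝ᵥ τ = 0) :
    ∃ ω : Fin 3 → PolyXYZ, τ = ω ⨯₃ eulerTriple := by
  have hX : ∀ i, (X i : PolyXYZ) ≠ 0 := fun i => X_ne_zero i
  simp only [dot_expand, eulerTriple] at h
  have hz : X 2 * τ 2 ∈ Ideal.span ((X : Fin 3 → PolyXYZ) '' {0, 1}) := by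
    have : X 2 * τ 2 = -(X 0 * τ 0) - X 1 * τ 1 := by linear_combination h
    rw [this]
    refine sub_mem (neg_mem ?_) ?_ <;>
    exact Ideal.mul_mem_right _ _ (Ideal.subset_span ⟨_, by simp, rfl⟩)
  -- Here x, y, z being a regular sequence is used: z can be cancelled modulo (x, y), as one sees on
  -- monomials.
  have h2 : τ 2 ∈ Ideal.span ((X : Fin 3 → PolyXYZ) '' {0, 1}) := by
    rw [mem_ideal_span_X_image] at hz ⊢
    intro m hm
    obtain ⟨i, hi, hmi⟩ := hz (m + Finsupp.single 2 1) (by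
      rw [mem_support_iff, mul_comm, coeff_mul_X]; exact mem_support_iff.1 hm)
    refine ⟨i, hi, ?_⟩
    have : i ≠ 2 := by rintro rfl; simp at hi
    simpa [Finsupp.single_apply, this.symm] using hmi
  rw [Set.image_pair, Ideal.mem_span_pair] at h2
  obtain ⟨a, b, hab⟩ := h2
  have hx : (X 0 : PolyXYZ) ∣ X 1 * (τ 1 + X 2 * b) :=
    ⟨-(τ 0 + X 2 * a), by linear_combination h + X 2 * hab⟩
  have hp : Prime (X 0 : PolyXYZ) := by
    have := linForm_prime (l := Pi.single 0 1) (by simp)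
    simpa [linForm_expand] using this
  have hnd : ¬ (X 0 : PolyXYZ) ∣ X 1 := by simp [X_dvd_X]
  obtain ⟨e, he⟩ := (hp.dvd_or_dvd hx).resolve_left hnd
  have he' : τ 0 + X 2 * a = - (X 1 * e) := by
    refine mul_left_cancel₀ (hX 0) ?_
    linear_combination h + X 2 * hab - X 1 * he
  refine ⟨![b, -a, e], ?_⟩
  ext1 j
  fin_cases j <;> simp [cross_apply, eulerTriple]
  · linear_combination he'
  · linear_combination he
  · linear_combination -hab

/-- Koszul exactness one step further: from x θ₁ = y θ₀ the coprimality of x and y gives the factor,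
and the other two coordinates follow on cancelling x. -/
theorem eq_smul_euler_of_cross {θ : Fin 3 → PolyXYZ} (h : θ ⨯₃ eulerTriple = 0) :
    ∃ g : PolyXYZ, θ = g • eulerTriple := by
  have hX : ∀ i, (X i : PolyXYZ) ≠ 0 := fun i => X_ne_zero i
  have h1 := congrFun h 1
  have h2 := congrFun h 2
  simp only [cross_one_apply, cross_two_apply, eulerTriple, Pi.zero_apply] at h1 h2
  have hp : Prime (X 0 : PolyXYZ) := by
    have := linForm_prime (l := Pi.single 0 1) (by simp)
    simpa [linForm_expand] using this
  have hnd : ¬ (X 0 : PolyXYZ) ∣ X 1 := by simp [X_dvd_X]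
  obtain ⟨g, hg⟩ := (hp.dvd_or_dvd (a := X 1) (b := θ 0)
    ⟨θ 1, by linear_combination h2⟩).resolve_left hnd
  refine ⟨g, ?_⟩
  ext1 j
  fin_cases j <;> simp [eulerTriple]
  · linear_combination hg
  · refine mul_left_cancel₀ (hX 0) ?_
    linear_combination -h2 + X 1 * hg
  · refine mul_left_cancel₀ (hX 0) ?_
    linear_combination h1 + X 2 * hg

end

/-! ### Forms vanishing at points of a line, and division of fields by a line -/

section

open MvPolynomial
open scoped Matrix

theorem exists_dot_eq_one {q : Fin 3 → ℂ} (hq : q ≠ 0) : ∃ m : Fin 3 → ℂ, m ⬝ᵥ q = 1 := by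
  obtain ⟨j, hj⟩ := Function.ne_iff.1 hq
  exact ⟨Pi.single j (q j)⁻¹, by simpa using inv_mul_cancel₀ hj⟩

theorem cross_ne_zero {l m : Fin 3 → ℂ} (h : LinearIndependent ℂ ![l, m]) : l ⨯₃ m ≠ 0 :=
  crossProduct_ne_zero_iff_linearIndependent.2 h

theorem cross_cross_eq_zero {R : Type*} [CommRing R] {l m t : Fin 3 → R} (hl : l ⬝ᵥ t = 0)
    (hm : m ⬝ᵥ t = 0) : t ⨯₃ (l ⨯₃ m) = 0 := by
  rw [dot_expand] at hl hm
  ext1 j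
  fin_cases j <;> simp [cross_apply]
  · linear_combination l 0 * hm - m 0 * hl
  · linear_combination l 1 * hm - m 1 * hl
  · linear_combination l 2 * hm - m 2 * hl

/-- Restriction of a polynomial to the line spanned by `q` in `ℂ³`. -/
noncomputable def restrictToPoint (q : Fin 3 → ℂ) : PolyXYZ →ₐ[ℂ] Polynomial ℂ :=
  aeval fun i => Polynomial.C (q i) * Polynomial.X

theorem restrictToPoint_of_isHomogeneous (q : Fin 3 → ℂ) {F : PolyXYZ} {n : ℕ}
    (hF : F.IsHomogeneous n) :
    restrictToPoint q F = Polynomial.C (eval q F) * Polynomial.X ^ n := by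
  rw [restrictToPoint, aeval_def, eval₂_eq', eval_eq', map_sum, Finset.sum_mul]
  refine Finset.sum_congr rfl fun m hm => ?_
  have : ∑ i, m i = n := by
    rw [← Finsupp.degree_eq_sum, Finsupp.degree_apply, ← hF.degree_eq_sum_deg_support hm]
  rw [← this, map_mul, map_prod, mul_assoc, ← Finset.prod_pow_eq_pow_sum, ← Finset.prod_mul_distrib]
  simp [mul_pow, Polynomial.algebraMap_eq]

theorem restrictToPoint_linForm (l q : Fin 3 → ℂ) :
    restrictToPoint q (linForm l) = Polynomial.C (l ⬝ᵥ q) * Polynomial.X := by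
  rw [restrictToPoint_of_isHomogeneous q (linForm_isHomogeneous l), eval_linForm, pow_one]

/-- Complete `l`, `m` by a form `n` with value 1 at the vector q = l × m. Modulo the two forms each
coordinate equals its value at q times `n`, so the quotient map factors through restriction to the
line ℂq. -/
theorem mem_span_pair_of_restrictToPoint {l m : Fin 3 → ℂ} (h : LinearIndependent ℂ ![l, m])
    {F : PolyXYZ} (hF : restrictToPoint (l ⨯₃ m) F = 0) :
    F ∈ Ideal.span {linForm l, linForm m} := by
  set I := Ideal.span {linForm l, linForm m}
  obtain ⟨n, hn⟩ := exists_dot_eq_one (cross_ne_zero h)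
  have hX : ∀ i, (X i : PolyXYZ) - C ((l ⨯₃ m) i) * linForm n ∈ I := by
    intro i
    have h1 := tripleProd_smul l m n (Pi.single i 1)
    have h2 : tripleProd l m n = 1 := by
      rw [← hn]; simp only [tripleProd_expand, dot_expand, cross_zero_apply, cross_one_apply,
        cross_two_apply]; ring
    have h3 : tripleProd l m (Pi.single i 1) = (l ⨯₃ m) i := by
      fin_cases i <;> simp [tripleProd_expand, cross_apply] <;> ring
    have h4 : linForm (Pi.single i 1) = X i := by
      fin_cases i <;> simp [linForm_expand]
    rw [h2, h3, one_smul] at h1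
    have h5 := congrArg linForm h1
    rw [h4, linForm_add, linForm_add, linForm_smul, linForm_smul, linForm_smul] at h5
    rw [h5, add_sub_cancel_right]
    exact add_mem (I.mul_mem_left _ (Ideal.subset_span (by simp)))
      (I.mul_mem_left _ (Ideal.subset_span (by simp)))
  have key : Ideal.Quotient.mkₐ ℂ I = (Ideal.Quotient.mkₐ ℂ I).comp
      ((Polynomial.aeval (linForm n)).comp (restrictToPoint (l ⨯₃ m))) := by
    refine algHom_ext fun i => ?_
    have := Ideal.Quotient.eq.2 (hX i)
    simpa [restrictToPoint] using this
  have := DFunLike.congr_fun key F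
  simp only [AlgHom.comp_apply, hF, map_zero] at this
  exact Ideal.Quotient.eq_zero_iff_mem.1 this

/-- A form vanishing at the intersection point of two lines is a combination of their equations. -/
theorem exists_eq_add_of_eval_cross {l m : Fin 3 → ℂ} (h : LinearIndependent ℂ ![l, m])
    {F : PolyXYZ} {n : ℕ} (hF : F.IsHomogeneous (n + 1)) (h0 : eval (l ⨯₃ m) F = 0) :
    ∃ a b : PolyXYZ, a.IsHomogeneous n ∧ b.IsHomogeneous n ∧
      F = linForm l * a + linForm m * b := by
  have h1 : F ∈ Ideal.span {linForm l, linForm m} := mem_span_pair_of_restrictToPoint h (by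
    rw [restrictToPoint_of_isHomogeneous _ hF, h0]; simp)
  obtain ⟨a, b, hab⟩ := Ideal.mem_span_pair.1 h1
  refine ⟨homogeneousComponent n a, homogeneousComponent n b,
    homogeneousComponent_isHomogeneous _ _, homogeneousComponent_isHomogeneous _ _, ?_⟩
  rw [← homogeneousComponent_mul_of_left (linForm_isHomogeneous l),
    ← homogeneousComponent_mul_of_left (linForm_isHomogeneous m), ← map_add, mul_comm _ a,
    mul_comm _ b, hab, add_comm 1 n, homogeneousComponent_eq_self hF]

/-- A form of degree n with more than n zeros on a projective line vanishes on it. The induction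
removes one zero and one degree at a time. -/
theorem linForm_dvd_of_eval_eq_zero {ι : Type*} {l : Fin 3 → ℂ} {m : ι → Fin 3 → ℂ}
    (s : Finset ι) (hind : ∀ a ∈ s, LinearIndependent ℂ ![l, m a])
    (hne : ∀ a ∈ s, ∀ b ∈ s, a ≠ b → m a ⬝ᵥ (l ⨯₃ m b) ≠ 0)
    {F : PolyXYZ} {n : ℕ} (hF : F.IsHomogeneous n) (hn : n < s.card)
    (h0 : ∀ a ∈ s, eval (l ⨯₃ m a) F = 0) : linForm l ∣ F := by
  classical
  induction s using Finset.induction_on generalizing F n with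
  | empty => simp at hn
  | insert a s ha ih =>
    have ham := Finset.mem_insert_self a s
    cases n with
    | zero =>
      rw [← totalDegree_zero_iff_isHomogeneous, totalDegree_eq_zero_iff_eq_C] at hF
      have := h0 a ham
      rw [hF, eval_C] at this
      rw [hF, this]
      simp
    | succ n =>
      obtain ⟨A, B, hA, hB, rfl⟩ := exists_eq_add_of_eval_cross (hind a ham) hF (h0 a ham)
      -- The cofactor `B` of `m a` has one degree less and still vanishes at the remaining points,
      -- because `m a` is nonzero there.
      refine dvd_add (dvd_mul_right _ _) (Dvd.dvd.mul_left ?_ _)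
      refine ih (fun b hb => hind b (Finset.mem_insert_of_mem hb))
        (fun b hb c hc => hne b (Finset.mem_insert_of_mem hb) c (Finset.mem_insert_of_mem hc))
        hB ?_ fun b hb => ?_
      · rw [Finset.card_insert_of_notMem ha] at hn; omega
      · have h1 := h0 b (Finset.mem_insert_of_mem hb)
        rw [map_add, map_mul, map_mul, eval_linForm, eval_linForm, dot_self_cross, zero_mul,
          zero_add] at h1
        exact (mul_eq_zero.1 h1).resolve_left
          (hne a ham b (Finset.mem_insert_of_mem hb) fun e => ha (e ▸ hb))

theorem IsTangent.eval_dot {l : Fin 3 → ℂ} {θ : Fin 3 → PolyXYZ} (h : IsTangent l θ)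
    {q : Fin 3 → ℂ} (hq : l ⬝ᵥ q = 0) : l ⬝ᵥ (fun j => eval q (θ j)) = 0 := by
  obtain ⟨k, hk⟩ := h
  have := congrArg (eval q) hk
  rw [map_mul, eval_linForm, hq, zero_mul] at this
  rw [← this]
  simp [dot_expand, constTriple]

/-- A field tangent to a line and to more than `r + 1` further lines that meet it in distinct points
is a multiple of the Euler field along the line. -/
theorem exists_eq_smul_add_smul_euler {ι : Type*} {l : Fin 3 → ℂ} (hl : l ≠ 0)
    {m : ι → Fin 3 → ℂ}
    (s : Finset ι) (hind : ∀ a ∈ s, LinearIndependent ℂ ![l, m a])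
    (hne : ∀ a ∈ s, ∀ b ∈ s, a ≠ b → m a ⬝ᵥ (l ⨯₃ m b) ≠ 0)
    {θ : Fin 3 → PolyXYZ} {r : ℕ} (hθ : IsHomogeneousTriple θ (r + 1)) (hr : r + 2 < s.card)
    (htl : IsTangent l θ) (htm : ∀ a ∈ s, IsTangent (m a) θ) :
    ∃ (ω : Fin 3 → PolyXYZ) (g : PolyXYZ), IsHomogeneousTriple ω r ∧
      θ = linForm l • ω + g • eulerTriple := by
  have hX : ∀ i, (eulerTriple i).IsHomogeneous 1 := fun i => isHomogeneous_X _ _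
  have hhom : ∀ c, ((θ ⨯₃ eulerTriple) c).IsHomogeneous (r + 2) := by
    intro c
    fin_cases c <;> simp only [Fin.zero_eta, Fin.mk_one, Fin.reduceFinMk, cross_zero_apply,
        cross_one_apply, cross_two_apply] <;>
      exact ((hθ _).mul (hX _)).sub ((hθ _).mul (hX _))
  -- At an intersection point q the value of θ is orthogonal to both lines, hence parallel to q. So
  -- each coordinate of θ × E, of degree r + 2, has more than r + 2 zeros on the line.
  have hdvd : ∀ c, linForm l ∣ (θ ⨯₃ eulerTriple) c := by
    intro c
    refine linForm_dvd_of_eval_eq_zero s hind hne (hhom c) hr fun a ha => ?_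
    have h1 := htl.eval_dot (dot_self_cross l (m a))
    have h2 := (htm a ha).eval_dot (dot_cross_self l (m a))
    set q := l ⨯₃ m a
    have h3 : (fun j => eval q (θ j)) ⨯₃ q = 0 := cross_cross_eq_zero h1 h2
    have h4 := congrFun h3 c
    have h5 : eval q ((θ ⨯₃ eulerTriple) c) = ((fun j => eval q (θ j)) ⨯₃ q) c := by
      fin_cases c <;> simp [cross_apply, eulerTriple]
    rw [h5, h4, Pi.zero_apply]
  choose τ hτ using hdvd
  have hl0 := linForm_ne_zero hl
  have hEτ : eulerTriple ⬝ᵥ τ = 0 := by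
    refine mul_left_cancel₀ hl0 ?_
    have := dot_cross_self θ eulerTriple
    rw [dot_expand, hτ 0, hτ 1, hτ 2] at this
    rw [dot_expand]; linear_combination this
  obtain ⟨ω, hω⟩ := exists_eq_cross_euler hEτ
  have hpar : (θ - linForm l • ω) ⨯₃ eulerTriple = 0 := by
    ext1 c
    have := hτ c
    rw [hω] at this
    simp [this]
  obtain ⟨g, hg⟩ := eq_smul_euler_of_cross hpar
  refine ⟨fun j => homogeneousComponent r (ω j), homogeneousComponent r g,
    fun j => homogeneousComponent_isHomogeneous _ _, ?_⟩
  -- The `ω` and `g` found above need not be homogeneous; taking the component of degree r + 1 of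
  -- the identity corrects this.
  ext1 j
  have h1 : θ j = linForm l * ω j + X j * g := by
    have := congrFun hg j
    simp only [Pi.sub_apply, Pi.smul_apply, smul_eq_mul, eulerTriple] at this
    linear_combination this
  have h2 := congrArg (homogeneousComponent (1 + r)) h1
  rw [map_add, homogeneousComponent_mul_of_left (linForm_isHomogeneous l),
    homogeneousComponent_mul_of_left (isHomogeneous_X _ _), add_comm 1 r,
    homogeneousComponent_eq_self (hθ j)] at h2
  rw [h2]
  simp [eulerTriple, mul_comm]

theorem dot_isHomogeneous {θ : Fin 3 → PolyXYZ} {r : ℕ} (hθ : IsHomogeneousTriple θ r)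
    (l : Fin 3 → ℂ) : (constTriple l ⬝ᵥ θ).IsHomogeneous r :=
  IsHomogeneous.sum _ _ _ fun j _ => (hθ j).C_mul (l j)

theorem tripleProd_euler_constTriple_cross (τ : Fin 3 → PolyXYZ) (m n : Fin 3 → ℂ) :
    tripleProd τ eulerTriple (constTriple (m ⨯₃ n)) =
      (constTriple m ⬝ᵥ τ) * linForm n - (constTriple n ⬝ᵥ τ) * linForm m := by
  rw [← constTriple_cross]
  simp only [tripleProd_expand, linForm, dot_expand, cross_zero_apply, cross_one_apply,
    cross_two_apply]
  ring

/-- A field that is radial with respect to a point is a combination of the Euler field and the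
constant field at the point. -/
theorem exists_eq_smul_euler_add_of_tripleProd {m n : Fin 3 → ℂ}
    (h : LinearIndependent ℂ ![m, n]) {τ : Fin 3 → PolyXYZ}
    (hτ : tripleProd τ eulerTriple (constTriple (m ⨯₃ n)) = 0) :
    ∃ a b : PolyXYZ, τ = a • eulerTriple + b • constTriple (m ⨯₃ n) ∧
      ∀ r, IsHomogeneousTriple τ r → b.IsHomogeneous r := by
  have hm : m ≠ 0 := h.ne_zero 0
  rw [tripleProd_euler_constTriple_cross] at hτ
  -- The determinant condition says (m·τ) n = (n·τ) m, so both pairings have the same cofactor `a`.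
  -- Then τ - aE is orthogonal to `m` and `n`, hence a multiple of m × n.
  obtain ⟨a, ha⟩ := ((linForm_prime hm).dvd_or_dvd (a := linForm n) (b := constTriple m ⬝ᵥ τ)
    ⟨constTriple n ⬝ᵥ τ, by linear_combination hτ⟩).resolve_left (not_linForm_dvd h)
  have hb : constTriple n ⬝ᵥ τ = linForm n * a := by
    refine mul_left_cancel₀ (linForm_ne_zero hm) ?_
    linear_combination -hτ + linForm n * ha
  obtain ⟨k, hk⟩ := exists_dot_eq_one (cross_ne_zero h)
  have h2 : tripleProd (constTriple m) (constTriple n) (constTriple k) = 1 := by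
    have : constTriple k ⬝ᵥ constTriple (m ⨯₃ n) = 1 := by rw [constTriple_dot, hk, map_one]
    rw [← this, ← constTriple_cross]
    simp only [tripleProd_expand, dot_expand, cross_zero_apply, cross_one_apply,
      cross_two_apply]
    ring
  have e1 : (τ - a • eulerTriple) ⬝ᵥ constTriple m = 0 := by
    rw [dotProduct_comm, dotProduct_sub, dotProduct_smul, ha]
    simp only [smul_eq_mul, linForm]; ring
  have e2 : (τ - a • eulerTriple) ⬝ᵥ constTriple n = 0 := by
    rw [dotProduct_comm, dotProduct_sub, dotProduct_smul, hb]
    simp only [smul_eq_mul, linForm]; ring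
  refine ⟨a, (τ - a • eulerTriple) ⬝ᵥ constTriple k, ?_, fun r hr => ?_⟩
  · ext1 j
    have := linForm_mul_tripleProd (τ - a • eulerTriple) (constTriple m) (constTriple n)
      (constTriple k) j
    rw [h2, e1, e2, constTriple_cross m n] at this
    simp only [Pi.sub_apply, Pi.smul_apply, smul_eq_mul, Pi.add_apply] at this ⊢
    linear_combination this
  · have h3 := (linForm_isHomogeneous m).of_mul_left (linForm_ne_zero hm) (n := r) (b := a)
      (by rw [← ha]; exact dot_isHomogeneous hr m)
    rw [dotProduct_comm]
    refine dot_isHomogeneous (fun j => (hr j).sub ?_) k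
    rcases Nat.eq_zero_or_pos r with rfl | hr0
    · rw [h3.2 one_pos]; simpa using isHomogeneous_zero _ _ _
    · have := h3.1.mul (isHomogeneous_X ℂ j)
      rwa [Nat.sub_add_cancel hr0] at this

end

/-! ### Jacobian syzygies versus logarithmic fields; criteria for free and nearly free -/

section

open MvPolynomial
open scoped Matrix

theorem grad_mul_dot (f g : PolyXYZ) (θ : Fin 3 → PolyXYZ) :
    grad (f * g) ⬝ᵥ θ = f * (grad g ⬝ᵥ θ) + g * (grad f ⬝ᵥ θ) := by
  simp [dot_expand, grad]; ring

theorem grad_linForm (l : Fin 3 → ℂ) : grad (linForm l) = constTriple l := by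
  ext1 j
  fin_cases j <;> simp [grad, linForm_expand, constTriple, pderiv_X]

theorem grad_dot_euler {f : PolyXYZ} {d : ℕ} (hf : f.IsHomogeneous d) :
    grad f ⬝ᵥ eulerTriple = d * f := by
  rw [← nsmul_eq_mul, ← hf.sum_X_mul_pderiv]
  simp [dotProduct, grad, eulerTriple, mul_comm]

theorem mem_jacobianSyzygies_iff_grad {f : PolyXYZ} {θ : Fin 3 → PolyXYZ} :
    θ ∈ jacobianSyzygies f ↔ grad f ⬝ᵥ θ = 0 := by
  rw [mem_jacobianSyzygies, dot_expand]
  simp [grad, mul_comm]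

theorem IsHomogeneousTriple.smul {θ : Fin 3 → PolyXYZ} {r n : ℕ} (hθ : IsHomogeneousTriple θ r)
    {a : PolyXYZ} (ha : a.IsHomogeneous n) : IsHomogeneousTriple (a • θ) (n + r) :=
  fun j => ha.mul (hθ j)

theorem IsHomogeneousTriple.add {θ θ' : Fin 3 → PolyXYZ} {r : ℕ} (hθ : IsHomogeneousTriple θ r)
    (hθ' : IsHomogeneousTriple θ' r) : IsHomogeneousTriple (θ + θ') r :=
  fun j => (hθ j).add (hθ' j)

theorem IsHomogeneousTriple.sub {θ θ' : Fin 3 → PolyXYZ} {r : ℕ} (hθ : IsHomogeneousTriple θ r)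
    (hθ' : IsHomogeneousTriple θ' r) : IsHomogeneousTriple (θ - θ') r :=
  fun j => (hθ j).sub (hθ' j)

theorem isHomogeneousTriple_constTriple (u : Fin 3 → ℂ) :
    IsHomogeneousTriple (constTriple u) 0 := fun _ => isHomogeneous_C _ _

/-- The degree of the cofactor is recorded through its products with the coordinates, that is, as
the degree of `k • eulerTriple`. This avoids the truncated r - 1: for r = 0 the cofactor is zero. -/
theorem IsTangent.exists_cofactor {l : Fin 3 → ℂ} (hl : l ≠ 0) {θ : Fin 3 → PolyXYZ}
    (h : IsTangent l θ) : ∃ k : PolyXYZ, constTriple l ⬝ᵥ θ = k * linForm l ∧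
      ∀ r, IsHomogeneousTriple θ r → ∀ j : Fin 3, (k * X j).IsHomogeneous r := by
  obtain ⟨k, hk⟩ := h
  refine ⟨k, by rw [hk, mul_comm], fun r hr j => ?_⟩
  have h3 := (linForm_isHomogeneous l).of_mul_left (linForm_ne_zero hl) (n := r) (b := k)
    (by rw [← hk]; exact dot_isHomogeneous hr l)
  rcases Nat.eq_zero_or_pos r with rfl | hr0
  · rw [h3.2 one_pos, zero_mul]; exact isHomogeneous_zero _ _ _
  · have := h3.1.mul (isHomogeneous_X ℂ j)
    rwa [Nat.sub_add_cancel hr0] at this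

theorem exists_cofactor_prod {ι : Type*} (s : Finset ι) (l : ι → Fin 3 → ℂ)
    (hl : ∀ i ∈ s, l i ≠ 0) {θ : Fin 3 → PolyXYZ} (h : ∀ i ∈ s, IsTangent (l i) θ) :
    ∃ k : PolyXYZ, grad (∏ i ∈ s, linForm (l i)) ⬝ᵥ θ = k * ∏ i ∈ s, linForm (l i) ∧
      ∀ r, IsHomogeneousTriple θ r → ∀ j : Fin 3, (k * X j).IsHomogeneous r := by
  classical
  induction s using Finset.induction_on with
  | empty =>
    refine ⟨0, ?_, fun r _ j => by rw [zero_mul]; exact isHomogeneous_zero _ _ _⟩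
    simp [dot_expand, grad]
  | insert a s ha ih =>
    obtain ⟨k, hk, hk'⟩ := ih (fun i hi => hl i (Finset.mem_insert_of_mem hi))
      (fun i hi => h i (Finset.mem_insert_of_mem hi))
    obtain ⟨k₁, hk₁, hk₁'⟩ := (h a (Finset.mem_insert_self _ _)).exists_cofactor
      (hl a (Finset.mem_insert_self _ _))
    refine ⟨k + k₁, ?_, fun r hr j => by rw [add_mul]; exact (hk' r hr j).add (hk₁' r hr j)⟩
    rw [Finset.prod_insert ha, grad_mul_dot, hk, grad_linForm, hk₁]
    ring

/-- Free and nearly free exclude each other. -/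
theorem not_isNearlyFreeCurve_of_isFreeCurve {f : PolyXYZ} (hf : IsFreeCurve f) :
    ¬ IsNearlyFreeCurve f := by
  obtain ⟨-, -, b, -, -⟩ := hf
  rintro ⟨d₁, d₂, ρ, η, h1, h12, -, -, -, hη0, hη1, hη2, -, hex1, hex2⟩
  -- Minimality enters here: the relation has entries of positive degree, so it dies modulo (x, y,
  -- z).
  have hη : ∀ j, eval 0 (η j) = 0 := by
    have key : ∀ (p : PolyXYZ) (n : ℕ), p.IsHomogeneous (n + 1) → eval 0 p = 0 := by
      intro p n hp
      have h := hp.coeff_eq_zero (d := 0) (by simp)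
      rw [← constantCoeff_eq] at h
      rw [← h, constantCoeff_eq]
      simp
      rfl
    intro j
    fin_cases j
    exacts [key _ _ hη0, key _ 0 hη1, key _ 0 hη2]
  have hρ : ∀ i, ρ i ∈ jacobianSyzygies f := by
    intro i
    refine (hex2 _).2 ⟨Pi.single i 1, ?_⟩
    simp [Fintype.linearCombination_apply_single]
  have hc : ∀ k : Fin 2, ∃ c, Fintype.linearCombination PolyXYZ ρ c = b k := fun k =>
    (hex2 _).1 (b k).2
  choose c hc using hc
  let M : Fin 3 → Fin 2 → PolyXYZ := fun i k => b.repr ⟨ρ i, hρ i⟩ k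
  have hM : ∀ i, ρ i = M i 0 • (b 0 : Fin 3 → PolyXYZ) + M i 1 • (b 1 : Fin 3 → PolyXYZ) := by
    intro i
    have := congrArg (Subtype.val) (b.sum_repr ⟨ρ i, hρ i⟩)
    rw [Fin.sum_univ_two] at this
    exact this.symm
  have ht : ∀ i, ∃ t : PolyXYZ, t • η = Pi.single i 1 - (M i 0 • c 0 + M i 1 • c 1) := by
    intro i
    have : Fintype.linearCombination PolyXYZ ρ (Pi.single i 1 - (M i 0 • c 0 + M i 1 • c 1)) = 0 := by
      rw [map_sub, map_add, map_smul, map_smul, hc, hc, ← hM,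
        Fintype.linearCombination_apply_single, one_smul, sub_self]
    obtain ⟨t, ht⟩ := (hex1 _).1 this
    exact ⟨t, ht⟩
  choose t ht using ht
  let P : Matrix (Fin 3) (Fin 2) ℂ := fun i k => eval 0 (M i k)
  let Q : Matrix (Fin 2) (Fin 3) ℂ := fun k j => eval 0 (c k j)
  -- Passing from the three generators to the basis and back is the identity up to multiples of `η`.
  -- At the origin the 3 × 3 identity therefore factors through ℂ², contradicting its rank.
  have hPQ : P * Q = 1 := by
    ext i j
    have := congrArg (eval 0) (congrFun (ht i) j)
    simp only [Pi.smul_apply, smul_eq_mul, map_mul, hη, mul_zero, Pi.sub_apply, map_sub,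
      Pi.add_apply, map_add] at this
    rw [Matrix.mul_apply, Fin.sum_univ_two, Matrix.one_apply]
    have h2 : eval (0 : Fin 3 → ℂ) ((Pi.single i 1 : Fin 3 → PolyXYZ) j) = if i = j then 1 else 0 := by
      rw [Pi.single_apply]
      simp only [eq_comm (a := j)]
      split_ifs <;> simp
    rw [h2] at this
    exact (sub_eq_zero.1 this.symm).symm
  have h3 := Matrix.rank_mul_le_left P Q
  rw [hPQ, Matrix.rank_one] at h3
  have h4 := P.rank_le_width
  simp at h3
  omega

namespace LineArrangement

variable {d : ℕ} (A : LineArrangement d)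

/-- The field `θ` is tangent to all lines of the arrangement. -/
def IsLogarithmic (θ : Fin 3 → PolyXYZ) : Prop := ∀ i, IsTangent (A.coeff i) θ

theorem definingPoly_eq : A.definingPoly = ∏ i, linForm (A.coeff i) := rfl

theorem definingPoly_isHomogeneous : A.definingPoly.IsHomogeneous d := by
  rw [definingPoly_eq]
  have := IsHomogeneous.prod Finset.univ (fun i => linForm (A.coeff i)) (fun _ => 1)
    (fun i _ => linForm_isHomogeneous _)
  simpa using this

theorem definingPoly_ne_zero : A.definingPoly ≠ 0 :=
  Finset.prod_ne_zero_iff.2 fun i _ => linForm_ne_zero (A.coeff_ne_zero i)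

variable {A}

/-- By Leibniz, the i-th form divides its own derivative times the product of the other forms; it is
prime and divides none of those. -/
theorem isLogarithmic_of_mem {θ : Fin 3 → PolyXYZ} (h : θ ∈ jacobianSyzygies A.definingPoly) :
    A.IsLogarithmic θ := by
  classical
  intro i
  rw [mem_jacobianSyzygies_iff_grad, definingPoly_eq,
    ← Finset.mul_prod_erase Finset.univ _ (Finset.mem_univ i), grad_mul_dot, grad_linForm] at h
  have hp := linForm_prime (A.coeff_ne_zero i)
  refine (hp.dvd_or_dvd (a := ∏ x ∈ Finset.univ.erase i, linForm (A.coeff x))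
    ⟨- (grad (∏ x ∈ Finset.univ.erase i, linForm (A.coeff x)) ⬝ᵥ θ), by
      linear_combination h⟩).resolve_left fun hd => ?_
  obtain ⟨j, hj, hji⟩ := (Prime.dvd_finsetProd_iff hp _).1 hd
  exact not_linForm_dvd (A.coeff_distinct i j (Finset.ne_of_mem_erase hj).symm) hji

/-- If θ f = k f, then θ - (k/d) E kills f, because E f = d f. -/
theorem IsLogarithmic.exists_syzygy (hd : d ≠ 0) {θ : Fin 3 → PolyXYZ} (h : A.IsLogarithmic θ) :
    ∃ (σ : Fin 3 → PolyXYZ) (e : PolyXYZ), σ ∈ jacobianSyzygies A.definingPoly ∧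
      θ = σ + e • eulerTriple ∧ ∀ r, IsHomogeneousTriple θ r → IsHomogeneousTriple σ r := by
  obtain ⟨k, hk, hk'⟩ := exists_cofactor_prod Finset.univ A.coeff
    (fun i _ => A.coeff_ne_zero i) (fun i _ => h i)
  have hC : (C (d : ℂ)⁻¹ : PolyXYZ) * d = 1 := by
    rw [← map_natCast (C : ℂ →+* PolyXYZ), ← C_mul, inv_mul_cancel₀ (Nat.cast_ne_zero.2 hd), C_1]
  refine ⟨θ - (C (d : ℂ)⁻¹ * k) • eulerTriple, C (d : ℂ)⁻¹ * k, ?_, by simp, fun r hr j => ?_⟩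
  · rw [mem_jacobianSyzygies_iff_grad, dotProduct_sub, dotProduct_smul,
      grad_dot_euler A.definingPoly_isHomogeneous, definingPoly_eq, hk]
    simp only [smul_eq_mul]
    linear_combination (-k * ∏ i, linForm (A.coeff i)) * hC
  · refine (hr j).sub ?_
    have := (hk' r hr j).C_mul (d : ℂ)⁻¹
    simpa [eulerTriple, mul_assoc] using this

theorem smul_euler_mem (hd : d ≠ 0) {e : PolyXYZ}
    (h : e • eulerTriple ∈ jacobianSyzygies A.definingPoly) : e = 0 := by
  rw [mem_jacobianSyzygies_iff_grad, dotProduct_smul,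
      grad_dot_euler A.definingPoly_isHomogeneous] at h
  have h1 : (d : PolyXYZ) ≠ 0 := Nat.cast_ne_zero.2 hd
  simpa [h1, A.definingPoly_ne_zero] using h

theorem mdr_le (hd : d ≠ 0) {θ : Fin 3 → PolyXYZ} (h : A.IsLogarithmic θ) {r : ℕ}
    (hr : IsHomogeneousTriple θ r) (hθ : ∀ g : PolyXYZ, θ ≠ g • eulerTriple) :
    mdr A.definingPoly ≤ r := by
  obtain ⟨σ, e, hσ, he, hhom⟩ := h.exists_syzygy hd
  refine Nat.sInf_le ⟨σ, hσ, ?_, hhom r hr⟩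
  rintro rfl
  exact hθ e (by rw [he, zero_add])

theorem exists_isLogarithmic_mdr (A : LineArrangement d) (hd : d ≠ 0) :
    ∃ θ, A.IsLogarithmic θ ∧ IsHomogeneousTriple θ (mdr A.definingPoly) ∧
      ∀ g : PolyXYZ, θ ≠ g • eulerTriple := by
  obtain ⟨s, hs, hs0, hsr⟩ := Nat.sInf_mem
    (exists_homogeneous_jacobianSyzygy A.definingPoly_isHomogeneous)
  refine ⟨s, isLogarithmic_of_mem hs, hsr, ?_⟩
  rintro g rfl
  exact hs0 (by rw [smul_euler_mem hd hs, zero_smul])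

theorem IsLogarithmic.definingPoly_dvd {a b c : Fin 3 → PolyXYZ} (ha : A.IsLogarithmic a)
    (hb : A.IsLogarithmic b) (hc : A.IsLogarithmic c) :
    A.definingPoly ∣ tripleProd a b c :=
  prod_linForm_dvd Finset.univ A.coeff (fun i _ => A.coeff_ne_zero i)
    (fun i _ j _ => A.coeff_distinct i j) _
    fun i _ => dvd_tripleProd (A.coeff_ne_zero i) (ha i) (hb i) (hc i)

theorem isLogarithmic_euler : A.IsLogarithmic eulerTriple := fun _ => isTangent_euler _

/-- Saito's criterion. -/
theorem isFreeCurve_of_tripleProd (hd : d ≠ 0) {θ₁ θ₂ : Fin 3 → PolyXYZ} {d₁ d₂ : ℕ}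
    (h₁ : A.IsLogarithmic θ₁) (h₂ : A.IsLogarithmic θ₂) (hr₁ : IsHomogeneousTriple θ₁ d₁)
    (hr₂ : IsHomogeneousTriple θ₂ d₂) {c : ℂ} (hc : c ≠ 0)
    (hdet : tripleProd θ₁ eulerTriple θ₂ = C c * A.definingPoly) :
    IsFreeCurve A.definingPoly := by
  obtain ⟨σ₁, e₁, hσ₁, rfl, hhom₁⟩ := h₁.exists_syzygy hd
  obtain ⟨σ₂, e₂, hσ₂, rfl, hhom₂⟩ := h₂.exists_syzygy hd
  replace hdet : tripleProd σ₁ eulerTriple σ₂ = C c * A.definingPoly := by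
    rw [← hdet]; simp only [tripleProd_expand, Pi.add_apply, Pi.smul_apply, smul_eq_mul]; ring
  have hf := A.definingPoly_ne_zero
  have hc' : (C c : PolyXYZ) ≠ 0 := by simpa using hc
  have hli : LinearIndependent PolyXYZ
      ![(⟨σ₁, hσ₁⟩ : jacobianSyzygies A.definingPoly), ⟨σ₂, hσ₂⟩] := by
    rw [LinearIndependent.pair_iff]
    intro s t hst
    have hst' : s • σ₁ + t • σ₂ = 0 := congrArg Subtype.val hst
    have hs : s * tripleProd σ₁ eulerTriple σ₂ =
        tripleProd (s • σ₁ + t • σ₂) eulerTriple σ₂ := by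
      simp only [tripleProd_expand, Pi.add_apply, Pi.smul_apply, smul_eq_mul]; ring
    have ht : t * tripleProd σ₁ eulerTriple σ₂ =
        tripleProd σ₁ eulerTriple (s • σ₁ + t • σ₂) := by
      simp only [tripleProd_expand, Pi.add_apply, Pi.smul_apply, smul_eq_mul]; ring
    rw [hst', hdet] at hs ht
    constructor
    · simpa [tripleProd_expand, hf, hc'] using hs
    · simpa [tripleProd_expand, hf, hc'] using ht
  have hspan : ⊤ ≤ Submodule.span PolyXYZ (Set.range
      ![(⟨σ₁, hσ₁⟩ : jacobianSyzygies A.definingPoly), ⟨σ₂, hσ₂⟩]) := by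
    rintro ⟨θ, hθ⟩ -
    have hl := isLogarithmic_of_mem hθ
    obtain ⟨u, hu⟩ := hl.definingPoly_dvd isLogarithmic_euler (isLogarithmic_of_mem hσ₂)
    obtain ⟨v, hv⟩ := (isLogarithmic_of_mem hσ₁).definingPoly_dvd isLogarithmic_euler hl
    obtain ⟨w, hw⟩ := (isLogarithmic_of_mem hσ₁).definingPoly_dvd hl (isLogarithmic_of_mem hσ₂)
    -- Cramer's rule expands θ in σ₁, E, σ₂. All determinants involved are divisible by f, so f
    -- cancels and only the constant `c` remains as denominator.
    have hcr := tripleProd_smul σ₁ eulerTriple σ₂ θ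
    rw [hdet, hu, hv, hw] at hcr
    have hcr' : (C c : PolyXYZ) • θ = u • σ₁ + w • eulerTriple + v • σ₂ := by
      ext1 j
      have := congrFun hcr j
      simp only [Pi.smul_apply, Pi.add_apply, smul_eq_mul] at this ⊢
      refine mul_left_cancel₀ hf ?_
      linear_combination this
    have hw0 : w = 0 := by
      refine smul_euler_mem (A := A) hd ?_
      have : w • eulerTriple = (C c : PolyXYZ) • θ - u • σ₁ - v • σ₂ := by rw [hcr']; abel
      rw [this]
      exact sub_mem (sub_mem (Submodule.smul_mem _ _ hθ) (Submodule.smul_mem _ _ hσ₁))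
        (Submodule.smul_mem _ _ hσ₂)
    rw [hw0, zero_smul, add_zero] at hcr'
    have hcc : (C c⁻¹ : PolyXYZ) * C c = 1 := by rw [← C_mul, inv_mul_cancel₀ hc, C_1]
    rw [Matrix.range_cons, Matrix.range_cons, Matrix.range_empty, Set.union_empty,
      Set.singleton_union, Submodule.mem_span_pair]
    refine ⟨C c⁻¹ * u, C c⁻¹ * v, Subtype.ext ?_⟩
    simp only [Submodule.coe_add, Submodule.coe_smul]
    rw [mul_smul, mul_smul, ← smul_add, ← hcr', smul_smul, hcc, one_smul]
  refine ⟨d₁, d₂, Module.Basis.mk hli hspan, ?_, ?_⟩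
  · simpa using hhom₁ _ hr₁
  · simpa using hhom₂ _ hr₂

/-- Criterion for being nearly free in terms of the module of logarithmic fields modulo the Euler
field. -/
theorem isNearlyFreeCurve_of_logarithmic (hd : d ≠ 0) {d₁ d₂ : ℕ} (h1 : 1 ≤ d₁) (h12 : d₁ ≤ d₂)
    {ρ : Fin 3 → Fin 3 → PolyXYZ} {η : Fin 3 → PolyXYZ} (hlog : ∀ i, A.IsLogarithmic (ρ i))
    (hr0 : IsHomogeneousTriple (ρ 0) d₁) (hr1 : IsHomogeneousTriple (ρ 1) d₂)
    (hr2 : IsHomogeneousTriple (ρ 2) d₂) (hη0 : (η 0).IsHomogeneous (d₂ - d₁ + 1))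
    (hη1 : (η 1).IsHomogeneous 1) (hη2 : (η 2).IsHomogeneous 1) (hη : η ≠ 0)
    (hrel : ∃ e : PolyXYZ, Fintype.linearCombination PolyXYZ ρ η = e • eulerTriple)
    (hgen : ∀ θ, A.IsLogarithmic θ → ∃ (c : Fin 3 → PolyXYZ) (e : PolyXYZ),
      θ = Fintype.linearCombination PolyXYZ ρ c + e • eulerTriple)
    (hker : ∀ (c : Fin 3 → PolyXYZ) (e : PolyXYZ),
      Fintype.linearCombination PolyXYZ ρ c = e • eulerTriple → ∃ t : PolyXYZ, t • η = c) :
    IsNearlyFreeCurve A.definingPoly := by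
  -- The generators are replaced by their syzygy parts. The coefficients `η` survive, since a
  -- combination that is a multiple of E has syzygy part zero.
  have hs := fun i => (hlog i).exists_syzygy hd
  choose σ e hσ he hhom using hs
  have hcomb : ∀ c, Fintype.linearCombination PolyXYZ ρ c =
      Fintype.linearCombination PolyXYZ σ c +
        (c 0 * e 0 + c 1 * e 1 + c 2 * e 2) • eulerTriple := by
    intro c
    simp only [Fintype.linearCombination_apply, Fin.sum_univ_three]
    rw [he 0, he 1, he 2]
    module
  have hmem : ∀ c, Fintype.linearCombination PolyXYZ σ c ∈ jacobianSyzygies A.definingPoly := by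
    intro c
    rw [Fintype.linearCombination_apply]
    exact sum_mem fun i _ => Submodule.smul_mem _ _ (hσ i)
  have hzero : ∀ c (a : PolyXYZ), Fintype.linearCombination PolyXYZ ρ c = a • eulerTriple →
      Fintype.linearCombination PolyXYZ σ c = 0 := by
    intro c a h
    rw [hcomb, ← eq_sub_iff_add_eq, ← sub_smul] at h
    have hm := hmem c
    rw [h] at hm ⊢
    rw [smul_euler_mem (A := A) hd hm, zero_smul]
  refine ⟨d₁, d₂, σ, η, h1, h12, hhom 0 _ hr0, hhom 1 _ hr1, hhom 2 _ hr2, hη0, hη1, hη2,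
    ?_, ?_, ?_⟩
  · rw [← LinearMap.ker_eq_bot]
    exact LinearMap.ker_toSpanSingleton PolyXYZ hη
  · intro c
    constructor
    · intro h
      obtain ⟨t, ht⟩ := hker c _ (by rw [hcomb, h, zero_add])
      exact ⟨t, ht⟩
    · rintro ⟨t, rfl⟩
      obtain ⟨a, ha⟩ := hrel
      rw [LinearMap.toSpanSingleton_apply, map_smul, hzero _ _ ha, smul_zero]
  · intro θ
    constructor
    · intro h
      obtain ⟨c, a, hca⟩ := hgen θ (isLogarithmic_of_mem h)
      refine ⟨c, ?_⟩
      rw [hcomb, add_assoc, ← add_smul, ← sub_eq_iff_eq_add'] at hca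
      have h0 := smul_euler_mem (A := A) hd (hca ▸ sub_mem (show θ ∈ jacobianSyzygies A.definingPoly from h)
        (hmem c))
      rw [h0, zero_smul, sub_eq_zero] at hca
      exact hca.symm
    · rintro ⟨c, rfl⟩
      exact hmem c

end LineArrangement

end

/-! ### Explicit fields for a pencil with at most two further lines -/

section

open MvPolynomial
open scoped Matrix

/-- A nonzero constant field is not parallel to E: cancelling `F` would give pᵢ xⱼ = pⱼ xᵢ for all
i, j. -/
theorem eq_zero_of_smul_constTriple_eq {p : Fin 3 → ℂ} (hp : p ≠ 0) {F e : PolyXYZ}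
    (h : F • constTriple p = e • eulerTriple) : F = 0 := by
  by_contra hF
  have key : ∀ i j : Fin 3, (C (p i) * X j : PolyXYZ) = C (p j) * X i := by
    intro i j
    have hi := congrFun h i
    have hj := congrFun h j
    simp only [Pi.smul_apply, smul_eq_mul, constTriple, eulerTriple] at hi hj
    refine mul_left_cancel₀ hF ?_
    linear_combination X j * hi - X i * hj
  obtain ⟨i, hi⟩ := Function.ne_iff.1 hp
  obtain ⟨j, hj⟩ : ∃ j : Fin 3, j ≠ i := exists_ne i
  have := congrArg (eval (Pi.single j 1)) (key i j)
  simp [hj.symm] at this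
  exact hi this

theorem eq_smul_cross {m n p : Fin 3 → ℂ} (h : LinearIndependent ℂ ![m, n])
    (hm : m ⬝ᵥ p = 0) (hn : n ⬝ᵥ p = 0) : ∃ c : ℂ, p = c • (m ⨯₃ n) := by
  obtain ⟨k, hk⟩ := exists_dot_eq_one (cross_ne_zero h)
  refine ⟨k ⬝ᵥ p, ?_⟩
  have h3 := cross_cross_eq_zero hm hn
  generalize m ⨯₃ n = q at hk h3
  have e0 := congrFun h3 0
  have e1 := congrFun h3 1
  have e2 := congrFun h3 2
  simp only [cross_zero_apply, cross_one_apply, cross_two_apply, Pi.zero_apply] at e0 e1 e2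
  rw [dot_expand] at hk
  ext1 j
  fin_cases j <;> simp [dot_expand]
  · linear_combination -p 0 * hk + k 1 * e2 - k 2 * e1
  · linear_combination -p 1 * hk - k 0 * e2 + k 2 * e0
  · linear_combination -p 2 * hk + k 0 * e1 - k 1 * e0

theorem exists_eq_smul_euler_add_of_tripleProd' {m n p : Fin 3 → ℂ}
    (h : LinearIndependent ℂ ![m, n]) (hp : p ≠ 0) (hm : m ⬝ᵥ p = 0) (hn : n ⬝ᵥ p = 0)
    {τ : Fin 3 → PolyXYZ} (hτ : tripleProd τ eulerTriple (constTriple p) = 0) :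
    ∃ a b : PolyXYZ, τ = a • eulerTriple + b • constTriple p ∧
      ∀ r, IsHomogeneousTriple τ r → b.IsHomogeneous r := by
  obtain ⟨c, rfl⟩ := eq_smul_cross h hm hn
  have hc : c ≠ 0 := by rintro rfl; simp at hp
  have hcc : (C c⁻¹ : PolyXYZ) * C c = 1 := by rw [← C_mul, inv_mul_cancel₀ hc, C_1]
  have hcon : constTriple (c • (m ⨯₃ n)) = (C c : PolyXYZ) • constTriple (m ⨯₃ n) := by
    ext1 j; simp [constTriple]
  rw [hcon] at hτ ⊢
  have hτ' : tripleProd τ eulerTriple (constTriple (m ⨯₃ n)) = 0 := by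
    refine mul_left_cancel₀ (left_ne_zero_of_mul_eq_one ((mul_comm _ _).trans hcc)) ?_
    rw [mul_zero, ← hτ]
    simp only [tripleProd_expand, Pi.smul_apply, smul_eq_mul]; ring
  obtain ⟨a, b, hab, hb⟩ := exists_eq_smul_euler_add_of_tripleProd h hτ'
  refine ⟨a, C c⁻¹ * b, ?_, fun r hr => (hb r hr).C_mul _⟩
  rw [hab, smul_smul, mul_right_comm, hcc, one_mul]

theorem grad_prod_dot_constTriple {ι : Type*} (s : Finset ι) (l : ι → Fin 3 → ℂ)
    {p : Fin 3 → ℂ} (h : ∀ i ∈ s, l i ⬝ᵥ p = 0) :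
    grad (∏ i ∈ s, linForm (l i)) ⬝ᵥ constTriple p = 0 := by
  classical
  induction s using Finset.induction_on with
  | empty => simp [dot_expand, grad]
  | insert a s ha ih =>
    rw [Finset.prod_insert ha, grad_mul_dot, grad_linForm, constTriple_dot,
      h a (Finset.mem_insert_self _ _), ih fun i hi => h i (Finset.mem_insert_of_mem hi)]
    simp

namespace LineArrangement

variable {d : ℕ} (A : LineArrangement d)

/-- The lines of the arrangement that pass through the point `p`. -/
noncomputable def pencil (p : Fin 3 → ℂ) : Finset (Fin d) :=
  open Classical in Finset.univ.filter fun i => A.coeff i ⬝ᵥ p = 0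

/-- The product of the equations of the lines through `p`. -/
noncomputable def pencilPoly (p : Fin 3 → ℂ) : PolyXYZ := ∏ i ∈ A.pencil p, linForm (A.coeff i)

/-- A field tangent to the lines through `p` and to all lines with equation `l = const`. -/
noncomputable def pencilField (p l : Fin 3 → ℂ) : Fin 3 → PolyXYZ :=
  grad (A.pencilPoly p) ⨯₃ constTriple l

variable {A}

theorem mem_pencil {p : Fin 3 → ℂ} {i : Fin d} : i ∈ A.pencil p ↔ A.coeff i ⬝ᵥ p = 0 := by
  simp [pencil]

theorem pencilPoly_isHomogeneous (p : Fin 3 → ℂ) :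
    (A.pencilPoly p).IsHomogeneous (A.pencil p).card := by
  have := IsHomogeneous.prod (A.pencil p) (fun i => linForm (A.coeff i)) (fun _ => 1)
    (fun i _ => linForm_isHomogeneous _)
  simpa [pencilPoly] using this

theorem pencilPoly_ne_zero (p : Fin 3 → ℂ) : A.pencilPoly p ≠ 0 :=
  Finset.prod_ne_zero_iff.2 fun i _ => linForm_ne_zero (A.coeff_ne_zero i)

theorem pencilField_isHomogeneous (p l : Fin 3 → ℂ) :
    IsHomogeneousTriple (A.pencilField p l) ((A.pencil p).card - 1) := by
  have hg : ∀ j, (grad (A.pencilPoly p) j).IsHomogeneous ((A.pencil p).card - 1) :=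
    fun j => (pencilPoly_isHomogeneous p).pderiv
  have h : ∀ i j k m, (grad (A.pencilPoly p) i * constTriple l j
      - grad (A.pencilPoly p) k * constTriple l m).IsHomogeneous ((A.pencil p).card - 1) :=
    fun i j k m => ((hg i).mul (isHomogeneous_C _ _)).sub ((hg k).mul (isHomogeneous_C _ _))
  intro c
  fin_cases c <;> simp only [Fin.zero_eta, Fin.mk_one, Fin.reduceFinMk, pencilField,
    cross_zero_apply, cross_one_apply, cross_two_apply] <;> exact h _ _ _ _

theorem isTangent_pencilField {p : Fin 3 → ℂ} (l : Fin 3 → ℂ) {i : Fin d}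
    (hi : i ∈ A.pencil p) : IsTangent (A.coeff i) (A.pencilField p l) := by
  classical
  have hg : ∀ θ, grad (A.pencilPoly p) ⬝ᵥ θ = linForm (A.coeff i) *
      (grad (∏ j ∈ (A.pencil p).erase i, linForm (A.coeff j)) ⬝ᵥ θ) +
      (∏ j ∈ (A.pencil p).erase i, linForm (A.coeff j)) * (constTriple (A.coeff i) ⬝ᵥ θ) := by
    intro θ
    rw [pencilPoly, ← Finset.mul_prod_erase _ _ hi, grad_mul_dot, grad_linForm]
  have h1 : constTriple (A.coeff i) ⬝ᵥ (A.pencilField p l) =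
      grad (A.pencilPoly p) ⬝ᵥ (constTriple l ⨯₃ constTriple (A.coeff i)) :=
    triple_product_permutation _ _ _
  unfold IsTangent
  rw [h1, hg, dot_cross_self, mul_zero, add_zero]
  exact dvd_mul_right _ _

theorem constTriple_dot_pencilField (p l m : Fin 3 → ℂ) :
    constTriple m ⬝ᵥ A.pencilField p l = grad (A.pencilPoly p) ⬝ᵥ constTriple (l ⨯₃ m) := by
  rw [← constTriple_cross]
  exact triple_product_permutation _ _ _

theorem constTriple_dot_pencilField_self (p l : Fin 3 → ℂ) :
    constTriple l ⬝ᵥ A.pencilField p l = 0 := dot_cross_self _ _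

/-- Write P for `pencilPoly`. By the Binet–Cauchy identity the determinant is (∇P·E)(l·p) -
(∇P·p)(l·E). Euler's formula evaluates the first term, and the second vanishes because P is constant
in the direction p. This is the determinant behind all the pencil cases. -/
theorem tripleProd_pencilField (p l : Fin 3 → ℂ) :
    tripleProd (A.pencilField p l) eulerTriple (constTriple p) =
      C ((A.pencil p).card * (l ⬝ᵥ p)) * A.pencilPoly p := by
  have h1 := grad_dot_euler (pencilPoly_isHomogeneous (A := A) p)
  have h2 := grad_prod_dot_constTriple (A.pencil p) A.coeff (p := p) fun i hi => mem_pencil.1 hi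
  have h3 := constTriple_dot l p
  have : tripleProd (A.pencilField p l) eulerTriple (constTriple p) =
      (grad (A.pencilPoly p) ⬝ᵥ eulerTriple) * (constTriple l ⬝ᵥ constTriple p) -
      (grad (A.pencilPoly p) ⬝ᵥ constTriple p) * (constTriple l ⬝ᵥ eulerTriple) :=
    cross_dot_cross _ _ _ _
  rw [this, h1, h3, pencilPoly, h2, C_mul, map_natCast]
  ring

/-- The constant field p is tangent to the lines through p; multiplying it by the product of the
other lines makes it logarithmic. -/
theorem mdr_le_card_sub (hd : d ≠ 0) {p : Fin 3 → ℂ} (hp : p ≠ 0) :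
    mdr A.definingPoly ≤ d - (A.pencil p).card := by
  classical
  set F : PolyXYZ := ∏ i ∈ (A.pencil p)ᶜ, linForm (A.coeff i) with hF
  have hFd : F.IsHomogeneous (d - (A.pencil p).card) := by
    have := IsHomogeneous.prod ((A.pencil p)ᶜ) (fun i => linForm (A.coeff i)) (fun _ => 1)
      (fun i _ => linForm_isHomogeneous _)
    simpa [Finset.card_compl] using this
  have hF0 : F ≠ 0 := Finset.prod_ne_zero_iff.2 fun i _ => linForm_ne_zero (A.coeff_ne_zero i)
  refine mdr_le hd (θ := F • constTriple p) (fun i => ?_)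
    ((isHomogeneousTriple_constTriple p).smul hFd)
    fun g hg => hF0 (eq_zero_of_smul_constTriple_eq hp hg)
  by_cases hi : i ∈ A.pencil p
  · exact (isTangent_constTriple (mem_pencil.1 hi)).smul F
  · unfold IsTangent
    rw [dotProduct_smul]
    exact Dvd.dvd.mul_right (Finset.dvd_prod_of_mem _ (Finset.mem_compl.2 hi)) _

theorem isFreeCurve_of_concurrent (hd : d ≠ 0) {p : Fin 3 → ℂ} (hp : p ≠ 0)
    (h : ∀ i, A.coeff i ⬝ᵥ p = 0) : IsFreeCurve A.definingPoly := by
  obtain ⟨l, hl⟩ := exists_dot_eq_one hp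
  have hu : A.pencil p = Finset.univ := Finset.eq_univ_iff_forall.2 fun i => mem_pencil.2 (h i)
  have hf : A.pencilPoly p = A.definingPoly := by rw [pencilPoly, hu, definingPoly_eq]
  refine isFreeCurve_of_tripleProd hd (θ₁ := A.pencilField p l) (θ₂ := constTriple p)
    (fun i => isTangent_pencilField l (mem_pencil.2 (h i)))
    (fun i => isTangent_constTriple (h i)) (pencilField_isHomogeneous p l)
    (isHomogeneousTriple_constTriple p) (c := d) (Nat.cast_ne_zero.2 hd) ?_
  rw [tripleProd_pencilField, hf, hu, hl]
  simp

theorem isFreeCurve_of_one_transversal (hd : 2 ≤ d) {p : Fin 3 → ℂ} {i₀ : Fin d}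
    (h₀ : A.coeff i₀ ⬝ᵥ p ≠ 0) (h : ∀ i, i ≠ i₀ → A.coeff i ⬝ᵥ p = 0) :
    IsFreeCurve A.definingPoly := by
  classical
  have hn : i₀ ∉ A.pencil p := fun hi => h₀ (mem_pencil.1 hi)
  have hu : insert i₀ (A.pencil p) = Finset.univ := Finset.eq_univ_iff_forall.2 fun i => by
    by_cases hi : i = i₀
    · simp [hi]
    · exact Finset.mem_insert_of_mem (mem_pencil.2 (h i hi))
  have hf : A.definingPoly = linForm (A.coeff i₀) * A.pencilPoly p := by
    rw [definingPoly_eq, ← hu, Finset.prod_insert hn, pencilPoly]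
  have hcard : (A.pencil p).card + 1 = d := by
    rw [← Finset.card_insert_of_notMem hn, hu, Finset.card_univ, Fintype.card_fin]
  have hm : ((A.pencil p).card : ℂ) ≠ 0 := Nat.cast_ne_zero.2 (by omega)
  refine isFreeCurve_of_tripleProd (by omega) (θ₁ := A.pencilField p (A.coeff i₀))
    (θ₂ := linForm (A.coeff i₀) • constTriple p) (fun i => ?_) (fun i => ?_)
    (pencilField_isHomogeneous p _)
    ((isHomogeneousTriple_constTriple p).smul (linForm_isHomogeneous _))
    (c := (A.pencil p).card * (A.coeff i₀ ⬝ᵥ p)) (mul_ne_zero hm h₀) ?_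
  · by_cases hi : i = i₀
    · subst hi
      simp [IsTangent, constTriple_dot_pencilField_self]
    · exact isTangent_pencilField _ (mem_pencil.2 (h i hi))
  · by_cases hi : i = i₀
    · subst hi
      unfold IsTangent
      rw [dotProduct_smul]
      exact dvd_mul_right _ _
    · exact (isTangent_constTriple (h i hi)).smul _
  · have := tripleProd_pencilField (A := A) p (A.coeff i₀)
    rw [hf, mul_left_comm, ← this]
    simp only [tripleProd_expand, Pi.smul_apply, smul_eq_mul]; ring

section TwoTransversals

variable {p : Fin 3 → ℂ} {i₀ i₁ : Fin d}

theorem insert_insert_pencil [DecidableEq (Fin d)]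
    (h : ∀ i, i ≠ i₀ → i ≠ i₁ → A.coeff i ⬝ᵥ p = 0) :
    insert i₀ (insert i₁ (A.pencil p)) = Finset.univ :=
  Finset.eq_univ_iff_forall.2 fun i => by
    by_cases hi : i = i₀
    · simp [hi]
    by_cases hi' : i = i₁
    · simp [hi']
    · simp [mem_pencil.2 (h i hi hi')]

theorem definingPoly_of_two_transversals (h01 : i₀ ≠ i₁) (h₀ : A.coeff i₀ ⬝ᵥ p ≠ 0)
    (h₁ : A.coeff i₁ ⬝ᵥ p ≠ 0) (h : ∀ i, i ≠ i₀ → i ≠ i₁ → A.coeff i ⬝ᵥ p = 0) :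
    A.definingPoly = linForm (A.coeff i₀) * (linForm (A.coeff i₁) * A.pencilPoly p) := by
  classical
  rw [definingPoly_eq, ← insert_insert_pencil h, Finset.prod_insert, Finset.prod_insert, pencilPoly]
  · exact fun hi => h₁ (mem_pencil.1 hi)
  · simpa [h01] using fun hi => h₀ (mem_pencil.1 hi)

theorem card_pencil_of_two_transversals (h01 : i₀ ≠ i₁) (h₀ : A.coeff i₀ ⬝ᵥ p ≠ 0)
    (h₁ : A.coeff i₁ ⬝ᵥ p ≠ 0) (h : ∀ i, i ≠ i₀ → i ≠ i₁ → A.coeff i ⬝ᵥ p = 0) :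
    (A.pencil p).card + 2 = d := by
  classical
  have := congrArg Finset.card (insert_insert_pencil h)
  rw [Finset.card_insert_of_notMem, Finset.card_insert_of_notMem, Finset.card_univ,
    Fintype.card_fin] at this
  · exact this
  · exact fun hi => h₁ (mem_pencil.1 hi)
  · simpa [h01] using fun hi => h₀ (mem_pencil.1 hi)

/-- The value of the `i₁`-th form on the pencil field, at the intersection of the transversals. -/
theorem eval_dot_pencilField :
    eval (A.coeff i₀ ⨯₃ A.coeff i₁)
      (constTriple (A.coeff i₁) ⬝ᵥ A.pencilField p (A.coeff i₀)) =
    (A.pencil p).card * ∏ i ∈ A.pencil p, A.coeff i ⬝ᵥ (A.coeff i₀ ⨯₃ A.coeff i₁) := by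
  have h := congrArg (eval (A.coeff i₀ ⨯₃ A.coeff i₁))
    (grad_dot_euler (pencilPoly_isHomogeneous (A := A) p))
  rw [constTriple_dot_pencilField]
  rw [map_mul, map_natCast, pencilPoly, map_prod] at h
  simp only [eval_linForm] at h
  rw [← h]
  simp [dot_expand, constTriple, eulerTriple, pencilPoly]

/-- The pencil field w is tangent to everything except possibly the second transversal. Its defect k
there vanishes at the meeting point of the transversals, because a pencil line passes through that
point. Hence k = aα + bβ in the two transversal forms a, b, and a multiple of the constant field p
absorbs aα. -/
theorem isFreeCurve_of_two_transversals (hd : 4 ≤ d) (h01 : i₀ ≠ i₁)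
    (h₀ : A.coeff i₀ ⬝ᵥ p ≠ 0) (h₁ : A.coeff i₁ ⬝ᵥ p ≠ 0)
    (h : ∀ i, i ≠ i₀ → i ≠ i₁ → A.coeff i ⬝ᵥ p = 0)
    {i₂ : Fin d} (hi₂ : A.coeff i₂ ⬝ᵥ p = 0)
    (hq : A.coeff i₂ ⬝ᵥ (A.coeff i₀ ⨯₃ A.coeff i₁) = 0) : IsFreeCurve A.definingPoly := by
  have hcard := card_pencil_of_two_transversals h01 h₀ h₁ h
  have hf := definingPoly_of_two_transversals h01 h₀ h₁ h
  set k := constTriple (A.coeff i₁) ⬝ᵥ A.pencilField p (A.coeff i₀) with hk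
  have hk0 : eval (A.coeff i₀ ⨯₃ A.coeff i₁) k = 0 := by
    rw [hk, eval_dot_pencilField, Finset.prod_eq_zero (mem_pencil.2 hi₂) hq, mul_zero]
  -- The degree is d - 3, written as a successor to suit `exists_eq_add_of_eval_cross`.
  have hkh : k.IsHomogeneous ((d - 4) + 1) := by
    have : (d - 4) + 1 = (A.pencil p).card - 1 := by omega
    rw [this]
    exact dot_isHomogeneous (pencilField_isHomogeneous p _) _
  obtain ⟨α, β, hα, hβ, hαβ⟩ := exists_eq_add_of_eval_cross (A.coeff_distinct _ _ h01) hkh hk0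
  set κ := A.coeff i₁ ⬝ᵥ p
  have hκ : (C κ⁻¹ : PolyXYZ) * C κ = 1 := by rw [← C_mul, inv_mul_cancel₀ h₁, C_1]
  have hm : ((A.pencil p).card : ℂ) ≠ 0 := Nat.cast_ne_zero.2 (by omega)
  refine isFreeCurve_of_tripleProd (by omega) (θ₁ := A.pencilField p (A.coeff i₀) -
      (C κ⁻¹ * (linForm (A.coeff i₀) * α)) • constTriple p)
    (θ₂ := (linForm (A.coeff i₀) * linForm (A.coeff i₁)) • constTriple p)
    (fun i => ?_) (fun i => ?_) (d₁ := (d - 4) + 1) (d₂ := 2) ?_ ?_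
    (c := (A.pencil p).card * (A.coeff i₀ ⬝ᵥ p)) (mul_ne_zero hm h₀) ?_
  · by_cases hi : i = i₀
    · subst hi
      unfold IsTangent
      rw [dotProduct_sub, dotProduct_smul, constTriple_dot_pencilField_self, zero_sub, dvd_neg]
      exact ⟨C κ⁻¹ * α * (constTriple (A.coeff i) ⬝ᵥ constTriple p), by
        simp only [smul_eq_mul]; ring⟩
    by_cases hi' : i = i₁
    · subst hi'
      unfold IsTangent
      rw [dotProduct_sub, dotProduct_smul, ← hk, hαβ, constTriple_dot]
      exact ⟨β, by simp only [smul_eq_mul]; linear_combination (-linForm (A.coeff i₀) * α) * hκ⟩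
    · exact (isTangent_pencilField _ (mem_pencil.2 (h i hi hi'))).sub
        ((isTangent_constTriple (h i hi hi')).smul _)
  · by_cases hi : i = i₀
    · subst hi
      unfold IsTangent
      rw [dotProduct_smul]
      exact Dvd.intro _ (mul_assoc _ _ _).symm
    by_cases hi' : i = i₁
    · subst hi'
      unfold IsTangent
      rw [dotProduct_smul]
      exact (dvd_mul_left _ _).mul_right _
    · exact (isTangent_constTriple (h i hi hi')).smul _
  · refine IsHomogeneousTriple.sub ?_ ?_
    · have : (d - 4) + 1 = (A.pencil p).card - 1 := by omega
      rw [this]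
      exact pencilField_isHomogeneous p _
    · have := (isHomogeneousTriple_constTriple p).smul
        (((linForm_isHomogeneous (A.coeff i₀)).mul hα).C_mul κ⁻¹)
      rwa [add_zero, add_comm 1] at this
  · exact (isHomogeneousTriple_constTriple p).smul
      ((linForm_isHomogeneous (A.coeff i₀)).mul (linForm_isHomogeneous (A.coeff i₁)))
  · have := tripleProd_pencilField (A := A) p (A.coeff i₀)
    have e : ∀ x a b g : PolyXYZ, x * (a * (b * g)) = a * b * (x * g) := fun x a b g => by ring
    rw [hf, e, ← this]
    simp only [tripleProd_expand, Pi.smul_apply, Pi.sub_apply, smul_eq_mul]; ring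

/-- Now the defect k of the pencil field w does not vanish at the meeting point q of the
transversals a, b. A multiple uw can be corrected to a logarithmic field only if u vanishes at q,
that is, u ∈ (a, b). This ideal needs two generators, tied by one Koszul relation, which accounts
for two of the generators and for the syzygy between all three. -/
theorem isNearlyFreeCurve_of_two_transversals (hd : 4 ≤ d) (h01 : i₀ ≠ i₁) (hp : p ≠ 0)
    (h₀ : A.coeff i₀ ⬝ᵥ p ≠ 0) (h₁ : A.coeff i₁ ⬝ᵥ p ≠ 0)
    (h : ∀ i, i ≠ i₀ → i ≠ i₁ → A.coeff i ⬝ᵥ p = 0)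
    (hq : ∀ i, A.coeff i ⬝ᵥ p = 0 → A.coeff i ⬝ᵥ (A.coeff i₀ ⨯₃ A.coeff i₁) ≠ 0) :
    IsNearlyFreeCurve A.definingPoly := by
  have hcard := card_pencil_of_two_transversals h01 h₀ h₁ h
  obtain ⟨j₀, hj₀, j₁, hj₁, hj⟩ := Finset.one_lt_card.1 (show 1 < (A.pencil p).card by omega)
  have hind := A.coeff_distinct _ _ h01
  have hm : ((A.pencil p).card : ℂ) ≠ 0 := Nat.cast_ne_zero.2 (by omega)
  set w := A.pencilField p (A.coeff i₀) with hw
  set k := constTriple (A.coeff i₁) ⬝ᵥ w with hk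
  have hwhom : IsHomogeneousTriple w (d - 3) := by
    have : d - 3 = (A.pencil p).card - 1 := by omega
    rw [this]; exact pencilField_isHomogeneous p _
  have hkhom : k.IsHomogeneous (d - 3) := dot_isHomogeneous hwhom _
  have hk0 : eval (A.coeff i₀ ⨯₃ A.coeff i₁) k ≠ 0 := by
    rw [hk, hw, eval_dot_pencilField]
    exact mul_ne_zero hm (Finset.prod_ne_zero_iff.2 fun i hi => hq i (mem_pencil.1 hi))
  have hkr : restrictToPoint (A.coeff i₀ ⨯₃ A.coeff i₁) k ≠ 0 := by
    rw [restrictToPoint_of_isHomogeneous _ hkhom]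
    exact mul_ne_zero (by simpa using hk0) (pow_ne_zero _ Polynomial.X_ne_zero)
  set a := linForm (A.coeff i₀) with ha
  set b := linForm (A.coeff i₁) with hb
  have hah : a.IsHomogeneous 1 := linForm_isHomogeneous _
  have hbh : b.IsHomogeneous 1 := linForm_isHomogeneous _
  have ha0 : a ≠ 0 := linForm_ne_zero (A.coeff_ne_zero i₀)
  have hb0 : b ≠ 0 := linForm_ne_zero (A.coeff_ne_zero i₁)
  have hbp : Prime b := linForm_prime (A.coeff_ne_zero i₁)
  have hba : ¬ b ∣ a := not_linForm_dvd (A.coeff_distinct _ _ h01.symm)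
  set κ := A.coeff i₁ ⬝ᵥ p
  have hκ : (C κ⁻¹ : PolyXYZ) * C κ = 1 := by rw [← C_mul, inv_mul_cancel₀ h₁, C_1]
  have haw : constTriple (A.coeff i₀) ⬝ᵥ w = 0 := constTriple_dot_pencilField_self _ _
  have hap : constTriple (A.coeff i₀) ⬝ᵥ constTriple p = C (A.coeff i₀ ⬝ᵥ p) := constTriple_dot _ _
  have hbp' : constTriple (A.coeff i₁) ⬝ᵥ constTriple p = C κ := constTriple_dot _ _
  set ν : ℂ := (A.pencil p).card * (A.coeff i₀ ⬝ᵥ p)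
  have hν : ν ≠ 0 := mul_ne_zero hm h₀
  have hν' : (C ν⁻¹ : PolyXYZ) * C ν = 1 := by rw [← C_mul, inv_mul_cancel₀ hν, C_1]
  have hdet : tripleProd w eulerTriple (constTriple p) = C ν * A.pencilPoly p :=
    tripleProd_pencilField _ _
  have hcomb : ∀ c : Fin 3 → PolyXYZ, Fintype.linearCombination PolyXYZ
      ![(a * b) • constTriple p, a • w - (a * (C κ⁻¹ * k)) • constTriple p, b • w] c =
      (c 1 * a + c 2 * b) • w + (c 0 * a * b - c 1 * a * (C κ⁻¹ * k)) • constTriple p := by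
    intro c
    simp only [Fintype.linearCombination_apply, Fin.sum_univ_three, Matrix.cons_val_zero,
      Matrix.cons_val_one, Matrix.cons_val]
    module
  -- The generators are ab·p, the multiple aw corrected along p so as to be tangent to b, and bw,
  -- which needs no correction. The relation is b·(aw) - a·(bw) = 0 with the correction term
  -- compensated by ab·p.
  refine isNearlyFreeCurve_of_logarithmic (by omega) (d₁ := 2) (d₂ := d - 2) (by omega) (by omega)
    (ρ := ![(a * b) • constTriple p, a • w - (a * (C κ⁻¹ * k)) • constTriple p, b • w])
    (η := ![C κ⁻¹ * k, b, -a]) ?_ ?_ ?_ ?_ ?_ hbh hah.neg ?_ ⟨0, ?_⟩ ?_ ?_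
  · intro j i
    by_cases hi : i = i₀
    · subst hi
      fin_cases j <;> simp only [IsTangent, Fin.zero_eta, Fin.mk_one, Fin.reduceFinMk,
        Matrix.cons_val_zero, Matrix.cons_val_one, Matrix.cons_val, dotProduct_sub,
        dotProduct_smul, haw, hap, smul_eq_mul]
      · exact Dvd.intro _ (mul_assoc _ _ _).symm
      · exact ⟨-(C κ⁻¹ * k * C (A.coeff i ⬝ᵥ p)), by ring⟩
      · simp
    by_cases hi' : i = i₁
    · subst hi'
      fin_cases j <;> simp only [IsTangent, Fin.zero_eta, Fin.mk_one, Fin.reduceFinMk,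
        Matrix.cons_val_zero, Matrix.cons_val_one, Matrix.cons_val, dotProduct_sub,
        dotProduct_smul, ← hk, hbp', smul_eq_mul]
      · exact (dvd_mul_left _ _).mul_right _
      · exact ⟨0, by linear_combination (-a * k) * hκ⟩
      · exact dvd_mul_right _ _
    · have t1 : IsTangent (A.coeff i) w := isTangent_pencilField _ (mem_pencil.2 (h i hi hi'))
      have t2 : IsTangent (A.coeff i) (constTriple p) := isTangent_constTriple (h i hi hi')
      fin_cases j
      exacts [t2.smul _, (t1.smul _).sub (t2.smul _), t1.smul _]
  · exact (isHomogeneousTriple_constTriple p).smul (hah.mul hbh)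
  · have e1 : d - 2 = 1 + (d - 3) := by omega
    have e2 := (isHomogeneousTriple_constTriple p).smul (hah.mul (hkhom.C_mul κ⁻¹))
    rw [e1]
    exact (hwhom.smul hah).sub e2
  · have e1 : d - 2 = 1 + (d - 3) := by omega
    rw [e1]
    exact hwhom.smul hbh
  · have e1 : d - 2 - 2 + 1 = d - 3 := by omega
    rw [e1]
    exact hkhom.C_mul κ⁻¹
  · intro h0
    exact hb0 (congrFun h0 1)
  · rw [hcomb]
    simp only [Matrix.cons_val_zero, Matrix.cons_val_one, Matrix.cons_val]
    have e1 : b * a + -a * b = 0 := by ring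
    have e2 : C κ⁻¹ * k * a * b - b * a * (C κ⁻¹ * k) = 0 := by ring
    rw [e1, e2]
    simp
  · intro θ hθ
    -- Comparing det(θ, E, p) with the same determinant for w determines the coefficient u of w in
    -- θ; the rest is a combination of E and p.
    obtain ⟨u', hu'⟩ := prod_linForm_dvd (A.pencil p) A.coeff (fun i _ => A.coeff_ne_zero i)
      (fun i _ j _ => A.coeff_distinct i j) (tripleProd θ eulerTriple (constTriple p))
      fun i hi => dvd_tripleProd (A.coeff_ne_zero i) (hθ i) (isTangent_euler _)
        (isTangent_constTriple (mem_pencil.1 hi))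
    change _ = A.pencilPoly p * u' at hu'
    set u := C ν⁻¹ * u' with hu
    have h0 : tripleProd (θ - u • w) eulerTriple (constTriple p) = 0 := by
      have : tripleProd (θ - u • w) eulerTriple (constTriple p) =
          tripleProd θ eulerTriple (constTriple p) -
          u * tripleProd w eulerTriple (constTriple p) := by
        simp only [tripleProd_expand, Pi.smul_apply, Pi.sub_apply, smul_eq_mul]; ring
      rw [this, hu', hdet, hu]
      linear_combination (-A.pencilPoly p * u') * hν'
    obtain ⟨e, s, hes, -⟩ := exists_eq_smul_euler_add_of_tripleProd' (A.coeff_distinct _ _ hj)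
      hp (mem_pencil.1 hj₀) (mem_pencil.1 hj₁) h0
    rw [sub_eq_iff_eq_add] at hes
    have hs : a ∣ s := by
      have := hθ i₀
      unfold IsTangent at this
      rw [hes, dotProduct_add, dotProduct_add, dotProduct_smul, dotProduct_smul, dotProduct_smul,
        haw, hap, smul_zero, add_zero] at this
      have h2 : a ∣ s • C (A.coeff i₀ ⬝ᵥ p) :=
        (dvd_add_right (Dvd.intro_left e rfl)).1 this
      rw [smul_eq_mul] at h2
      exact ((isUnit_iff_ne_zero.2 h₀).map C).dvd_mul_right.1 h2
    obtain ⟨s', rfl⟩ := hs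
    obtain ⟨z, hz⟩ : b ∣ u * k + a * s' * C κ := by
      have := hθ i₁
      unfold IsTangent at this
      rw [hes, dotProduct_add, dotProduct_add, dotProduct_smul, dotProduct_smul, dotProduct_smul,
        ← hk, hbp', add_assoc] at this
      have h2 := (dvd_add_right (Dvd.intro_left e rfl)).1 this
      simp only [smul_eq_mul] at h2
      rwa [add_comm]
    -- Tangency to the second transversal, restricted to q, says u k = 0 there, and k does not
    -- vanish at q.
    have hur : restrictToPoint (A.coeff i₀ ⨯₃ A.coeff i₁) u = 0 := by
      have := congrArg (restrictToPoint (A.coeff i₀ ⨯₃ A.coeff i₁)) hz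
      simp only [map_add, map_mul, ha, hb, restrictToPoint_linForm, dot_self_cross,
        dot_cross_self, Polynomial.C_0, zero_mul, add_zero] at this
      exact (mul_eq_zero.1 this).resolve_right hkr
    obtain ⟨u₁, u₂, hu12⟩ := Ideal.mem_span_pair.1 (mem_span_pair_of_restrictToPoint hind hur)
    obtain ⟨y, hy⟩ := (hbp.dvd_or_dvd (a := a) (b := u₁ * k + s' * C κ)
      ⟨z - u₂ * k, by linear_combination hz + k * hu12⟩).resolve_left hba
    refine ⟨![C κ⁻¹ * y, u₁, u₂], e, ?_⟩
    rw [hcomb, hes]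
    simp only [Matrix.cons_val_zero, Matrix.cons_val_one, Matrix.cons_val]
    have e1 : a * s' = C κ⁻¹ * y * a * b - u₁ * a * (C κ⁻¹ * k) := by
      linear_combination (-a * s') * hκ + (C κ⁻¹ * a) * hy
    rw [e1, ← hu12]
    abel
  · intro c e hce
    rw [hcomb] at hce
    have h0 : (c 1 * a + c 2 * b) * tripleProd w eulerTriple (constTriple p) =
        tripleProd ((c 1 * a + c 2 * b) • w + (c 0 * a * b - c 1 * a * (C κ⁻¹ * k)) •
          constTriple p) eulerTriple (constTriple p) := by
      simp only [tripleProd_expand, Pi.smul_apply, Pi.add_apply, smul_eq_mul]; ring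
    have h0' : tripleProd (e • eulerTriple) eulerTriple (constTriple p) = 0 := by
      simp only [tripleProd_expand, Pi.smul_apply, smul_eq_mul]; ring
    rw [hce, h0', hdet] at h0
    have h1 : c 1 * a + c 2 * b = 0 := (mul_eq_zero.1 h0).resolve_right
      (mul_ne_zero (by simpa using hν) (pencilPoly_ne_zero p))
    rw [h1, zero_smul, zero_add] at hce
    have h2 := eq_zero_of_smul_constTriple_eq hp hce
    obtain ⟨t, ht⟩ := (hbp.dvd_or_dvd (a := a) (b := c 1)
      ⟨-c 2, by linear_combination h1⟩).resolve_left hba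
    refine ⟨t, ?_⟩
    ext1 j
    fin_cases j <;> simp
    · refine mul_left_cancel₀ (mul_ne_zero ha0 hb0) ?_
      linear_combination -h2 - a * (C κ⁻¹ * k) * ht
    · rw [ht]; ring
    · refine mul_left_cancel₀ hb0 ?_
      linear_combination -h1 + a * ht

end TwoTransversals

/-! ### Power fields and freeness of the arrangement abc(a-b)(a-c)(b-c) -/

/-- The field with components `aⁿ, bⁿ, cⁿ` with respect to the linear forms `a, b, c`. -/
noncomputable def powerField (a b c : Fin 3 → ℂ) (n : ℕ) : Fin 3 → PolyXYZ :=
  linForm a ^ n • constTriple (b ⨯₃ c) + linForm b ^ n • constTriple (c ⨯₃ a) +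
    linForm c ^ n • constTriple (a ⨯₃ b)

section PowerField

variable (a b c : Fin 3 → ℂ)

theorem powerField_isHomogeneous (n : ℕ) : IsHomogeneousTriple (powerField a b c n) n := by
  have h : ∀ l u, IsHomogeneousTriple (linForm l ^ n • constTriple u) n := fun l u => by
    simpa using (isHomogeneousTriple_constTriple u).smul ((linForm_isHomogeneous l).pow n)
  exact ((h _ _).add (h _ _)).add (h _ _)

theorem linForm_sub (l l' : Fin 3 → ℂ) : linForm (l - l') = linForm l - linForm l' := by
  simp [linForm_expand]; ring

theorem powerField_one : powerField a b c 1 = (C (tripleProd a b c) : PolyXYZ) • eulerTriple := by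
  ext1 j
  fin_cases j <;> simp [powerField, linForm_expand, constTriple, cross_apply, eulerTriple,
    tripleProd_expand] <;> ring

theorem constTriple_dot_powerField (n : ℕ) :
    constTriple a ⬝ᵥ powerField a b c n = C (tripleProd a b c) * linForm a ^ n ∧
    constTriple b ⬝ᵥ powerField a b c n = C (tripleProd a b c) * linForm b ^ n ∧
    constTriple c ⬝ᵥ powerField a b c n = C (tripleProd a b c) * linForm c ^ n := by
  simp only [dot_expand, powerField, Pi.add_apply, Pi.smul_apply, constTriple,
    cross_zero_apply, cross_one_apply, cross_two_apply, tripleProd_expand, smul_eq_mul, map_add,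
    map_sub, map_mul]
  refine ⟨by ring, by ring, by ring⟩

theorem tripleProd_linear_combination {R : Type*} [CommRing R] (p q r x y z : Fin 3 → R) :
    tripleProd (x 0 • p + x 1 • q + x 2 • r) (y 0 • p + y 1 • q + y 2 • r)
      (z 0 • p + z 1 • q + z 2 • r) = tripleProd x y z * tripleProd p q r := by
  simp only [tripleProd_expand, Pi.add_apply, Pi.smul_apply, smul_eq_mul]
  ring

/-- In the basis b × c, c × a, a × b, whose determinant is the square of that of a, b, c, the fields
have coordinates the powers 2, 1, 3 of the three forms. The determinant is thus Vandermonde times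
abc, up to sign from the order of rows. -/
theorem tripleProd_powerField :
    tripleProd (powerField a b c 2) (powerField a b c 1) (powerField a b c 3) =
      C (-(tripleProd a b c) ^ 2) * (linForm a * linForm b * linForm c *
        linForm (a - b) * linForm (a - c) * linForm (b - c)) * -1 := by
  have h := tripleProd_linear_combination (constTriple (b ⨯₃ c)) (constTriple (c ⨯₃ a))
    (constTriple (a ⨯₃ b)) ![linForm a ^ 2, linForm b ^ 2, linForm c ^ 2]
    ![linForm a ^ 1, linForm b ^ 1, linForm c ^ 1] ![linForm a ^ 3, linForm b ^ 3, linForm c ^ 3]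
  have h2 : tripleProd (constTriple (b ⨯₃ c)) (constTriple (c ⨯₃ a)) (constTriple (a ⨯₃ b)) =
      C (tripleProd a b c ^ 2) := by
    simp only [tripleProd_expand, constTriple, cross_zero_apply, cross_one_apply,
      cross_two_apply, ← C_mul, ← C_sub, ← C_add]
    congr 1
    ring
  rw [h2] at h
  refine h.trans ?_
  simp only [tripleProd_expand, Matrix.cons_val_zero, Matrix.cons_val_one, Matrix.cons_val,
    linForm_sub, map_neg]
  ring

variable {a b c}

/-- Pairing with a difference such as a - b gives a constant times aⁿ - bⁿ, which a - b divides. -/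
theorem isTangent_powerField {l : Fin 3 → ℂ} {s : ℂ}
    (hl : l = s • a ∨ l = s • b ∨ l = s • c ∨ l = s • (a - b) ∨ l = s • (a - c) ∨ l = s • (b - c))
    {n : ℕ} (hn : n ≠ 0) : IsTangent l (powerField a b c n) := by
  obtain ⟨h1, h2, h3⟩ := constTriple_dot_powerField a b c n
  have hsc : ∀ m, IsTangent m (powerField a b c n) → IsTangent (s • m) (powerField a b c n) := by
    intro m hm
    unfold IsTangent at hm ⊢
    have : constTriple (s • m) = (C s : PolyXYZ) • constTriple m := by
      ext1 j; simp [constTriple]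
    rw [linForm_smul, this, smul_dotProduct]
    exact mul_dvd_mul_left _ hm
  have hsub : ∀ m m' : Fin 3 → ℂ, constTriple (m - m') = constTriple m - constTriple m' := by
    intro m m'; ext1 j; simp [constTriple]
  rcases hl with rfl | rfl | rfl | rfl | rfl | rfl <;> refine hsc _ ?_ <;> unfold IsTangent
  · rw [h1]; exact (dvd_pow_self _ hn).mul_left _
  · rw [h2]; exact (dvd_pow_self _ hn).mul_left _
  · rw [h3]; exact (dvd_pow_self _ hn).mul_left _
  · rw [hsub, sub_dotProduct, h1, h2, linForm_sub, ← mul_sub]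
    exact (sub_dvd_pow_sub_pow _ _ _).mul_left _
  · rw [hsub, sub_dotProduct, h1, h3, linForm_sub, ← mul_sub]
    exact (sub_dvd_pow_sub_pow _ _ _).mul_left _
  · rw [hsub, sub_dotProduct, h2, h3, linForm_sub, ← mul_sub]
    exact (sub_dvd_pow_sub_pow _ _ _).mul_left _

/-- An arrangement projectively equivalent to `abc(a-b)(a-c)(b-c) = 0` is free and has `mdr ≤ 2`. -/
theorem isFreeCurve_and_mdr_le_of_braid (hd : d ≠ 0) (habc : tripleProd a b c ≠ 0)
    (hl : ∀ i, ∃ s : ℂ, A.coeff i = s • a ∨ A.coeff i = s • b ∨ A.coeff i = s • c ∨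
      A.coeff i = s • (a - b) ∨ A.coeff i = s • (a - c) ∨ A.coeff i = s • (b - c))
    {e : ℂ} (he : e ≠ 0) (hf : C e * A.definingPoly = linForm a * linForm b * linForm c *
        linForm (a - b) * linForm (a - c) * linForm (b - c)) :
    IsFreeCurve A.definingPoly ∧ mdr A.definingPoly ≤ 2 := by
  have hlog : ∀ n, n ≠ 0 → A.IsLogarithmic (powerField a b c n) := by
    intro n hn i
    obtain ⟨s, h⟩ := hl i
    exact isTangent_powerField h hn
  have hdet := tripleProd_powerField a b c
  have hNN : (C (tripleProd a b c) : PolyXYZ) ≠ 0 := by simpa using habc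
  rw [powerField_one, ← hf] at hdet
  have hdet' : tripleProd (powerField a b c 2) eulerTriple (powerField a b c 3) =
      C (tripleProd a b c * e) * A.definingPoly := by
    refine mul_left_cancel₀ hNN ?_
    have : C (tripleProd a b c) *
        tripleProd (powerField a b c 2) eulerTriple (powerField a b c 3) =
        tripleProd (powerField a b c 2) ((C (tripleProd a b c) : PolyXYZ) • eulerTriple)
          (powerField a b c 3) := by
      simp only [tripleProd_expand (R := PolyXYZ), Pi.smul_apply, smul_eq_mul]; ring
    rw [this, hdet]
    simp only [map_neg, map_mul, map_pow]
    ring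
  refine ⟨isFreeCurve_of_tripleProd hd (hlog 2 two_ne_zero) (hlog 3 three_ne_zero)
    (powerField_isHomogeneous a b c 2) (powerField_isHomogeneous a b c 3)
    (mul_ne_zero habc he) hdet', mdr_le hd (hlog 2 two_ne_zero)
    (powerField_isHomogeneous a b c 2) fun g hg => ?_⟩
  rw [hg] at hdet'
  have h0 : tripleProd (g • eulerTriple) eulerTriple (powerField a b c 3) = 0 := by
    simp only [tripleProd_expand, Pi.smul_apply, smul_eq_mul]; ring
  rw [h0] at hdet'
  refine mul_ne_zero ?_ A.definingPoly_ne_zero hdet'.symm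
  simpa using mul_ne_zero habc he

end PowerField

end LineArrangement

end

/-! ### Six lines with four triple points: normal form and combinatorics -/

section

open MvPolynomial
open scoped Matrix

theorem card_le_of_prod_linForm_dvd {ι : Type*} (s : Finset ι) (l : ι → Fin 3 → ℂ) {F : PolyXYZ}
    {n : ℕ} (hl : ∀ i ∈ s, l i ≠ 0) (hF : F.IsHomogeneous n) (hF0 : F ≠ 0)
    (h : ∏ i ∈ s, linForm (l i) ∣ F) : s.card ≤ n := by
  have h1 := totalDegree_le_of_dvd_of_isDomain h hF0
  have h2 : (∏ i ∈ s, linForm (l i)).IsHomogeneous s.card := by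
    have := IsHomogeneous.prod s (fun i => linForm (l i)) (fun _ => 1)
      (fun i _ => linForm_isHomogeneous _)
    simpa using this
  rw [hF.totalDegree hF0, h2.totalDegree
    (Finset.prod_ne_zero_iff.2 fun i hi => linForm_ne_zero (hl i hi))] at h1
  exact h1

theorem exists_eq_smul_add_smul_of_tripleProd {x y w : Fin 3 → ℂ}
    (h : LinearIndependent ℂ ![x, y]) (hw : tripleProd x y w = 0) :
    ∃ α β : ℂ, w = α • x + β • y := by
  obtain ⟨k, hk⟩ := exists_dot_eq_one (cross_ne_zero h)
  have h1 : tripleProd x y k = 1 := by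
    rw [← hk]
    simp only [tripleProd_expand, dot_expand, cross_zero_apply, cross_one_apply, cross_two_apply]
    ring
  have h2 := tripleProd_smul x y k w
  rw [h1, hw, one_smul, zero_smul, add_zero] at h2
  exact ⟨_, _, h2⟩

theorem tripleProd_rotate {R : Type*} [CommRing R] (a b c : Fin 3 → R) :
    tripleProd a b c = c ⬝ᵥ (a ⨯₃ b) := by
  simp only [tripleProd_expand, dot_expand, cross_zero_apply, cross_one_apply, cross_two_apply]
  ring

/-- Normal form for six lines with four triple points. -/
theorem exists_braid_normal_form {x : Fin 6 → Fin 3 → ℂ}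
    (hind : ∀ i j, i ≠ j → LinearIndependent ℂ ![x i, x j])
    (h012 : tripleProd (x 0) (x 1) (x 2) = 0) (h034 : tripleProd (x 0) (x 3) (x 4) = 0)
    (h135 : tripleProd (x 1) (x 3) (x 5) = 0) (h245 : tripleProd (x 2) (x 4) (x 5) = 0)
    (h013 : tripleProd (x 0) (x 1) (x 3) ≠ 0) :
    ∃ a b c : Fin 3 → ℂ, tripleProd a b c ≠ 0 ∧ ∃ s : Fin 6 → ℂ, (∀ i, s i ≠ 0) ∧
      x 0 = s 0 • a ∧ x 1 = s 1 • b ∧ x 3 = s 3 • c ∧ x 2 = s 2 • (a - b) ∧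
      x 4 = s 4 • (a - c) ∧ x 5 = s 5 • (b - c) := by
  have hne : ∀ i j, i ≠ j → ∀ t : ℂ, x i ≠ t • x j := by
    intro i j hij t h
    have := (LinearIndependent.pair_iff.1 (hind i j hij)) 1 (-t) (by rw [h]; module)
    exact one_ne_zero this.1
  obtain ⟨α, β, h2⟩ := exists_eq_smul_add_smul_of_tripleProd (hind 0 1 (by decide)) h012
  obtain ⟨γ, δ, h4⟩ := exists_eq_smul_add_smul_of_tripleProd (hind 0 3 (by decide)) h034
  obtain ⟨ε, ζ, h5⟩ := exists_eq_smul_add_smul_of_tripleProd (hind 1 3 (by decide)) h135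
  have hα : α ≠ 0 := by rintro rfl; exact hne 2 1 (by decide) β (by rw [h2]; module)
  have hβ : β ≠ 0 := by rintro rfl; exact hne 2 0 (by decide) α (by rw [h2]; module)
  have hγ : γ ≠ 0 := by rintro rfl; exact hne 4 3 (by decide) δ (by rw [h4]; module)
  have hδ : δ ≠ 0 := by rintro rfl; exact hne 4 0 (by decide) γ (by rw [h4]; module)
  have hε : ε ≠ 0 := by rintro rfl; exact hne 5 3 (by decide) ζ (by rw [h5]; module)
  have hζ : ζ ≠ 0 := by rintro rfl; exact hne 5 1 (by decide) ε (by rw [h5]; module)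
  have hrel : α * δ * ε + β * γ * ζ = 0 := by
    refine (mul_eq_zero.1 (?_ : (α * δ * ε + β * γ * ζ) * tripleProd (x 0) (x 1) (x 3) = 0)
      ).resolve_right h013
    rw [← neg_eq_zero, ← h245, h2, h4, h5]
    simp only [tripleProd_expand, Pi.add_apply, Pi.smul_apply, smul_eq_mul]
    ring
  refine ⟨α • x 0, (-β) • x 1, (-(δ * α / γ)) • x 3, ?_,
    ![α⁻¹, (-β)⁻¹, 1, (-(δ * α / γ))⁻¹, γ / α, -(ε / β)], ?_, ?_, ?_, ?_, ?_, ?_, ?_⟩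
  · have : tripleProd (α • x 0) ((-β) • x 1) ((-(δ * α / γ)) • x 3) =
        (α * -β * -(δ * α / γ)) * tripleProd (x 0) (x 1) (x 3) := by
      simp only [tripleProd_expand, Pi.smul_apply, smul_eq_mul]; ring
    rw [this]
    refine mul_ne_zero (mul_ne_zero (mul_ne_zero hα (neg_ne_zero.2 hβ)) (neg_ne_zero.2 ?_)) h013
    exact div_ne_zero (mul_ne_zero hδ hα) hγ
  · intro i
    fin_cases i <;> simp [hα, hβ, hγ, hδ, hε]
  · simp [smul_smul, hα]
  · simp [smul_smul, hβ]
  · have : δ * α / γ ≠ 0 := div_ne_zero (mul_ne_zero hδ hα) hγ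
    change _ = (-(δ * α / γ))⁻¹ • _
    rw [smul_smul, inv_mul_cancel₀ (neg_ne_zero.2 this), one_smul]
  · change _ = (1 : ℂ) • _
    rw [h2]; module
  · change _ = (γ / α) • _
    rw [h4, smul_sub, smul_smul, smul_smul, div_mul_cancel₀ _ hα]
    have : γ / α * -(δ * α / γ) = -δ := by field_simp
    rw [this]; module
  · change _ = (-(ε / β)) • _
    rw [h5, smul_sub, smul_smul, smul_smul]
    have e1 : -(ε / β) * -β = ε := by field_simp
    have e2 : -(ε / β) * -(δ * α / γ) = -ζ := by
      field_simp
      linear_combination hrel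
    rw [e1, e2]; module

/-- The Fano plane is not realizable over `ℂ`. -/
theorem not_fano {a b c w : Fin 3 → ℂ} (habc : tripleProd a b c ≠ 0) (hw : w ≠ 0)
    (h1 : tripleProd a (b - c) w = 0) (h2 : tripleProd b (a - c) w = 0)
    (h3 : tripleProd c (a - b) w = 0) : False := by
  have h := tripleProd_smul a b c w
  have e1 : tripleProd a b w + tripleProd a w c = 0 := by
    rw [← h1]; simp only [tripleProd_expand, Pi.sub_apply]; ring
  have e2 : tripleProd a b w + tripleProd w b c = 0 := by
    rw [← neg_eq_zero, ← h2]; simp only [tripleProd_expand, Pi.sub_apply]; ring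
  have e3 : tripleProd a w c + tripleProd w b c = 0 := by
    rw [← h3]; simp only [tripleProd_expand, Pi.sub_apply]; ring
  -- The coordinates of w in the basis a, b, c have vanishing pairwise sums; dividing by 2 is what
  -- fails in the Fano plane over 𝔽₂.
  have f1 : tripleProd w b c = 0 := by linear_combination (e2 + e3 - e1) / 2
  have f2 : tripleProd a w c = 0 := by linear_combination (e1 + e3 - e2) / 2
  have f3 : tripleProd a b w = 0 := by linear_combination (e1 + e2 - e3) / 2
  rw [f1, f2, f3] at h
  simp only [zero_smul, add_zero] at h
  exact (smul_ne_zero habc hw) h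

/-- A ternary collinearity relation in which every element carries at most three blocks, all blocks
having at most three elements, contains a complete quadrilateral. -/
theorem exists_complete_quadrilateral {ι : Type*} [Fintype ι] [DecidableEq ι] {R : ι → ι → ι → Prop}
    (hs : ∀ i j k, R i j k → R j i k) (hs' : ∀ i j k, R i j k → R i k j)
    (hM : ∀ i j k l, i ≠ j → i ≠ k → i ≠ l → j ≠ k → j ≠ l → k ≠ l → R i j k → ¬ R i j l)
    (hP : ∀ l (Q : Finset ι), l ∉ Q → Q.card = 4 → ∃ a ∈ Q, ∃ b ∈ Q, a ≠ b ∧ R l a b)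
    (hcard : 6 ≤ Fintype.card ι) :
    ∃ x : Fin 6 → ι, Function.Injective x ∧ R (x 0) (x 1) (x 2) ∧ R (x 0) (x 3) (x 4) ∧
      R (x 1) (x 3) (x 5) ∧ R (x 2) (x 4) (x 5) ∧
      ∀ y, (∀ i, y ≠ x i) → R (x 0) (x 5) y ∧ R (x 1) (x 4) y ∧ R (x 2) (x 3) y := by
  have hP4 : ∀ l a b c e, l ≠ a → l ≠ b → l ≠ c → l ≠ e → a ≠ b → a ≠ c → a ≠ e → b ≠ c → b ≠ e →
      c ≠ e → R l a b ∨ R l a c ∨ R l a e ∨ R l b c ∨ R l b e ∨ R l c e := by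
    intro l a b c e h1 h2 h3 h4 h5 h6 h7 h8 h9 h10
    obtain ⟨u, hu, v, hv, huv, h⟩ := hP l {a, b, c, e} (by simp [h1, h2, h3, h4])
      (by simp [h5, h6, h7, h8, h9, h10])
    simp only [Finset.mem_insert, Finset.mem_singleton] at hu hv
    have h' := hs' _ _ _ h
    rcases hu with rfl | rfl | rfl | rfl <;> rcases hv with rfl | rfl | rfl | rfl <;>
      first | exact absurd rfl huv | tauto
  obtain ⟨l⟩ : Nonempty ι := Fintype.card_pos_iff.1 (by omega)
  have pick : ∀ (S : Finset ι) (n : ℕ), S.card + n ≤ Fintype.card ι →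
      ∃ Q : Finset ι, Q.card = n ∧ ∀ q ∈ Q, q ∉ S := by
    intro S n h
    obtain ⟨Q, hQ, hQn⟩ := Finset.exists_subset_card_eq (s := Sᶜ) (n := n)
      (by rw [Finset.card_compl]; omega)
    exact ⟨Q, hQn, fun q hq => Finset.mem_compl.1 (hQ hq)⟩
  obtain ⟨Q, hQ4, hQ⟩ := pick {l} 4 (by simp; omega)
  obtain ⟨a, ha, b, hb, hab, hlab⟩ := hP l Q (fun h => hQ l h (by simp)) hQ4
  have hla : l ≠ a := fun e => hQ a ha (by simp [e])
  have hlb : l ≠ b := fun e => hQ b hb (by simp [e])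
  obtain ⟨Q', hQ3', hQ'⟩ := pick {l, a, b} 3 (by
    have := Finset.card_le_three (a := l) (b := a) (c := b); omega)
  have haQ' : a ∉ Q' := fun h => hQ' a h (by simp)
  -- A second block through l, disjoint from {a, b}: the block of l and a is already full, so a
  -- cannot be one of the two elements supplied by `hP`.
  obtain ⟨c, e, hc, he, hce, hlce⟩ : ∃ c e, c ∈ Q' ∧ e ∈ Q' ∧ c ≠ e ∧ R l c e := by
    obtain ⟨u, hu, v, hv, huv, h⟩ := hP l (insert a Q')
      (by
        rw [Finset.mem_insert, not_or]
        exact ⟨hla, fun h => hQ' l h (by simp)⟩)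
      (by rw [Finset.card_insert_of_notMem haQ', hQ3'])
    have key : ∀ v ∈ Q', ¬ R l a v := by
      intro v hv
      have h3 := hQ' v hv
      simp only [Finset.mem_insert, Finset.mem_singleton, not_or] at h3
      exact hM l a b v hla hlb (Ne.symm h3.1) hab (Ne.symm h3.2.1) (Ne.symm h3.2.2) hlab
    rcases Finset.mem_insert.1 hu with hu' | hu' <;>
      rcases Finset.mem_insert.1 hv with hv' | hv'
    · exact absurd (hu'.trans hv'.symm) huv
    · exact absurd (hu' ▸ h) (key v hv')
    · exact absurd (hs' _ _ _ (hv' ▸ h)) (key u hu')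
    · exact ⟨u, v, hu', hv', huv, h⟩
  have hc' := hQ' c hc
  have he' := hQ' e he
  simp only [Finset.mem_insert, Finset.mem_singleton, not_or, ← ne_eq] at hc' he'
  obtain ⟨hcl, hca, hcb⟩ := hc'
  obtain ⟨hel, hea, heb⟩ := he'
  obtain ⟨F, hF1, hF⟩ := pick {l, a, b, c, e} 1 (by
    have := Finset.card_le_five (a := l) (b := a) (c := b) (d := c) (e := e); omega)
  obtain ⟨f, rfl⟩ := Finset.card_eq_one.1 hF1
  have hf := hF f (by simp)
  simp only [Finset.mem_insert, Finset.mem_singleton, not_or, ← ne_eq] at hf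
  obtain ⟨hfl, hfa, hfb, hfc, hfe⟩ := hf
  have cyc : ∀ i j k, R i j k → R j k i := fun i j k h => hs' _ _ _ (hs _ _ _ h)
  -- Apply `hP` at a to {l, c, e, f}. Every pair other than {c, f} and {e, f} would put a fourth
  -- element on one of the two given blocks.
  have step : ∀ l a b c e f, [l, a, b, c, e, f].Nodup → R l a b → R l c e →
      R a c f ∨ R a e f := by
    intro l a b c e f hnd h1 h2
    simp only [List.nodup_cons, List.mem_cons, List.not_mem_nil, not_or, or_false,
      List.nodup_nil, and_true, not_false_eq_true, ← ne_eq] at hnd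
    obtain ⟨⟨n1, n2, n3, n4, n5⟩, ⟨n6, n7, n8, n9⟩, ⟨n10, n11, n12⟩, ⟨n13, n14⟩, n15⟩ := hnd
    rcases hP4 a l c e f n1.symm n7 n8 n9 n3 n4 n5 n13 n14 n15 with h | h | h | h | h | h
    · exact absurd (hs _ _ _ h) (hM l a b c n1 n2 n3 n6 n7 n10 h1)
    · exact absurd (hs _ _ _ h) (hM l a b e n1 n2 n4 n6 n8 n11 h1)
    · exact absurd (hs _ _ _ h) (hM l a b f n1 n2 n5 n6 n9 n12 h1)
    · exact absurd (cyc _ _ _ h)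
        (hM c e l a n13 n3.symm n7.symm n4.symm n8.symm n1 (cyc _ _ _ h2))
    · exact Or.inl h
    · exact Or.inr h
  -- Two full blocks through p leave room for only one more, so any two remaining elements form a
  -- block with p. This makes a seventh element meet every opposite pair.
  have step' : ∀ p q q' r r' s g, [p, q, q', r, r', s, g].Nodup → R p q q' → R p r r' →
      R p s g := by
    intro p q q' r r' s g hnd h1 h2
    simp only [List.nodup_cons, List.mem_cons, List.not_mem_nil, not_or, or_false,
      List.nodup_nil, and_true, not_false_eq_true, ← ne_eq] at hnd
    obtain ⟨⟨n1, n2, n3, n4, n5, n6⟩, ⟨n7, n8, n9, n10, n11⟩, ⟨n12, n13, n14, n15⟩,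
      ⟨n16, n17, n18⟩, ⟨n19, n20⟩, n21⟩ := hnd
    rcases hP4 p q r s g n1 n3 n5 n6 n8 n10 n11 n17 n18 n21 with h | h | h | h | h | h
    · exact absurd h (hM p q q' r n1 n2 n3 n7 n8 n12 h1)
    · exact absurd h (hM p q q' s n1 n2 n5 n7 n10 n14 h1)
    · exact absurd h (hM p q q' g n1 n2 n6 n7 n11 n15 h1)
    · exact absurd h (hM p r r' s n3 n4 n5 n16 n17 n19 h2)
    · exact absurd h (hM p r r' g n3 n4 n6 n16 n18 n20 h2)
    · exact h
  have fin : ∀ c e, [l, a, b, c, e, f].Nodup → R l c e → R a c f → R b e f →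
      ∃ x : Fin 6 → ι, Function.Injective x ∧ R (x 0) (x 1) (x 2) ∧ R (x 0) (x 3) (x 4) ∧
      R (x 1) (x 3) (x 5) ∧ R (x 2) (x 4) (x 5) ∧
      ∀ y, (∀ i, y ≠ x i) → R (x 0) (x 5) y ∧ R (x 1) (x 4) y ∧ R (x 2) (x 3) y := by
    intro c e hnd h1 h2 h3
    refine ⟨![l, a, b, c, e, f], ?_, hlab, h1, h2, h3, fun y hy => ?_⟩
    · have h : (![l, a, b, c, e, f] : Fin 6 → ι) = [l, a, b, c, e, f].get := by
        ext i; fin_cases i <;> rfl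
      rw [h]
      exact List.nodup_iff_injective_get.1 hnd
    · have y0 : y ≠ l := hy 0
      have y1 : y ≠ a := hy 1
      have y2 : y ≠ b := hy 2
      have y3 : y ≠ c := hy 3
      have y4 : y ≠ e := hy 4
      have y5 : y ≠ f := hy 5
      simp only [List.nodup_cons, List.mem_cons, List.not_mem_nil, not_or, or_false,
        List.nodup_nil, and_true, not_false_eq_true, ← ne_eq] at hnd
      obtain ⟨⟨n1, n2, n3, n4, n5⟩, ⟨n6, n7, n8, n9⟩, ⟨n10, n11, n12⟩, ⟨n13, n14⟩, n15⟩ := hnd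
      refine ⟨step' l a b c e f y ?_ hlab h1, step' a l b c f e y ?_ (hs _ _ _ hlab) h2,
        step' b l a e f c y ?_ (hs _ _ _ (hs' _ _ _ hlab)) h3⟩ <;>
        clear hs hs' hM hP hP4 step step' cyc <;> grind
  have hnd : [l, a, b, c, e, f].Nodup := by
    simp [hla, hlb, hab, hcl.symm, hca.symm, hcb.symm, hel.symm, hea.symm, heb.symm, hce,
      hfl.symm, hfa.symm, hfb.symm, hfc.symm, hfe.symm]
  have hnd' : [l, a, b, e, c, f].Nodup := by
    simp [hla, hlb, hab, hcl.symm, hca.symm, hcb.symm, hel.symm, hea.symm, heb.symm, hce.symm,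
      hfl.symm, hfa.symm, hfb.symm, hfc.symm, hfe.symm]
  have hndb : [l, b, a, c, e, f].Nodup := by
    simp [hla, hlb, hab.symm, hcl.symm, hca.symm, hcb.symm, hel.symm, hea.symm, heb.symm, hce,
      hfl.symm, hfa.symm, hfb.symm, hfc.symm, hfe.symm]
  have excl : ∀ c, c ≠ a → c ≠ b → f ≠ c → R a c f → ¬ R b c f := fun c h1 h2 h3 h4 h5 =>
    hM c f a b h3.symm h1 h2 hfa hfb hab (cyc _ _ _ h4) (cyc _ _ _ h5)
  rcases step l a b c e f hnd hlab hlce with h1 | h1 <;>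
    rcases step l b a c e f hndb (hs' _ _ _ hlab) hlce with h2 | h2
  · exact absurd h2 (excl c hca hcb hfc h1)
  · exact fin c e hnd hlce h1 h2
  · exact fin e c hnd' (hs' _ _ _ hlce) h1 h2
  · exact absurd h2 (excl e hea heb hfe h1)

/-! ### Logarithmic fields of degree at most two force a large pencil or six special lines -/

namespace LineArrangement

variable {d : ℕ} {A : LineArrangement d}

variable (A) in
/-- The lines with numbers `i, j, k` pass through a common point. -/
def Concurrent (i j k : Fin d) : Prop :=
  tripleProd (A.coeff i) (A.coeff j) (A.coeff k) = 0

theorem concurrent_iff {i j k : Fin d} :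
    A.Concurrent i j k ↔ k ∈ A.pencil (A.coeff i ⨯₃ A.coeff j) := by
  rw [Concurrent, mem_pencil, tripleProd_rotate]

theorem Concurrent.swap {i j k : Fin d} (h : A.Concurrent i j k) : A.Concurrent j i k := by
  unfold Concurrent at h ⊢
  rw [← neg_eq_zero, ← h]; simp only [tripleProd_expand]; ring

theorem Concurrent.swap' {i j k : Fin d} (h : A.Concurrent i j k) : A.Concurrent i k j := by
  unfold Concurrent at h ⊢
  rw [← neg_eq_zero, ← h]; simp only [tripleProd_expand]; ring

theorem concurrent_left (i j : Fin d) : A.Concurrent i j i := by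
  unfold Concurrent; simp only [tripleProd_expand]; ring

theorem concurrent_right (i j : Fin d) : A.Concurrent i j j := by
  unfold Concurrent; simp only [tripleProd_expand]; ring

variable (A) in
/-- The arrangement consists of the six lines of a complete quadrilateral. -/
def IsBraid : Prop :=
  ∃ x : Fin 6 → Fin d, Function.Bijective x ∧ A.Concurrent (x 0) (x 1) (x 2) ∧
    A.Concurrent (x 0) (x 3) (x 4) ∧ A.Concurrent (x 1) (x 3) (x 5) ∧
    A.Concurrent (x 2) (x 4) (x 5) ∧
    ∀ i j k l, i ≠ j → i ≠ k → i ≠ l → j ≠ k → j ≠ l → k ≠ l →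
      A.Concurrent i j k → ¬ A.Concurrent i j l

/-- Fields of degree `r` cannot be tangent to a pencil of more than `r + 1` lines and to more than
`r` other lines. -/
theorem card_sdiff_pencil_le {s : Finset (Fin d)} {i j : Fin d} (hij : i ≠ j)
    {θ : Fin 3 → PolyXYZ} {r : ℕ} (hθ : IsHomogeneousTriple θ r)
    (hlog : ∀ k ∈ s, IsTangent (A.coeff k) θ) (hne : ∀ g : PolyXYZ, θ ≠ g • eulerTriple)
    (hcard : r + 1 < (s ∩ A.pencil (A.coeff i ⨯₃ A.coeff j)).card) :
    (s \ A.pencil (A.coeff i ⨯₃ A.coeff j)).card ≤ r := by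
  have hind := A.coeff_distinct i j hij
  set p := A.coeff i ⨯₃ A.coeff j with hp
  have hX : ∀ i, (eulerTriple i).IsHomogeneous 1 := fun i => isHomogeneous_X _ _
  have hC : ∀ i, (constTriple p i).IsHomogeneous 0 := fun i => isHomogeneous_C _ _
  have hG : (tripleProd θ eulerTriple (constTriple p)).IsHomogeneous (r + 1) := by
    have h : ∀ a b c e f, (θ a * (eulerTriple b * constTriple p c -
        eulerTriple e * constTriple p f)).IsHomogeneous (r + 1) := fun a b c e f =>
      (hθ a).mul (((hX b).mul (hC c)).sub ((hX e).mul (hC f)))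
    rw [tripleProd_expand]
    exact ((h _ _ _ _ _).add (h _ _ _ _ _)).add (h _ _ _ _ _)
  have hG0 : tripleProd θ eulerTriple (constTriple p) = 0 := by
    by_contra h0
    have := card_le_of_prod_linForm_dvd (s ∩ A.pencil p) A.coeff (fun i _ => A.coeff_ne_zero i)
      hG h0 (prod_linForm_dvd _ A.coeff (fun i _ => A.coeff_ne_zero i)
        (fun i _ j _ => A.coeff_distinct i j) _ fun i hi =>
        dvd_tripleProd (A.coeff_ne_zero i) (hlog i (Finset.mem_inter.1 hi).1) (isTangent_euler _)
          (isTangent_constTriple (mem_pencil.1 (Finset.mem_inter.1 hi).2)))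
    omega
  obtain ⟨a, b, hab, hb⟩ := exists_eq_smul_euler_add_of_tripleProd hind hG0
  have hb0 : b ≠ 0 := by
    rintro rfl
    exact hne a (by simpa using hab)
  refine card_le_of_prod_linForm_dvd _ A.coeff (fun i _ => A.coeff_ne_zero i) (hb r hθ) hb0
    (prod_linForm_dvd _ A.coeff (fun i _ => A.coeff_ne_zero i)
        (fun i _ j _ => A.coeff_distinct i j) _ fun k hk => ?_)
  obtain ⟨hk, hkp⟩ := Finset.mem_sdiff.1 hk
  have := hlog k hk
  unfold IsTangent at this
  rw [hab, dotProduct_add, dotProduct_smul, dotProduct_smul, ← hp, constTriple_dot] at this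
  have h2 := (dvd_add_right (Dvd.intro_left a rfl)).1 this
  rw [mem_pencil] at hkp
  exact ((isUnit_iff_ne_zero.2 hkp).map C).dvd_mul_right.1 h2

/-- Division of a field by the equation of a line with many multiple points. -/
theorem exists_tangent_erase {s : Finset (Fin d)} {l : Fin d} (hl : l ∈ s) {Q : Finset (Fin d)}
    (hQ : Q ⊆ s) (hlQ : l ∉ Q)
    (hnc : ∀ a ∈ Q, ∀ b ∈ Q, a ≠ b → ¬ A.Concurrent l a b) {θ : Fin 3 → PolyXYZ} {r : ℕ}
    (hθ : IsHomogeneousTriple θ (r + 1)) (hr : r + 2 < Q.card)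
    (hlog : ∀ k ∈ s, IsTangent (A.coeff k) θ) (hne : ∀ g : PolyXYZ, θ ≠ g • eulerTriple) :
    ∃ ω : Fin 3 → PolyXYZ, IsHomogeneousTriple ω r ∧
      (∀ k ∈ s.erase l, IsTangent (A.coeff k) ω) ∧ ∀ g : PolyXYZ, ω ≠ g • eulerTriple := by
  obtain ⟨ω, g, hω, hg⟩ := exists_eq_smul_add_smul_euler (A.coeff_ne_zero l) (m := A.coeff) Q
    (fun a ha => A.coeff_distinct l a fun e => hlQ (e ▸ ha))
    (fun a ha b hb hab h => hnc b hb a ha hab.symm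
      (concurrent_iff.2 (mem_pencil.2 h)))
    hθ hr (hlog l hl) fun a ha => hlog a (hQ ha)
  refine ⟨ω, hω, fun k hk => ?_, fun g' hg' => ?_⟩
  · obtain ⟨hkl, hks⟩ := Finset.mem_erase.1 hk
    have := hlog k hks
    unfold IsTangent at this
    rw [hg, dotProduct_add, dotProduct_smul, dotProduct_smul] at this
    have h2 := (dvd_add_left (Dvd.intro_left g rfl)).1 this
    exact ((linForm_prime (A.coeff_ne_zero k)).dvd_or_dvd h2).resolve_left
      (not_linForm_dvd (A.coeff_distinct k l hkl))
  · refine hne (linForm (A.coeff l) * g' + g) ?_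
    rw [hg, hg', smul_smul, add_smul]

theorem exists_concurrent_of_degree_zero {s : Finset (Fin d)} {θ : Fin 3 → PolyXYZ}
    (hθ : IsHomogeneousTriple θ 0) (hlog : ∀ k ∈ s, IsTangent (A.coeff k) θ)
    (hne : ∀ g : PolyXYZ, θ ≠ g • eulerTriple) : ∃ u : Fin 3 → ℂ, u ≠ 0 ∧ s ⊆ A.pencil u := by
  have h : ∀ j, ∃ c, θ j = C c := fun j => by
    have := hθ j
    rw [← totalDegree_zero_iff_isHomogeneous, totalDegree_eq_zero_iff_eq_C] at this
    exact ⟨_, this⟩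
  choose u hu using h
  have hθu : θ = constTriple u := funext hu
  refine ⟨u, ?_, fun k hk => ?_⟩
  · rintro rfl
    exact hne 0 (by rw [hθu]; ext1 j; simp [constTriple])
  · have h1 := hlog k hk
    unfold IsTangent at h1
    rw [hθu, constTriple_dot] at h1
    rw [mem_pencil]
    by_contra h0
    exact (linForm_prime (A.coeff_ne_zero k)).not_isUnit
      (isUnit_of_dvd_unit h1 ((isUnit_iff_ne_zero.2 h0).map C))

/-- With three concurrent lines `card_sdiff_pencil_le` applies. Otherwise any line meets the at
least three others in distinct points, and dividing by it leaves a constant field, so those others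
are concurrent. -/
theorem exists_card_sdiff_pencil_le_one {s : Finset (Fin d)} (hs : 4 ≤ s.card)
    {θ : Fin 3 → PolyXYZ}
    (hθ : IsHomogeneousTriple θ 1) (hlog : ∀ k ∈ s, IsTangent (A.coeff k) θ)
    (hne : ∀ g : PolyXYZ, θ ≠ g • eulerTriple) :
    ∃ u : Fin 3 → ℂ, u ≠ 0 ∧ (s \ A.pencil u).card ≤ 1 := by
  classical
  by_cases hM : ∃ i ∈ s, ∃ j ∈ s, i ≠ j ∧ 2 < (s ∩ A.pencil (A.coeff i ⨯₃ A.coeff j)).card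
  · obtain ⟨i, hi, j, hj, hij, h⟩ := hM
    exact ⟨_, cross_ne_zero (A.coeff_distinct i j hij),
      card_sdiff_pencil_le hij hθ hlog hne h⟩
  · push Not at hM
    obtain ⟨l, hl⟩ : s.Nonempty := Finset.card_pos.1 (by omega)
    have hcard := Finset.card_erase_of_mem hl
    obtain ⟨ω, hω, hωlog, hωne⟩ := exists_tangent_erase (r := 0) hl (Finset.erase_subset l s)
      (Finset.notMem_erase l s) (fun a ha b hb hab hc => by
        obtain ⟨hal, has⟩ := Finset.mem_erase.1 ha
        obtain ⟨hbl, hbs⟩ := Finset.mem_erase.1 hb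
        have h1 := hM l hl a has hal.symm
        have h2 : ({l, a, b} : Finset (Fin d)) ⊆ s ∩ A.pencil (A.coeff l ⨯₃ A.coeff a) := by
          intro x hx
          simp only [Finset.mem_insert, Finset.mem_singleton] at hx
          rcases hx with rfl | rfl | rfl
          · exact Finset.mem_inter.2 ⟨hl, concurrent_iff.1 (concurrent_left _ _)⟩
          · exact Finset.mem_inter.2 ⟨has, concurrent_iff.1 (concurrent_right _ _)⟩
          · exact Finset.mem_inter.2 ⟨hbs, concurrent_iff.1 hc⟩
        have h3 := Finset.card_le_card h2
        rw [Finset.card_eq_three.2 ⟨l, a, b, hal.symm, hbl.symm, hab, rfl⟩] at h3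
        omega) hθ (by omega) hlog hne
    obtain ⟨u, hu, hsu⟩ := exists_concurrent_of_degree_zero hω hωlog hωne
    refine ⟨u, hu, ?_⟩
    have : s \ A.pencil u ⊆ {l} := by
      intro x hx
      obtain ⟨hxs, hxu⟩ := Finset.mem_sdiff.1 hx
      by_contra hxl
      exact hxu (hsu (Finset.mem_erase.2 ⟨by simpa using hxl, hxs⟩))
    simpa using Finset.card_le_card this

theorem exists_pencil_or_isBraid (hd : 4 ≤ d) {θ : Fin 3 → PolyXYZ}
    (hθ : IsHomogeneousTriple θ 2) (hlog : A.IsLogarithmic θ)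
    (hne : ∀ g : PolyXYZ, θ ≠ g • eulerTriple) :
    (∃ u : Fin 3 → ℂ, u ≠ 0 ∧ d ≤ (A.pencil u).card + 2) ∨ A.IsBraid := by
  classical
  have hun : (Finset.univ : Finset (Fin d)).card = d := by simp
  have hsd : ∀ u, (Finset.univ \ A.pencil u).card = d - (A.pencil u).card := fun u => by
    rw [Finset.card_sdiff_of_subset (Finset.subset_univ _), hun]
  by_cases hM : ∃ i j, i ≠ j ∧ 3 < (Finset.univ ∩ A.pencil (A.coeff i ⨯₃ A.coeff j)).card
  · obtain ⟨i, j, hij, h⟩ := hM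
    left
    refine ⟨_, cross_ne_zero (A.coeff_distinct i j hij), ?_⟩
    have := card_sdiff_pencil_le hij hθ
      (fun k _ => hlog k) hne h
    rw [hsd] at this
    omega
  push Not at hM
  simp only [Finset.univ_inter] at hM
  have hthree : ∀ i j k, i ≠ j → i ≠ k → j ≠ k → A.Concurrent i j k →
      ({i, j, k} : Finset (Fin d)) ⊆ A.pencil (A.coeff i ⨯₃ A.coeff j) := by
    intro i j k hij hik hjk h x hx
    simp only [Finset.mem_insert, Finset.mem_singleton] at hx
    rcases hx with rfl | rfl | rfl
    exacts [concurrent_iff.1 (concurrent_left _ _), concurrent_iff.1 (concurrent_right _ _),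
      concurrent_iff.1 h]
  have hM' : ∀ i j k l, i ≠ j → i ≠ k → i ≠ l → j ≠ k → j ≠ l → k ≠ l →
      A.Concurrent i j k → ¬ A.Concurrent i j l := by
    intro i j k l hij hik hil hjk hjl hkl h1 h2
    have h3 : ({i, j, k, l} : Finset (Fin d)) ⊆ A.pencil (A.coeff i ⨯₃ A.coeff j) := by
      intro x hx
      simp only [Finset.mem_insert, Finset.mem_singleton] at hx
      rcases hx with rfl | rfl | rfl | rfl
      exacts [concurrent_iff.1 (concurrent_left _ _), concurrent_iff.1 (concurrent_right _ _),
        concurrent_iff.1 h1, concurrent_iff.1 h2]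
    have h4 := Finset.card_le_card h3
    have h5 : ({i, j, k, l} : Finset (Fin d)).card = 4 := by
      simp [hij, hik, hil, hjk, hjl, hkl]
    have := hM i j hij
    omega
  -- Four lines meeting `l` in distinct points allow division by `l`. The quotient has degree 1, so
  -- at most one of the remaining lines misses a common point, and `l` is the possible second
  -- exception.
  by_cases hP : ∃ (l : Fin d) (Q : Finset (Fin d)), l ∉ Q ∧ Q.card = 4 ∧
      ∀ a ∈ Q, ∀ b ∈ Q, a ≠ b → ¬ A.Concurrent l a b
  · obtain ⟨l, Q, hlQ, hQ, hnc⟩ := hP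
    obtain ⟨ω, hω, hωlog, hωne⟩ := exists_tangent_erase (r := 1) (Finset.mem_univ l)
      (Finset.subset_univ Q) hlQ hnc hθ (by omega) (fun k _ => hlog k) hne
    have hc := Finset.card_le_card
      (show Q ⊆ Finset.univ.erase l from fun x hx => Finset.mem_erase.2
        ⟨fun e => hlQ (e ▸ hx), Finset.mem_univ x⟩)
    obtain ⟨u, hu, hsu⟩ := exists_card_sdiff_pencil_le_one (by omega) hω hωlog hωne
    left
    refine ⟨u, hu, ?_⟩
    have h1 : Finset.univ \ A.pencil u ⊆ insert l (Finset.univ.erase l \ A.pencil u) := by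
      intro x hx
      by_cases hxl : x = l
      · simp [hxl]
      · simp only [Finset.mem_sdiff, Finset.mem_univ, true_and] at hx
        simp [hxl, hx]
    have h2 := (Finset.card_le_card h1).trans (Finset.card_insert_le _ _)
    rw [hsd] at h2
    omega
  push Not at hP
  rcases Nat.lt_or_ge d 6 with hd6 | hd6
  · left
    rcases Nat.lt_or_ge d 5 with hd5 | hd5
    · have hij : (⟨0, by omega⟩ : Fin d) ≠ ⟨1, by omega⟩ := by simp
      refine ⟨_, cross_ne_zero (A.coeff_distinct _ _ hij), ?_⟩
      have := Finset.card_le_card (show ({⟨0, by omega⟩, ⟨1, by omega⟩} : Finset (Fin d)) ⊆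
        A.pencil (A.coeff ⟨0, by omega⟩ ⨯₃ A.coeff ⟨1, by omega⟩) by
          intro x hx
          simp only [Finset.mem_insert, Finset.mem_singleton] at hx
          rcases hx with rfl | rfl
          exacts [concurrent_iff.1 (concurrent_left _ _),
            concurrent_iff.1 (concurrent_right _ _)])
      rw [Finset.card_pair hij] at this
      omega
    · obtain ⟨a, ha, b, hb, hab, h⟩ := hP ⟨0, by omega⟩ (Finset.univ.erase ⟨0, by omega⟩)
        (Finset.notMem_erase _ _) (by rw [Finset.card_erase_of_mem (Finset.mem_univ _)]; omega)
      have ha0 := (Finset.ne_of_mem_erase ha).symm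
      have hb0 := (Finset.ne_of_mem_erase hb).symm
      refine ⟨_, cross_ne_zero (A.coeff_distinct _ _ ha0), ?_⟩
      have := Finset.card_le_card (hthree _ _ _ ha0 hb0 hab h)
      rw [Finset.card_eq_three.2 ⟨_, a, b, ha0, hb0, hab, rfl⟩] at this
      omega
  · right
    obtain ⟨x, hx, h012, h034, h135, h245, hy⟩ := exists_complete_quadrilateral
      (R := A.Concurrent) (fun _ _ _ h => h.swap) (fun _ _ _ h => h.swap') hM' hP (by simpa)
    refine ⟨x, ⟨hx, fun y => ?_⟩, h012, h034, h135, h245, hM'⟩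
    by_contra hxy
    push Not at hxy
    obtain ⟨k1, k2, k3⟩ := hy y fun i => (hxy i).symm
    have hxne : ∀ i j, i ≠ j → x i ≠ x j := fun i j h => hx.ne h
    -- A seventh line `y` passes through the meeting points of the opposite pairs {0,5}, {1,4},
    -- {2,3}, which produces a Fano configuration.
    obtain ⟨a, b, c, habc, s, hs, e0, e1, e3, e2, e4, e5⟩ := exists_braid_normal_form
      (x := fun i => A.coeff (x i)) (fun i j hij => A.coeff_distinct _ _ (hxne i j hij))
      h012 h034 h135 h245 (hM' _ _ _ _ (hxne _ _ (by decide)) (hxne _ _ (by decide))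
        (hxne _ _ (by decide)) (hxne _ _ (by decide)) (hxne _ _ (by decide))
        (hxne _ _ (by decide)) h012)
    have hsc : ∀ (s t : ℂ) (u v w : Fin 3 → ℂ), s ≠ 0 → t ≠ 0 →
        tripleProd (s • u) (t • v) w = 0 → tripleProd u v w = 0 := by
      intro s t u v w hs ht h
      have : tripleProd (s • u) (t • v) w = s * t * tripleProd u v w := by
        simp only [tripleProd_expand, Pi.smul_apply, smul_eq_mul]; ring
      rw [this] at h
      exact (mul_eq_zero.1 h).resolve_left (mul_ne_zero hs ht)
    unfold Concurrent at k1 k2 k3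
    rw [e0, e5] at k1
    rw [e1, e4] at k2
    rw [e2, e3] at k3
    have k3' := hsc _ _ _ _ _ (hs _) (hs _) k3
    refine not_fano habc (A.coeff_ne_zero y) (hsc _ _ _ _ _ (hs _) (hs _) k1)
      (hsc _ _ _ _ _ (hs _) (hs _) k2) ?_
    rw [← neg_eq_zero, ← k3']; simp only [tripleProd_expand, Pi.sub_apply]; ring

/-- Arrangements with a field of degree at most two. -/
theorem exists_pencil_or_isBraid_of_mdr_le (hd : 4 ≤ d) (h : mdr A.definingPoly ≤ 2) :
    (∃ u : Fin 3 → ℂ, u ≠ 0 ∧ d ≤ (A.pencil u).card + mdr A.definingPoly) ∨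
      (mdr A.definingPoly = 2 ∧ A.IsBraid) := by
  classical
  obtain ⟨θ, hlog, hθ, hne⟩ := A.exists_isLogarithmic_mdr (by omega)
  have hun : (Finset.univ : Finset (Fin d)).card = d := by simp
  generalize mdr A.definingPoly = r at h hθ
  interval_cases r
  · obtain ⟨u, hu, hs⟩ := exists_concurrent_of_degree_zero (s := Finset.univ) hθ
      (fun k _ => hlog k) hne
    have := Finset.card_le_card hs
    exact Or.inl ⟨u, hu, by omega⟩
  · obtain ⟨u, hu, hs⟩ := exists_card_sdiff_pencil_le_one (s := Finset.univ) (by omega) hθ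
      (fun k _ => hlog k) hne
    rw [Finset.card_sdiff_of_subset (Finset.subset_univ _), hun] at hs
    exact Or.inl ⟨u, hu, by omega⟩
  · rcases exists_pencil_or_isBraid hd hθ hlog hne with h | h
    · exact Or.inl h
    · exact Or.inr ⟨rfl, h⟩

theorem IsBraid.isFreeCurve_and_mdr_le (h : A.IsBraid) :
    IsFreeCurve A.definingPoly ∧ mdr A.definingPoly ≤ 2 := by
  obtain ⟨x, hx, h012, h034, h135, h245, hM⟩ := h
  have hd : d ≠ 0 := by rintro rfl; exact (x 0).elim0
  have hxne : ∀ i j, i ≠ j → x i ≠ x j := fun i j h => hx.1.ne h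
  obtain ⟨a, b, c, habc, s, hs, e0, e1, e3, e2, e4, e5⟩ := exists_braid_normal_form
    (x := fun i => A.coeff (x i)) (fun i j hij => A.coeff_distinct _ _ (hxne i j hij))
    h012 h034 h135 h245 (hM _ _ _ _ (hxne _ _ (by decide)) (hxne _ _ (by decide))
      (hxne _ _ (by decide)) (hxne _ _ (by decide)) (hxne _ _ (by decide))
      (hxne _ _ (by decide)) h012)
  have hs0 : s 0 * s 1 * s 2 * s 3 * s 4 * s 5 ≠ 0 := by simp [hs]
  refine isFreeCurve_and_mdr_le_of_braid hd habc (fun i => ?_) (inv_ne_zero hs0) ?_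
  · obtain ⟨j, rfl⟩ := hx.2 i
    refine ⟨s j, ?_⟩
    fin_cases j
    exacts [Or.inl e0, Or.inr (Or.inl e1), Or.inr (Or.inr (Or.inr (Or.inl e2))),
      Or.inr (Or.inr (Or.inl e3)), Or.inr (Or.inr (Or.inr (Or.inr (Or.inl e4)))),
      Or.inr (Or.inr (Or.inr (Or.inr (Or.inr e5))))]
  · have hC : (C (s 0 * s 1 * s 2 * s 3 * s 4 * s 5)⁻¹ : PolyXYZ) *
        C (s 0 * s 1 * s 2 * s 3 * s 4 * s 5) = 1 := by
      rw [← C_mul, inv_mul_cancel₀ hs0, C_1]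
    have hprod : A.definingPoly = ∏ j : Fin 6, linForm (A.coeff (x j)) := by
      rw [definingPoly_eq]
      exact (Fintype.prod_bijective x hx _ _ fun _ => rfl).symm
    rw [hprod, Fin.prod_univ_six, e0, e1, e2, e3, e4, e5]
    simp only [linForm_smul]
    simp only [C_mul] at hC
    linear_combination (linForm a * linForm b * linForm c *
        linForm (a - b) * linForm (a - c) * linForm (b - c)) * hC

end LineArrangement

end

/-! ### The intersection lattice is equivalent to the concurrency relation on lines -/

section

open scoped Matrix

/-- A symmetric ternary relation depends only on the underlying set of a triple of distinct
elements. -/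
theorem symm_relation_of_set_eq {ι : Type*} [DecidableEq ι] {R : ι → ι → ι → Prop}
    (hs : ∀ i j k, R i j k → R j i k) (hs' : ∀ i j k, R i j k → R i k j) {a b c i j k : ι}
    (hij : i ≠ j) (hik : i ≠ k) (hjk : j ≠ k) (h : ({i, j, k} : Finset ι) = {a, b, c})
    (habc : R a b c) : R i j k := by
  have hi : i ∈ ({a, b, c} : Finset ι) := by rw [← h]; simp
  have hj : j ∈ ({a, b, c} : Finset ι) := by rw [← h]; simp
  have hk : k ∈ ({a, b, c} : Finset ι) := by rw [← h]; simp
  simp only [Finset.mem_insert, Finset.mem_singleton] at hi hj hk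
  have h1 := hs _ _ _ habc
  have h2 := hs' _ _ _ habc
  have h3 := hs' _ _ _ h1
  have h4 := hs _ _ _ h2
  have h5 := hs _ _ _ h3
  rcases hi with rfl | rfl | rfl <;> rcases hj with rfl | rfl | rfl <;>
    rcases hk with rfl | rfl | rfl <;> first | exact absurd rfl ‹_› | assumption

namespace LineArrangement

variable {d d' d'' : ℕ} {A : LineArrangement d} {B : LineArrangement d'}

theorem mem_line_iff_mem_pencil {i : Fin d} {v : Fin 3 → ℂ} :
    v ∈ A.line i ↔ i ∈ A.pencil v := by
  rw [mem_pencil, mem_line, ← eval_linForm]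
  rfl

/-- Two distinct lines through a point determine the other lines through it. -/
theorem mem_pencil_iff_concurrent {u : Fin 3 → ℂ} (hu : u ≠ 0) {i j : Fin d} (hij : i ≠ j)
    (hi : i ∈ A.pencil u) (hj : j ∈ A.pencil u) {k : Fin d} :
    k ∈ A.pencil u ↔ A.Concurrent i j k := by
  obtain ⟨c, rfl⟩ := eq_smul_cross (A.coeff_distinct i j hij) (mem_pencil.1 hi) (mem_pencil.1 hj)
  have hc : c ≠ 0 := by rintro rfl; simp at hu
  rw [concurrent_iff, mem_pencil, mem_pencil, dotProduct_smul, smul_eq_mul, mul_eq_zero,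
    or_iff_right hc]

theorem mem_pencil_cross_left (i j : Fin d) : i ∈ A.pencil (A.coeff i ⨯₃ A.coeff j) :=
  concurrent_iff.1 (concurrent_left i j)

theorem mem_pencil_cross_right (i j : Fin d) : j ∈ A.pencil (A.coeff i ⨯₃ A.coeff j) :=
  concurrent_iff.1 (concurrent_right i j)

theorem line_inf_line_le {i j k : Fin d} (hij : i ≠ j) :
    A.line i ⊓ A.line j ≤ A.line k ↔ A.Concurrent i j k := by
  constructor
  · intro h
    have := h (x := A.coeff i ⨯₃ A.coeff j) ⟨mem_line_iff_mem_pencil.2 (mem_pencil_cross_left i j),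
      mem_line_iff_mem_pencil.2 (mem_pencil_cross_right i j)⟩
    exact concurrent_iff.2 (mem_line_iff_mem_pencil.1 this)
  · rintro h v ⟨hi, hj⟩
    by_cases hv : v = 0
    · rw [hv]; exact zero_mem _
    · exact mem_line_iff_mem_pencil.2 ((mem_pencil_iff_concurrent hv hij
        (mem_line_iff_mem_pencil.1 hi) (mem_line_iff_mem_pencil.1 hj)).2 h)

theorem eq_of_line_le {i j : Fin d} (h : A.line i ≤ A.line j) : i = j := by
  by_contra hij
  obtain ⟨m, hm⟩ := exists_dot_eq_one (cross_ne_zero (A.coeff_distinct i j hij))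
  have h1 := h (x := m ⨯₃ A.coeff i) (mem_line_iff_mem_pencil.2 (mem_pencil.2
    (dot_cross_self _ _)))
  rw [mem_line_iff_mem_pencil, mem_pencil, triple_product_permutation, hm] at h1
  exact one_ne_zero h1

theorem line_ne_top (i : Fin d) : A.line i ≠ ⊤ := by
  intro h
  obtain ⟨j, hj⟩ := Function.ne_iff.1 (A.coeff_ne_zero i)
  have : Pi.single j 1 ∈ A.line i := by rw [h]; trivial
  rw [mem_line_iff_mem_pencil, mem_pencil] at this
  exact hj (by simpa using this)

variable (A) in
/-- The intersection of a set of lines. -/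
noncomputable def flat (s : Finset (Fin d)) : Submodule ℂ (Fin 3 → ℂ) := ⨅ i ∈ s, A.line i

theorem flat_mem (s : Finset (Fin d)) : A.flat s ∈ A.intersections := ⟨s, rfl⟩

theorem line_mem (i : Fin d) : A.line i ∈ A.intersections := ⟨{i}, by simp⟩

theorem flat_le_line {s : Finset (Fin d)} {i : Fin d} (hi : i ∈ s) : A.flat s ≤ A.line i :=
  iInf₂_le i hi

theorem mem_flat {s : Finset (Fin d)} {v : Fin 3 → ℂ} : v ∈ A.flat s ↔ s ⊆ A.pencil v := by
  simp only [flat, Submodule.mem_iInf, mem_line_iff_mem_pencil]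
  rfl

/-- An intersection of at least two distinct lines is either their common point or, if three of them
are not concurrent, the zero subspace, which lies in every line. So inclusions of flats are
expressed by concurrency alone. -/
theorem flat_le_line_iff {s : Finset (Fin d)} {j : Fin d} :
    A.flat s ≤ A.line j ↔ j ∈ s ∨ ∃ a ∈ s, ∃ b ∈ s, a ≠ b ∧
      (A.Concurrent a b j ∨ ∃ c ∈ s, ¬ A.Concurrent a b c) := by
  constructor
  · intro h
    by_contra hn
    push Not at hn
    obtain ⟨hj, hn⟩ := hn
    by_cases hab : ∃ a ∈ s, ∃ b ∈ s, a ≠ b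
    · obtain ⟨a, ha, b, hb, hab⟩ := hab
      obtain ⟨h1, h2⟩ := hn a ha b hb hab
      have h3 : A.coeff a ⨯₃ A.coeff b ∈ A.flat s :=
        mem_flat.2 fun c hc => concurrent_iff.1 (h2 c hc)
      exact h1 (concurrent_iff.2 (mem_line_iff_mem_pencil.1 (h h3)))
    · push Not at hab
      rcases s.eq_empty_or_nonempty with rfl | ⟨a, ha⟩
      · exact line_ne_top j (top_le_iff.1 (by simpa [flat] using h))
      · obtain rfl : s = {a} := Finset.eq_singleton_iff_unique_mem.2
          ⟨ha, fun b hb => hab b hb a ha⟩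
        have : A.flat {a} = A.line a := by simp [flat]
        rw [this] at h
        exact hj (by rw [eq_of_line_le h]; simp)
  · rintro (h | ⟨a, ha, b, hb, hab, h | ⟨c, hc, h⟩⟩)
    · exact flat_le_line h
    · exact (le_inf (flat_le_line ha) (flat_le_line hb)).trans ((line_inf_line_le hab).2 h)
    · intro v hv
      have hs := mem_flat.1 hv
      by_cases hv0 : v = 0
      · rw [hv0]; exact zero_mem _
      · exact absurd ((mem_pencil_iff_concurrent hv0 hab (hs ha) (hs hb)).1 (hs hc)) h

theorem sameLattice_of_concurrent (σ : Fin d ≃ Fin d')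
    (hσ : ∀ i j k, A.Concurrent i j k ↔ B.Concurrent (σ i) (σ j) (σ k)) : A.SameLattice B := by
  have h1 : ∀ s j, A.flat s ≤ A.line j ↔ B.flat (s.map σ.toEmbedding) ≤ B.line (σ j) := by
    intro s j
    have hex : ∀ P : Fin d' → Prop, (∃ a ∈ s.map σ.toEmbedding, P a) ↔ ∃ a ∈ s, P (σ a) :=
      fun P => by simp only [Finset.mem_map, exists_exists_and_eq_and]; rfl
    rw [flat_le_line_iff, flat_le_line_iff]
    simp only [hex, ← hσ, σ.injective.ne_iff]
    simp
  have hle : ∀ s t, A.flat s ≤ A.flat t ↔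
      B.flat (s.map σ.toEmbedding) ≤ B.flat (t.map σ.toEmbedding) := by
    intro s t
    have : ∀ {n : ℕ} (C : LineArrangement n) (x : Submodule ℂ (Fin 3 → ℂ)) (t : Finset (Fin n)),
        x ≤ C.flat t ↔ ∀ j ∈ t, x ≤ C.line j := fun C x t => by simp [flat]
    rw [this, this, Finset.forall_mem_map]
    simp only [h1, Equiv.coe_toEmbedding]
  have hr : ∀ x : A.intersections, ∃ s, A.flat s = x := fun x => x.2
  choose s hs using hr
  let f : A.intersections → B.intersections :=
    fun x => ⟨B.flat ((s x).map σ.toEmbedding), flat_mem _⟩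
  have hf : ∀ x y, f x ≤ f y ↔ x ≤ y := by
    intro x y
    rw [← Subtype.coe_le_coe (x := x), ← hs x, ← hs y, hle]
    rfl
  have hsurj : Function.Surjective f := by
    rintro ⟨y, t, rfl⟩
    refine ⟨⟨A.flat (t.map σ.symm.toEmbedding), flat_mem _⟩, Subtype.ext ?_⟩
    have ht : (t.map σ.symm.toEmbedding).map σ.toEmbedding = t := by
      rw [Finset.map_map]; simp
    change B.flat _ = B.flat t
    rw [← ht]
    refine le_antisymm ((hle _ _).1 ?_) ((hle _ _).1 ?_) <;> rw [ht] <;> rw [hs]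
  let e : A.intersections ≃o B.intersections :=
    RelIso.ofSurjective (OrderEmbedding.ofMapLEIff f hf) hsurj
  exact ⟨e.dual⟩

/-- The lines are exactly the maximal flats below the whole plane, so an order isomorphism permutes
them. -/
theorem exists_line_of_orderIso (e : A.intersections ≃o B.intersections) (i : Fin d) :
    ∃ j, (e ⟨A.line i, line_mem i⟩ : Submodule ℂ (Fin 3 → ℂ)) = B.line j := by
  have hlt : ∀ {n : ℕ} (C : LineArrangement n) (x : C.intersections),
      (x : Submodule ℂ (Fin 3 → ℂ)) ≠ ⊤ → ∃ j, (x : Submodule ℂ (Fin 3 → ℂ)) ≤ C.line j := by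
    rintro n C ⟨x, s, rfl⟩ hx
    rcases s.eq_empty_or_nonempty with rfl | ⟨a, ha⟩
    · simp at hx
    · exact ⟨a, flat_le_line ha⟩
  have htop : ∀ {n : ℕ} (C : LineArrangement n), ⊤ ∈ C.intersections := fun C => ⟨∅, by simp⟩
  obtain ⟨j, hj⟩ := hlt B (e ⟨A.line i, line_mem i⟩) fun h => by
    have h1 : (⟨⊤, htop A⟩ : A.intersections) ≤ ⟨A.line i, line_mem i⟩ := by
      rw [← e.le_iff_le, ← Subtype.coe_le_coe, h]
      exact le_top
    exact line_ne_top i (top_le_iff.1 h1)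
  refine ⟨j, le_antisymm hj ?_⟩
  obtain ⟨i', hi'⟩ := hlt A (e.symm ⟨B.line j, line_mem j⟩) fun h => by
    have h1 : (⟨⊤, htop B⟩ : B.intersections) ≤ ⟨B.line j, line_mem j⟩ := by
      rw [← e.symm.le_iff_le, ← Subtype.coe_le_coe, h]
      exact le_top
    exact line_ne_top j (top_le_iff.1 h1)
  have h1 : (⟨A.line i, line_mem i⟩ : A.intersections) ≤ e.symm ⟨B.line j, line_mem j⟩ := by
    rw [← e.le_iff_le, e.apply_symm_apply]
    exact hj
  have h2 : i = i' := eq_of_line_le ((Subtype.coe_le_coe.2 h1).trans hi')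
  have h3 : e.symm ⟨B.line j, line_mem j⟩ ≤ ⟨A.line i, line_mem i⟩ := by
    rw [← Subtype.coe_le_coe, h2]; exact hi'
  rw [← e.le_iff_le, e.apply_symm_apply] at h3
  exact h3

theorem concurrent_iff_forall_intersections {i j k : Fin d} (hij : i ≠ j) :
    A.Concurrent i j k ↔ ∀ x : A.intersections, x ≤ ⟨A.line i, line_mem i⟩ →
      x ≤ ⟨A.line j, line_mem j⟩ → x ≤ ⟨A.line k, line_mem k⟩ := by
  rw [← line_inf_line_le hij]
  constructor
  · intro h x hi hj
    exact (le_inf (Subtype.coe_le_coe.2 hi) (Subtype.coe_le_coe.2 hj)).trans h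
  · intro h
    have hmem : A.line i ⊓ A.line j ∈ A.intersections := ⟨{i, j}, by simp [iInf_or, iInf_inf_eq]⟩
    exact h ⟨_, hmem⟩ (Subtype.coe_le_coe.1 inf_le_left) (Subtype.coe_le_coe.1 inf_le_right)

theorem SameLattice.exists_equiv (h : A.SameLattice B) :
    ∃ σ : Fin d ≃ Fin d', ∀ i j k, A.Concurrent i j k ↔ B.Concurrent (σ i) (σ j) (σ k) := by
  obtain ⟨e⟩ := h
  -- Undoes the order reversal, so that ≤ is inclusion of subspaces from here on.
  let e : A.intersections ≃o B.intersections := e.dual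
  choose σ hσ using exists_line_of_orderIso e
  choose τ hτ using exists_line_of_orderIso e.symm
  have hσ' : ∀ i, e ⟨A.line i, line_mem i⟩ = ⟨B.line (σ i), line_mem _⟩ :=
    fun i => Subtype.ext (hσ i)
  have hτ' : ∀ i, e.symm ⟨B.line i, line_mem i⟩ = ⟨A.line (τ i), line_mem _⟩ :=
    fun i => Subtype.ext (hτ i)
  have h1 : ∀ i, τ (σ i) = i := fun i => by
    have := hτ' (σ i)
    rw [← hσ', e.symm_apply_apply] at this
    exact (eq_of_line_le (le_of_eq (congrArg Subtype.val this))).symm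
  have h2 : ∀ i, σ (τ i) = i := fun i => by
    have := hσ' (τ i)
    rw [← hτ', e.apply_symm_apply] at this
    exact (eq_of_line_le (le_of_eq (congrArg Subtype.val this))).symm
  refine ⟨⟨σ, τ, h1, h2⟩, fun i j k => ?_⟩
  change _ ↔ B.Concurrent (σ i) (σ j) (σ k)
  by_cases hij : i = j
  · subst hij
    have : ∀ {n : ℕ} (C : LineArrangement n) (i k : Fin n), C.Concurrent i i k :=
      fun C i k => (concurrent_left i k).swap'
    exact iff_of_true (this _ _ _) (this _ _ _)
  · have hij' : σ i ≠ σ j := fun h => hij (by rw [← h1 i, h, h1])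
    rw [concurrent_iff_forall_intersections hij, concurrent_iff_forall_intersections hij',
      ← e.toEquiv.forall_congr_right]
    simp only [← hσ']
    exact forall_congr' fun x => by
      simp [e.le_iff_le]

theorem SameLattice.refl (A : LineArrangement d) : A.SameLattice A := ⟨OrderIso.refl _⟩

theorem SameLattice.symm (h : A.SameLattice B) : B.SameLattice A :=
  h.elim fun e => ⟨e.symm⟩

theorem SameLattice.trans {D : LineArrangement d''} (h : A.SameLattice B)
    (h' : B.SameLattice D) : A.SameLattice D :=
  h.elim fun e => h'.elim fun e' => ⟨e.trans e'⟩

theorem SameLattice.card_eq (h : A.SameLattice B) : d = d' := by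
  obtain ⟨σ, -⟩ := h.exists_equiv
  simpa using Fintype.card_congr σ

theorem IsBraid.of_equiv (hB : B.IsBraid) (σ : Fin d ≃ Fin d')
    (hσ : ∀ i j k, A.Concurrent i j k ↔ B.Concurrent (σ i) (σ j) (σ k)) : A.IsBraid := by
  obtain ⟨x, hx, h1, h2, h3, h4, hM⟩ := hB
  refine ⟨fun i => σ.symm (x i), σ.symm.bijective.comp hx, ?_, ?_, ?_, ?_, ?_⟩
  any_goals simpa [hσ]
  intro i j k l h1 h2 h3 h4 h5 h6
  rw [hσ, hσ]
  exact hM _ _ _ _ (σ.injective.ne h1) (σ.injective.ne h2) (σ.injective.ne h3)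
    (σ.injective.ne h4) (σ.injective.ne h5) (σ.injective.ne h6)

theorem IsBraid.sameLattice (hA : A.IsBraid) (hB : B.IsBraid) : A.SameLattice B := by
  obtain ⟨x, hx, h1, h2, h3, h4, hM⟩ := hA
  obtain ⟨y, hy, k1, k2, k3, k4, hN⟩ := hB
  -- A triple that is not one of the four blocks shares two elements with a block. If it were
  -- concurrent, four lines would pass through one point. So the four triple points determine the
  -- whole concurrency relation.
  have dich : ∀ i j k : Fin 6, i ≠ j → i ≠ k → j ≠ k →
      (({i, j, k} : Finset (Fin 6)) = {0, 1, 2} ∨ ({i, j, k} : Finset (Fin 6)) = {0, 3, 4} ∨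
        ({i, j, k} : Finset (Fin 6)) = {1, 3, 5} ∨ ({i, j, k} : Finset (Fin 6)) = {2, 4, 5}) ∨
      ∃ a b c l : Fin 6, ({i, j, k} : Finset (Fin 6)) = {a, b, c} ∧ a ≠ b ∧ a ≠ c ∧ a ≠ l ∧
        b ≠ c ∧ b ≠ l ∧ c ≠ l ∧
        (({a, b, l} : Finset (Fin 6)) = {0, 1, 2} ∨ ({a, b, l} : Finset (Fin 6)) = {0, 3, 4} ∨
        ({a, b, l} : Finset (Fin 6)) = {1, 3, 5} ∨ ({a, b, l} : Finset (Fin 6)) = {2, 4, 5}) := by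
    decide
  have key : ∀ {n n' : ℕ} {C : LineArrangement n} {D : LineArrangement n'} (x : Fin 6 → Fin n)
      (y : Fin 6 → Fin n'), Function.Injective x →
      C.Concurrent (x 0) (x 1) (x 2) → C.Concurrent (x 0) (x 3) (x 4) →
      C.Concurrent (x 1) (x 3) (x 5) → C.Concurrent (x 2) (x 4) (x 5) →
      (∀ i j k l, i ≠ j → i ≠ k → i ≠ l → j ≠ k → j ≠ l → k ≠ l →
        C.Concurrent i j k → ¬ C.Concurrent i j l) →
      D.Concurrent (y 0) (y 1) (y 2) → D.Concurrent (y 0) (y 3) (y 4) →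
      D.Concurrent (y 1) (y 3) (y 5) → D.Concurrent (y 2) (y 4) (y 5) →
      ∀ i j k, C.Concurrent (x i) (x j) (x k) → D.Concurrent (y i) (y j) (y k) := by
    intro n n' C D x y hx h1 h2 h3 h4 hM k1 k2 k3 k4 i j k h
    by_cases hij : i = j
    · subst hij; exact (concurrent_left _ _).swap'
    by_cases hik : i = k
    · subst hik; exact concurrent_left _ _
    by_cases hjk : j = k
    · subst hjk; exact concurrent_right _ _
    have symC := fun {a b c i j k : Fin 6} => symm_relation_of_set_eq
      (R := fun i j k => C.Concurrent (x i) (x j) (x k)) (fun _ _ _ h => h.swap)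
      (fun _ _ _ h => h.swap') (a := a) (b := b) (c := c) (i := i) (j := j) (k := k)
    have symD := fun {a b c i j k : Fin 6} => symm_relation_of_set_eq
      (R := fun i j k => D.Concurrent (y i) (y j) (y k)) (fun _ _ _ h => h.swap)
      (fun _ _ _ h => h.swap') (a := a) (b := b) (c := c) (i := i) (j := j) (k := k)
    rcases dich i j k hij hik hjk with (e | e | e | e) |
      ⟨a, b, c, l, e, hab, hac, hal, hbc, hbl, hcl, h'⟩
    · exact symD hij hik hjk e k1
    · exact symD hij hik hjk e k2
    · exact symD hij hik hjk e k3
    · exact symD hij hik hjk e k4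
    · exfalso
      have e1 : C.Concurrent (x a) (x b) (x c) := symC hab hac hbc e.symm h
      have e2 : C.Concurrent (x a) (x b) (x l) := by
        rcases h' with e | e | e | e
        · exact symC hab hal hbl e h1
        · exact symC hab hal hbl e h2
        · exact symC hab hal hbl e h3
        · exact symC hab hal hbl e h4
      exact hM _ _ _ _ (hx.ne hab) (hx.ne hac) (hx.ne hal) (hx.ne hbc) (hx.ne hbl) (hx.ne hcl)
        e1 e2
  refine sameLattice_of_concurrent ((Equiv.ofBijective x hx).symm.trans (Equiv.ofBijective y hy))
    fun i j k => ?_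
  obtain ⟨i, rfl⟩ := hx.2 i
  obtain ⟨j, rfl⟩ := hx.2 j
  obtain ⟨k, rfl⟩ := hx.2 k
  simp only [Equiv.trans_apply, Equiv.ofBijective_symm_apply_apply, Equiv.ofBijective_apply]
  exact ⟨key x y hx.1 h1 h2 h3 h4 hM k1 k2 k3 k4 i j k,
    key y x hy.1 k1 k2 k3 k4 hN h1 h2 h3 h4 i j k⟩

/-- The integral coefficients of `monomial223`. -/
def coeff223 : Fin 6 → Fin 3 → ℤ :=
  ![![1, -1, 0], ![1, 1, 0], ![1, 0, -1], ![1, 0, 1], ![0, 1, -1], ![0, 1, 1]]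

theorem concurrent_monomial223 (i j k : Fin 6) : monomial223.Concurrent i j k ↔
    coeff223 i 0 * (coeff223 j 1 * coeff223 k 2 - coeff223 j 2 * coeff223 k 1) +
    coeff223 i 1 * (coeff223 j 2 * coeff223 k 0 - coeff223 j 0 * coeff223 k 2) +
    coeff223 i 2 * (coeff223 j 0 * coeff223 k 1 - coeff223 j 1 * coeff223 k 0) = 0 := by
  have h : ∀ i j, monomial223.coeff i j = (coeff223 i j : ℂ) := by
    intro i j
    fin_cases i <;> fin_cases j <;> simp [monomial223, coeff223]
  rw [Concurrent, tripleProd_expand]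
  simp only [h]
  exact_mod_cast Iff.rfl

theorem isBraid_monomial223 : monomial223.IsBraid := by
  refine ⟨![0, 2, 4, 5, 3, 1], by decide, ?_, ?_, ?_, ?_, ?_⟩
  · rw [concurrent_monomial223]; decide
  · rw [concurrent_monomial223]; decide
  · rw [concurrent_monomial223]; decide
  · rw [concurrent_monomial223]; decide
  · simp only [concurrent_monomial223]
    decide

theorem isBraid_iff_sameLattice : A.IsBraid ↔ A.SameLattice monomial223 := by
  constructor
  · exact fun h => h.sameLattice isBraid_monomial223
  · intro h
    obtain ⟨σ, hσ⟩ := h.exists_equiv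
    exact isBraid_monomial223.of_equiv σ hσ

end LineArrangement

end

/-! ### Multiplicities of points and the final case analysis -/

section

open scoped Matrix

namespace LineArrangement

variable {d d' : ℕ} {A : LineArrangement d} {B : LineArrangement d'}

theorem submodule_le_line_iff {p : ℙ ℂ (Fin 3 → ℂ)} {i : Fin d} :
    p.submodule ≤ A.line i ↔ i ∈ A.pencil p.rep := by
  rw [p.submodule_eq, Submodule.span_singleton_le_iff_mem, mem_line_iff_mem_pencil]

theorem mult_eq_card (p : ℙ ℂ (Fin 3 → ℂ)) : A.mult p = (A.pencil p.rep).card := by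
  simp only [mult, submodule_le_line_iff]
  rw [← Set.ncard_coe_finset]
  rfl

theorem pencil_mk_rep {u : Fin 3 → ℂ} (hu : u ≠ 0) :
    A.pencil (Projectivization.mk ℂ u hu).rep = A.pencil u := by
  ext i
  rw [← submodule_le_line_iff, Projectivization.submodule_mk,
    Submodule.span_singleton_le_iff_mem, mem_line_iff_mem_pencil]

theorem eq_of_mem_pencil {p q : ℙ ℂ (Fin 3 → ℂ)} {i j : Fin d} (hij : i ≠ j)
    (hip : i ∈ A.pencil p.rep) (hjp : j ∈ A.pencil p.rep) (hiq : i ∈ A.pencil q.rep)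
    (hjq : j ∈ A.pencil q.rep) : p = q := by
  have key : ∀ r : ℙ ℂ (Fin 3 → ℂ), i ∈ A.pencil r.rep → j ∈ A.pencil r.rep →
      r = Projectivization.mk ℂ _ (cross_ne_zero (A.coeff_distinct i j hij)) := by
    intro r hi hj
    obtain ⟨c, hc⟩ :=
      eq_smul_cross (A.coeff_distinct i j hij) (mem_pencil.1 hi) (mem_pencil.1 hj)
    rw [← r.mk_rep, Projectivization.mk_eq_mk_iff']
    exact ⟨c, hc.symm⟩
  rw [key p hip hjp, key q hiq hjq]

theorem card_pencil_inter_le {p q : ℙ ℂ (Fin 3 → ℂ)} (h : p ≠ q) :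
    (A.pencil p.rep ∩ A.pencil q.rep).card ≤ 1 := by
  by_contra! hc
  obtain ⟨i, hi, j, hj, hij⟩ := Finset.one_lt_card.1 hc
  rw [Finset.mem_inter] at hi hj
  exact h (eq_of_mem_pencil hij hi.1 hj.1 hi.2 hj.2)

theorem mult_add_card_compl (p : ℙ ℂ (Fin 3 → ℂ)) :
    A.mult p + (A.pencil p.rep)ᶜ.card = d := by
  rw [mult_eq_card, Finset.card_add_card_compl, Fintype.card_fin]

theorem mult_eq_inter_add_sdiff (p q : ℙ ℂ (Fin 3 → ℂ)) :
    A.mult q = (A.pencil q.rep ∩ A.pencil p.rep).card +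
      (A.pencil q.rep \ A.pencil p.rep).card := by
  rw [mult_eq_card, Finset.card_inter_add_card_sdiff]

theorem card_sdiff_le_card_compl (p q : ℙ ℂ (Fin 3 → ℂ)) :
    (A.pencil q.rep \ A.pencil p.rep).card ≤ (A.pencil p.rep)ᶜ.card :=
  Finset.card_le_card fun i hi => by simpa using (Finset.mem_sdiff.1 hi).2

/-- Two distinct points have at most one line in common. -/
theorem mult_add_mult_le {p q : ℙ ℂ (Fin 3 → ℂ)} (h : q ≠ p) : A.mult q + A.mult p ≤ d + 1 := by
  have h1 := A.mult_eq_inter_add_sdiff p q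
  have h2 := A.card_sdiff_le_card_compl p q
  have h3 := card_pencil_inter_le (A := A) h
  have h4 := A.mult_add_card_compl p
  omega

/-- If two points attain the bound on the sum of their multiplicities, every line passes through
one of them, and some line through both. -/
theorem exists_mem_pencil_of_mult_add_mult {p q : ℙ ℂ (Fin 3 → ℂ)} (h : q ≠ p)
    (hd : d < A.mult q + A.mult p) :
    (∃ i, i ∈ A.pencil q.rep ∧ i ∈ A.pencil p.rep) ∧
      ∀ i, i ∉ A.pencil p.rep → i ∈ A.pencil q.rep := by
  have h1 := A.mult_eq_inter_add_sdiff p q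
  have h2 := A.card_sdiff_le_card_compl p q
  have h3 := card_pencil_inter_le (A := A) h
  have h4 := A.mult_add_card_compl p
  constructor
  · obtain ⟨i, hi⟩ := Finset.card_pos.1
      (show 0 < (A.pencil q.rep ∩ A.pencil p.rep).card by omega)
    exact ⟨i, Finset.mem_inter.1 hi⟩
  · intro i hi
    have : A.pencil q.rep \ A.pencil p.rep = (A.pencil p.rep)ᶜ := by
      refine Finset.eq_of_subset_of_card_le (fun i hi => by simpa using (Finset.mem_sdiff.1 hi).2) ?_
      omega
    have hi' : i ∈ A.pencil q.rep \ A.pencil p.rep := by rw [this]; simpa using hi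
    exact (Finset.mem_sdiff.1 hi').1

theorem mdr_le_sub_mult (hd : d ≠ 0) (p : ℙ ℂ (Fin 3 → ℂ)) :
    mdr A.definingPoly ≤ d - A.mult p := by
  rw [mult_eq_card]
  exact mdr_le_card_sub hd p.rep_nonzero

theorem mult_le (p : ℙ ℂ (Fin 3 → ℂ)) : A.mult p ≤ d := by
  have := A.mult_add_card_compl p
  omega

/-- This is the lower bound for `mdr`: a smaller value would be at most 1, forcing a pencil of more
than m lines. The bound `hm` covers the cases where `mdr` is at least 2 without a pencil. -/
theorem le_add_mdr_of_mult_le (hd : 4 ≤ d) {m : ℕ} (hm : d ≤ m + 2)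
    (h : ∀ p, A.mult p ≤ m) : d ≤ m + mdr A.definingPoly := by
  by_cases h2 : mdr A.definingPoly ≤ 2
  · rcases exists_pencil_or_isBraid_of_mdr_le hd h2 with ⟨u, hu, hc⟩ | ⟨h2, -⟩
    · have := h (Projectivization.mk ℂ u hu)
      rw [mult_eq_card, pencil_mk_rep] at this
      omega
    · omega
  · omega

theorem mdr_eq_sub_of_mult_le (hd : 4 ≤ d) {m : ℕ} (hm : d ≤ m + 2)
    {p : ℙ ℂ (Fin 3 → ℂ)} (hp : A.mult p = m) (h : ∀ q, A.mult q ≤ m) :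
    mdr A.definingPoly = d - m := by
  have h1 := le_add_mdr_of_mult_le hd hm h
  have h2 := A.mdr_le_sub_mult (by omega) p
  omega

theorem HasOneMultiplePoint.mdr_eq (hd : 4 ≤ d) {m : ℕ} (hm : d ≤ m + 2)
    (h : A.HasOneMultiplePoint m) : mdr A.definingPoly = d - m := by
  obtain ⟨h2, p, hp, hq⟩ := h
  refine mdr_eq_sub_of_mult_le hd hm hp fun q => ?_
  by_cases hqp : q = p
  · rw [hqp, hp]
  · exact (hq q hqp).trans h2

theorem HasTwoMultiplePointsOnLine.mdr_eq (hd : 4 ≤ d)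
    (h : A.HasTwoMultiplePointsOnLine 3 (d - 2)) : mdr A.definingPoly = 2 := by
  obtain ⟨-, h3, h4, p, p', -, hp, hp', -, hq⟩ := h
  have := mdr_eq_sub_of_mult_le (A := A) hd (m := d - 2) (by omega) hp' fun q => ?_
  · omega
  · by_cases h1 : q = p
    · rw [h1, hp]; exact h3
    by_cases h2 : q = p'
    · rw [h2, hp']
    · exact (hq q h1 h2).trans (by omega)

/-- The sharp bound is 3, but 4 = 6 - 2 is the value that `le_add_mdr_of_mult_le` requires. -/
theorem IsBraid.mult_le_four (h : A.IsBraid) (p : ℙ ℂ (Fin 3 → ℂ)) : A.mult p ≤ 4 := by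
  obtain ⟨x, -, -, -, -, -, hM⟩ := h
  by_contra! hc
  rw [mult_eq_card] at hc
  obtain ⟨i, hi⟩ := Finset.card_pos.1 (show 0 < (A.pencil p.rep).card by omega)
  obtain ⟨j, k, l, hj, hk, hl, hjk, hjl, hkl⟩ := Finset.two_lt_card_iff.1
    (show 2 < ((A.pencil p.rep).erase i).card by rw [Finset.card_erase_of_mem hi]; omega)
  rw [Finset.mem_erase] at hj hk hl
  have := fun n => mem_pencil_iff_concurrent (k := n) p.rep_nonzero hj.1.symm hi hj.2
  exact hM i j k l hj.1.symm hk.1.symm hl.1.symm hjk hjl hkl ((this k).1 hk.2) ((this l).1 hl.2)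

theorem IsBraid.card_eq (h : A.IsBraid) : d = 6 := by
  obtain ⟨x, hx, -⟩ := h
  simpa using (Fintype.card_congr (Equiv.ofBijective x hx)).symm

theorem IsBraid.mdr_eq (h : A.IsBraid) : mdr A.definingPoly = 2 := by
  have h6 := h.card_eq
  have h1 := le_add_mdr_of_mult_le (A := A) (by omega) (by omega) h.mult_le_four
  have h2 := h.isFreeCurve_and_mdr_le.2
  omega

theorem isFreeCurve_of_mult_eq (hd : d ≠ 0) {p : ℙ ℂ (Fin 3 → ℂ)} (hp : A.mult p = d) :
    IsFreeCurve A.definingPoly := by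
  refine isFreeCurve_of_concurrent hd p.rep_nonzero fun i => mem_pencil.1 ?_
  have h1 := A.mult_add_card_compl p
  have h2 : (A.pencil p.rep)ᶜ = ∅ := Finset.card_eq_zero.1 (by omega)
  rw [Finset.compl_eq_empty_iff] at h2
  rw [h2]; simp

theorem isFreeCurve_of_mult_eq_sub_one (hd : 2 ≤ d) {p : ℙ ℂ (Fin 3 → ℂ)}
    (hp : A.mult p = d - 1) : IsFreeCurve A.definingPoly := by
  have h1 := A.mult_add_card_compl p
  obtain ⟨i, hi⟩ := Finset.card_eq_one.1 (show (A.pencil p.rep)ᶜ.card = 1 by omega)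
  have key : ∀ j, j ∉ A.pencil p.rep ↔ j = i := fun j => by
    rw [← Finset.mem_compl, hi, Finset.mem_singleton]
  refine isFreeCurve_of_one_transversal hd (i₀ := i) (p := p.rep)
    (fun h => (key i).2 rfl (mem_pencil.2 h)) fun j hj => mem_pencil.1 ?_
  by_contra h
  exact hj ((key j).1 h)

theorem exists_two_transversals {p : ℙ ℂ (Fin 3 → ℂ)} (hd : 2 ≤ d) (hp : A.mult p = d - 2) :
    ∃ i j, i ≠ j ∧ ∀ k, k ∉ A.pencil p.rep ↔ k = i ∨ k = j := by
  have h1 := A.mult_add_card_compl p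
  obtain ⟨i, j, hij, hi⟩ := Finset.card_eq_two.1 (show (A.pencil p.rep)ᶜ.card = 2 by omega)
  refine ⟨i, j, hij, fun k => ?_⟩
  rw [← Finset.mem_compl, hi, Finset.mem_insert, Finset.mem_singleton]

theorem HasOneMultiplePoint.isNearlyFreeCurve (hd : 4 ≤ d)
    (h : A.HasOneMultiplePoint (d - 2)) : IsNearlyFreeCurve A.definingPoly := by
  obtain ⟨-, p, hp, hq⟩ := h
  obtain ⟨i, j, hij, key⟩ := exists_two_transversals (by omega) hp
  have hi : i ∉ A.pencil p.rep := (key i).2 (Or.inl rfl)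
  have hj : j ∉ A.pencil p.rep := (key j).2 (Or.inr rfl)
  refine isNearlyFreeCurve_of_two_transversals hd hij p.rep_nonzero
    (fun h => hi (mem_pencil.2 h)) (fun h => hj (mem_pencil.2 h))
    (fun k hki hkj => mem_pencil.1 (by_contra fun h => ?_)) fun k hk hk' => ?_
  · rcases (key k).1 h with h | h
    · exact hki h
    · exact hkj h
  · let q := Projectivization.mk ℂ _ (cross_ne_zero (A.coeff_distinct i j hij))
    have hqr : A.pencil q.rep = A.pencil (A.coeff i ⨯₃ A.coeff j) := pencil_mk_rep _
    have hqp : q ≠ p := by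
      rintro h
      apply hi
      rw [← h, hqr]
      exact mem_pencil_cross_left i j
    have h2 := hq q hqp
    rw [mult_eq_card, hqr] at h2
    have h3 : 2 < (A.pencil (A.coeff i ⨯₃ A.coeff j)).card := Finset.two_lt_card_iff.2
      ⟨i, j, k, mem_pencil_cross_left i j, mem_pencil_cross_right i j, mem_pencil.2 hk', hij,
        fun h => hi (h ▸ mem_pencil.2 hk), fun h => hj (h ▸ mem_pencil.2 hk)⟩
    omega

theorem HasTwoMultiplePointsOnLine.isFreeCurve (hd : 4 ≤ d)
    (h : A.HasTwoMultiplePointsOnLine 3 (d - 2)) : IsFreeCurve A.definingPoly := by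
  obtain ⟨-, -, -, q, p, hqp, hq, hp, -, -⟩ := h
  obtain ⟨i, j, hij, key⟩ := exists_two_transversals (by omega) hp
  obtain ⟨⟨k, hkq, hkp⟩, hall⟩ :=
    exists_mem_pencil_of_mult_add_mult (A := A) hqp (by omega)
  have hi : i ∉ A.pencil p.rep := (key i).2 (Or.inl rfl)
  have hj : j ∉ A.pencil p.rep := (key j).2 (Or.inr rfl)
  refine isFreeCurve_of_two_transversals hd hij (p := p.rep) (i₂ := k)
    (fun h => hi (mem_pencil.2 h)) (fun h => hj (mem_pencil.2 h))
    (fun k hki hkj => mem_pencil.1 (by_contra fun h => ?_)) (mem_pencil.1 hkp)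
    (mem_pencil.1 (concurrent_iff.1
      ((mem_pencil_iff_concurrent q.rep_nonzero hij (hall i hi) (hall j hj)).1 hkq)))
  rcases (key k).1 h with h | h
  · exact hki h
  · exact hkj h

/-- A large pencil gives a point p of multiplicity exactly d - `mdr`. A second point of multiplicity
at least 3 makes `mult_add_mult_le` sharp, so `mdr` is 2 and that point is the triple point where
both lines missing p meet. A third such point would contain the same two lines. -/
theorem multiple_points_of_mdr_le (hd : 4 ≤ d) (h : mdr A.definingPoly ≤ 2) :
    A.HasOneMultiplePoint (d - mdr A.definingPoly) ∨
      (mdr A.definingPoly = 2 ∧ (A.HasTwoMultiplePointsOnLine 3 (d - 2) ∨ A.IsBraid)) := by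
  rcases exists_pencil_or_isBraid_of_mdr_le hd h with ⟨u, hu, hc⟩ | ⟨h2, hB⟩
  swap
  · exact Or.inr ⟨h2, Or.inr hB⟩
  have hle : ∀ q, mdr A.definingPoly ≤ d - A.mult q := A.mdr_le_sub_mult (by omega)
  obtain ⟨p, hp⟩ : ∃ p, A.mult p = d - mdr A.definingPoly := by
    refine ⟨Projectivization.mk ℂ u hu, ?_⟩
    have h1 := hle (Projectivization.mk ℂ u hu)
    have h2 := A.mult_le (Projectivization.mk ℂ u hu)
    rw [mult_eq_card, pencil_mk_rep] at h1 h2 ⊢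
    omega
  by_cases hq : ∀ q, q ≠ p → A.mult q ≤ 2
  · exact Or.inl ⟨by omega, p, hp, hq⟩
  push Not at hq
  obtain ⟨q, hqp, hq⟩ := hq
  have h1 := A.mult_add_mult_le hqp
  have h2 := hle q
  have h3 := A.mult_le q
  have hr : mdr A.definingPoly = 2 := by omega
  rw [hr] at hp
  obtain ⟨⟨k, hkq, hkp⟩, hall⟩ :=
    exists_mem_pencil_of_mult_add_mult (A := A) hqp (by omega)
  refine Or.inr ⟨hr, Or.inl ⟨le_rfl, by omega, by omega, q, p, hqp, by omega, hp,
    ⟨k, submodule_le_line_iff.2 hkq, submodule_le_line_iff.2 hkp⟩, fun q' hq' hqp' => ?_⟩⟩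
  by_contra! hc
  obtain ⟨-, hall'⟩ := exists_mem_pencil_of_mult_add_mult (A := A) hqp' (by omega)
  obtain ⟨i, j, hij, key⟩ := exists_two_transversals (by omega) hp
  have hi : i ∉ A.pencil p.rep := (key i).2 (Or.inl rfl)
  have hj : j ∉ A.pencil p.rep := (key j).2 (Or.inr rfl)
  exact hq' (eq_of_mem_pencil hij (hall' i hi) (hall' j hj) (hall i hi) (hall j hj))

/-- Two lines through p suffice to define the image point, and concurrency with these two describes
every line through it; hence the requirement of multiplicity at least 2. -/
theorem exists_point_of_equiv (σ : Fin d ≃ Fin d')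
    (hσ : ∀ i j k, A.Concurrent i j k ↔ B.Concurrent (σ i) (σ j) (σ k)) (p : ℙ ℂ (Fin 3 → ℂ))
    (hp : 2 ≤ A.mult p) :
    ∃ q : ℙ ℂ (Fin 3 → ℂ), B.pencil q.rep = (A.pencil p.rep).map σ.toEmbedding := by
  rw [mult_eq_card] at hp
  obtain ⟨i, hi, j, hj, hij⟩ := Finset.one_lt_card.1 hp
  refine ⟨Projectivization.mk ℂ _
    (cross_ne_zero (B.coeff_distinct (σ i) (σ j) (σ.injective.ne hij))), ?_⟩
  ext k
  obtain ⟨k, rfl⟩ := σ.surjective k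
  rw [pencil_mk_rep, ← concurrent_iff, ← hσ, ← mem_pencil_iff_concurrent p.rep_nonzero hij hi hj]
  simp

theorem eq_of_pencil_eq {p q : ℙ ℂ (Fin 3 → ℂ)} (hp : 2 ≤ A.mult p)
    (h : A.pencil p.rep = A.pencil q.rep) : p = q := by
  rw [mult_eq_card] at hp
  obtain ⟨i, hi, j, hj, hij⟩ := Finset.one_lt_card.1 hp
  exact eq_of_mem_pencil hij hi hj (h ▸ hi) (h ▸ hj)

/-- An isomorphism of intersection lattices matches the multiple points and the lines through
them. -/
theorem SameLattice.exists_equiv_pencil (h : A.SameLattice B) :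
    ∃ σ : Fin d ≃ Fin d',
      (∀ p : ℙ ℂ (Fin 3 → ℂ), 2 ≤ A.mult p →
        ∃ q : ℙ ℂ (Fin 3 → ℂ), B.pencil q.rep = (A.pencil p.rep).map σ.toEmbedding) ∧
      ∀ q : ℙ ℂ (Fin 3 → ℂ), 2 ≤ B.mult q →
        ∃ p : ℙ ℂ (Fin 3 → ℂ), B.pencil q.rep = (A.pencil p.rep).map σ.toEmbedding := by
  obtain ⟨σ, hσ⟩ := h.exists_equiv
  refine ⟨σ, exists_point_of_equiv σ hσ, fun q hq => ?_⟩
  obtain ⟨p, hp⟩ := exists_point_of_equiv (A := B) (B := A) σ.symm (fun i j k => by simp [hσ]) q hq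
  refine ⟨p, ?_⟩
  rw [hp, Finset.map_map]
  simp

theorem mult_eq_of_pencil_eq_map {σ : Fin d ≃ Fin d'} {p q : ℙ ℂ (Fin 3 → ℂ)}
    (h : B.pencil q.rep = (A.pencil p.rep).map σ.toEmbedding) : B.mult q = A.mult p := by
  rw [mult_eq_card, mult_eq_card, h, Finset.card_map]

theorem HasOneMultiplePoint.of_sameLattice {m : ℕ} (hA : A.HasOneMultiplePoint m)
    (h : A.SameLattice B) : B.HasOneMultiplePoint m := by
  obtain ⟨h2, p, hp, hq⟩ := hA
  obtain ⟨σ, h1, h1'⟩ := h.exists_equiv_pencil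
  obtain ⟨p', hp'⟩ := h1 p (by omega)
  refine ⟨h2, p', by rw [mult_eq_of_pencil_eq_map hp', hp], fun q hqp => ?_⟩
  by_contra! hc
  obtain ⟨q', hq'⟩ := h1' q (by omega)
  have h3 := mult_eq_of_pencil_eq_map hq'
  obtain rfl : q' = p := by
    by_contra hne
    have := hq q' hne
    omega
  exact hqp (eq_of_pencil_eq (A := B) (by omega) (hq'.trans hp'.symm))

theorem HasTwoMultiplePointsOnLine.of_sameLattice {m₁ m₂ : ℕ}
    (hA : A.HasTwoMultiplePointsOnLine m₁ m₂) (h : A.SameLattice B) :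
    B.HasTwoMultiplePointsOnLine m₁ m₂ := by
  obtain rfl := h.card_eq
  obtain ⟨h3, h4, hd, p₁, p₂, hne, hp₁, hp₂, ⟨i, hi₁, hi₂⟩, hq⟩ := hA
  obtain ⟨σ, h1, h1'⟩ := h.exists_equiv_pencil
  obtain ⟨p₁', hp₁'⟩ := h1 p₁ (by omega)
  obtain ⟨p₂', hp₂'⟩ := h1 p₂ (by omega)
  rw [submodule_le_line_iff] at hi₁ hi₂
  refine ⟨h3, h4, hd, p₁', p₂', ?_, by rw [mult_eq_of_pencil_eq_map hp₁', hp₁],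
    by rw [mult_eq_of_pencil_eq_map hp₂', hp₂], ⟨σ i, ?_, ?_⟩, fun q hq₁ hq₂ => ?_⟩
  · rintro rfl
    exact hne (eq_of_pencil_eq (A := A) (by omega)
      (Finset.map_injective σ.toEmbedding (hp₁'.symm.trans hp₂')))
  · rw [submodule_le_line_iff, hp₁']
    simpa using hi₁
  · rw [submodule_le_line_iff, hp₂']
    simpa using hi₂
  · by_contra! hc
    obtain ⟨q', hq'⟩ := h1' q (by omega)
    have h5 := mult_eq_of_pencil_eq_map hq'
    by_cases e₁ : q' = p₁
    · subst e₁
      exact hq₁ (eq_of_pencil_eq (A := B) (by omega) (hq'.trans hp₁'.symm))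
    by_cases e₂ : q' = p₂
    · subst e₂
      exact hq₂ (eq_of_pencil_eq (A := B) (by omega) (hq'.trans hp₂'.symm))
    have := hq q' e₁ e₂
    omega

theorem hasLatticeL_iff {m : ℕ} : A.HasLatticeL m ↔ A.HasOneMultiplePoint m :=
  ⟨fun ⟨_, hB, h⟩ => hB.of_sameLattice h.symm, fun h => ⟨A, h, SameLattice.refl A⟩⟩

theorem hasLatticeLHat_iff {m₁ m₂ : ℕ} :
    A.HasLatticeLHat m₁ m₂ ↔ A.HasTwoMultiplePointsOnLine m₁ m₂ :=
  ⟨fun ⟨_, hB, h⟩ => hB.of_sameLattice h.symm, fun h => ⟨A, h, SameLattice.refl A⟩⟩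

theorem IsBraid.of_sameLattice (hA : A.IsBraid) (h : A.SameLattice B) : B.IsBraid :=
  isBraid_iff_sameLattice.2 (h.symm.trans (isBraid_iff_sameLattice.1 hA))

/-- Arrangements with `mdr ≤ 2` are free or nearly free, and all arrangements with the same
lattice share `mdr` and this property. -/
theorem sameLattice_invariance_of_mdr_le (hd : 4 ≤ d) (h : mdr A.definingPoly ≤ 2) :
    (∀ {d' : ℕ} (B : LineArrangement d'), A.SameLattice B →
      mdr B.definingPoly = mdr A.definingPoly ∧ IsFreeCurve B.definingPoly) ∨
    ∀ {d' : ℕ} (B : LineArrangement d'), A.SameLattice B →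
      mdr B.definingPoly = mdr A.definingPoly ∧ IsNearlyFreeCurve B.definingPoly := by
  rcases multiple_points_of_mdr_le hd h with h1 | ⟨h2, h1 | h1⟩
  · by_cases h2 : mdr A.definingPoly = 2
    · refine Or.inr fun {d'} B hB => ?_
      obtain rfl := hB.card_eq
      have hB' := h1.of_sameLattice hB
      refine ⟨(hB'.mdr_eq hd (by omega)).trans (by omega), ?_⟩
      rw [h2] at hB'
      exact hB'.isNearlyFreeCurve hd
    · refine Or.inl fun {d'} B hB => ?_
      obtain rfl := hB.card_eq
      have hB' := h1.of_sameLattice hB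
      refine ⟨(hB'.mdr_eq hd (by omega)).trans (by omega), ?_⟩
      obtain ⟨-, p, hp, -⟩ := hB'
      obtain h0 | h0 : mdr A.definingPoly = 0 ∨ mdr A.definingPoly = 1 := by omega
      · exact isFreeCurve_of_mult_eq (by omega) (hp.trans (by omega))
      · exact isFreeCurve_of_mult_eq_sub_one (by omega) (hp.trans (by omega))
  · refine Or.inl fun {d'} B hB => ?_
    obtain rfl := hB.card_eq
    have hB' := h1.of_sameLattice hB
    exact ⟨(hB'.mdr_eq hd).trans h2.symm, hB'.isFreeCurve hd⟩
  · refine Or.inl fun {d'} B hB => ?_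
    have hB' := h1.of_sameLattice hB
    exact ⟨hB'.mdr_eq.trans h2.symm, hB'.isFreeCurve_and_mdr_le.1⟩

end LineArrangement

end

theorem corollary4p10 {d : ℕ} (hd : 4 ≤ d) (A : LineArrangement d) :
    (mdr A.definingPoly ≤ 2 →
      Xor (IsFreeCurve A.definingPoly) (IsNearlyFreeCurve A.definingPoly)) ∧
    (mdr A.definingPoly ≤ 2 →
      ∀ {d' : ℕ} (B : LineArrangement d'), A.SameLattice B →
        mdr B.definingPoly = mdr A.definingPoly ∧
        (IsFreeCurve B.definingPoly ↔ IsFreeCurve A.definingPoly) ∧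
        (IsNearlyFreeCurve B.definingPoly ↔ IsNearlyFreeCurve A.definingPoly)) ∧
    (mdr A.definingPoly = 0 ↔ A.HasLatticeL d) ∧
    (mdr A.definingPoly = 1 ↔ A.HasLatticeL (d - 1)) ∧
    (mdr A.definingPoly = 2 ↔
      A.HasLatticeL (d - 2) ∨ A.HasLatticeLHat 3 (d - 2) ∨
        A.SameLattice LineArrangement.monomial223) := by

  refine ⟨fun h => ?_, fun h d' B hB => ?_, ?_, ?_, ?_⟩
  · rcases LineArrangement.sameLattice_invariance_of_mdr_le hd h with hA | hA
    · have hf := (hA A (.refl A)).2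
      exact Or.inl ⟨hf, not_isNearlyFreeCurve_of_isFreeCurve hf⟩
    · have hf := (hA A (.refl A)).2
      exact Or.inr ⟨hf, fun h => not_isNearlyFreeCurve_of_isFreeCurve h hf⟩
  · rcases LineArrangement.sameLattice_invariance_of_mdr_le hd h with hA | hA
    · have hf := (hA A (.refl A)).2
      obtain ⟨hm, hg⟩ := hA B hB
      exact ⟨hm, iff_of_true hg hf, iff_of_false (not_isNearlyFreeCurve_of_isFreeCurve hg)
        (not_isNearlyFreeCurve_of_isFreeCurve hf)⟩
    · have hf := (hA A (.refl A)).2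
      obtain ⟨hm, hg⟩ := hA B hB
      exact ⟨hm, iff_of_false (fun h => not_isNearlyFreeCurve_of_isFreeCurve h hg)
        (fun h => not_isNearlyFreeCurve_of_isFreeCurve h hf), iff_of_true hg hf⟩
  all_goals simp only [LineArrangement.hasLatticeL_iff, LineArrangement.hasLatticeLHat_iff,
    ← LineArrangement.isBraid_iff_sameLattice]
  · refine ⟨fun h => ?_, fun h => (h.mdr_eq hd (by omega)).trans (by omega)⟩
    rcases LineArrangement.multiple_points_of_mdr_le hd (A := A) (by omega) with h1 | ⟨h2, -⟩
    · rwa [h] at h1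
    · omega
  · refine ⟨fun h => ?_, fun h => (h.mdr_eq hd (by omega)).trans (by omega)⟩
    rcases LineArrangement.multiple_points_of_mdr_le hd (A := A) (by omega) with h1 | ⟨h2, -⟩
    · rwa [h] at h1
    · omega
  · constructor
    · intro h
      rcases LineArrangement.multiple_points_of_mdr_le hd (A := A) (by omega) with h1 | ⟨-, h1⟩
      · rw [h] at h1
        exact Or.inl h1
      · exact Or.inr h1
    · rintro (h | h | h)
      · exact (h.mdr_eq hd (by omega)).trans (by omega)
      · exact h.mdr_eq hd
      · exact h.mdr_eq
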